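/- **Shadowing properties.** Let $\varphi$ be a continuous flow on a metric space $(X,d)$ and let $\Delta\ge 0$. Let $\mathrm{Rep}(\Delta)$ be the set of increasing homeomorphisms $h:\mathbb R\to\mathbb R$ with $h(0)=0$ and $\left|\frac{h(s)-h(t)}{s-t}-1\right|\le\Delta$ for all $s\ne t$. For a sequence $(x_i,t_i)_{i\in\mathbb Z}$ in $X\times\mathbb R$ put $A_i=d(\varphi(t_i,x_i),x_{i+1})$, $s_n=\sum_{i=0}^{n-1}t_i$ and $s_{-n}=\sum_{i=-n}^{-1}t_i$ for $n\ge 0$. For $p\in X$ and $h\in\mathrm{Rep}(\Delta)$ put $G_i^+=\int_{s_i}^{s_{i+1}}d(\varphi(h(t),p),\varphi(t-s_i,x_i))\,dt$ for $i\ge0$, and $G_i^-=\int_{-s_{-i}}^{-s_{-i+1}}d(\varphi(h(t),p),\varphi(t+s_{-i},x_{-i}))\,dt$ for $i\ge1$ (the interval of length $t_{-i}$ ending at $-s_{-(i-1)}$). * $\varphi$ has the *$\Delta$-average shadowing property* if for every $\epsilon>0$ there is $\delta>0$ such that every sequence with all $t_i\ge1$ for which there is $N\geq 1$ with $\frac1n\sum_{i=1}^nA_{i+k}<\delta$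 for all $n\ge N$, $k\in\mathbb Z$, is positively and negatively shadowed: there are $p\in X$, $h\in\mathrm{Rep}(\Delta)$ with $\limsup_n\frac1n\sum_{i=1}^nG_i^+<\epsilon$, and there are $p\in X$, $h\in\mathrm{Rep}(\Delta)$ with $\limsup_n\frac1n\sum_{i=1}^nG_i^-<\epsilon$. * $\varphi$ has the *$\Delta$-limit shadowing property* if for every sequence with all $t_i>1$ and $\lim_{|i|\to\infty}A_i=0$ there are $p,h$ with $\lim_iG_i^+=0$, and $p,h$ with $\lim_iG_i^-=0$. * $\varphi$ has the *$\Delta$-asymptotic average shadowing property* if for every sequence with all $t_i\ge1$ and $\lim_n\frac1n\sum_{i=-n}^nA_i=0$ there are $p,h$ with $\lim_n\frac1n\sum_{i=0}^nG_i^+=0$, and $p,h$ with $\lim_n\frac1n\sum_{i=1}^nG_i^-=0$. **Geometric Lorenz flows.** A geometric Lorenz flow is given by the complete flow $\varphi$ of a $C^1$ vector field $Y$ on $\mathbb R^3$, commuting with the rotation by $\pi$ around the $z$-axis, such that: * $Y(0)=0$, and $DY(0)$ has eigenvalues $\lambda_1,\lambda_2,\lambda_3$ with $0<-\lambda_3<\lambda_1<-\lambda_2$,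 the $z$-axis being the eigendirection of $\lambda_3$. There are continuous coordinates $(x,y,z)$ around $0$ (a homeomorphism of an open neighbourhood of $0$ onto an open set containing $[-1,1]^3$, with $0\mapsto0$) in which $\varphi$ is the linear flow $x'=\lambda_1x,\ y'=\lambda_2y,\ z'=\lambda_3z$. In these coordinates let $S=\{(x,y,1):|x|,|y|\le\frac12\}$, $S^*=S\setminus\{x=0\}$ and $\mathcal F_c=\{(c,y,1):|y|\le\frac12\}$. * Every point of $S^*$ returns to $S$ at a first positive time, and the first return map is $P(x,y)=(f(x),g(x,y))$ with $|f|\le\frac12$, $|g|<\frac12$, $P(-x,-y)=-P(x,y)$; $f'(x)\ge\lambda>\sqrt2$ for $x\ne0$ and $f'(x)\to\infty$ as $x\to0$; $0<\partial g/\partial y<\rho<1$ for constants $\lambda,\rho$, and $\partial g/\partial y\to0$ as $x\to0$. * The points $(\pm1,0,0)$ on the two unstable branches of $0$ reach $S$, and the transit time from the exit faces $\Sigma^\pm\subset\{x=\pm1\}$ (the sets of first points with $|x|=1$ on the orbits starting in $S^*$) to $S$ extends continuously to these vertices. * There is a compact $U\supset S$ with $\varphi_t(U)\subset\mathrm{int}\,U$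 for $t>0$, such that the positive orbit of each point of $U$ meets $S$ or converges to $0$. Its attractor is $\Lambda=\bigcap_{t\ge0}\varphi_t(U)$. Write $L^\pm=\mathcal F_{\pm1/2}$ and $f(\mathcal F_c)=\mathcal F_{f(c)}$. **Theorem.** Let $\varphi$ be a geometric Lorenz flow with attractor $\Lambda$ such that $f(L^+)\ne L^+$ or $f(L^-)\ne L^-$. Then for every $\Delta\ge0$ the flow $(\Lambda,\varphi|_\Lambda)$, with the Euclidean metric, has neither the $\Delta$-average shadowing property, nor the $\Delta$-limit shadowing property, nor the $\Delta$-asymptotic average shadowing property. The same holds for the restriction of $\varphi$ to any $\varphi$-invariant set $X$ with $\Lambda\subseteq X\subseteq\mathbb R^3$. -/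

import Mathlib

open Set Filter Topology

noncomputable section

/-! ### Shadowing properties of a flow on a metric space -/

namespace Shadowing

/-- `Rep(Δ)`: increasing homeomorphisms `h` of the line (these are exactly the order
isomorphisms) with `h 0 = 0` and `|(h s - h t) / (s - t) - 1| ≤ Δ` whenever `s ≠ t`. -/
def Rep (Δ : ℝ) : Set (ℝ ≃o ℝ) :=
  {h | h 0 = 0 ∧ ∀ s t : ℝ, s ≠ t → |(h s - h t) / (s - t) - 1| ≤ Δ}

/-- `s_n = t_0 + ⋯ + t_{n-1}`. -/
def posTime (t : ℤ → ℝ) (n : ℕ) : ℝ := ∑ i ∈ Finset.range n, t (i : ℤ)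

/-- `s_{-n} = t_{-n} + ⋯ + t_{-1}`. -/
def negTime (t : ℤ → ℝ) (n : ℕ) : ℝ := ∑ i ∈ Finset.range n, t (-((i : ℤ) + 1))

variable {X : Type*} [MetricSpace X]

/-- The one-step error `d(φ(t_i, x_i), x_{i+1})`. -/
def jump (φ : Flow ℝ X) (x : ℤ → X) (t : ℤ → ℝ) (i : ℤ) : ℝ := dist (φ (t i) (x i)) (x (i + 1))

/-- The integral of `d(φ(h(u), p), φ(u - s_i, x_i))` over `[s_i, s_{i+1}]`, for `i ≥ 0`. -/
def posGap (φ : Flow ℝ X) (x : ℤ → X) (t : ℤ → ℝ) (h : ℝ ≃o ℝ) (p : X) (i : ℕ) : ℝ :=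
  ∫ u in (posTime t i)..(posTime t (i + 1)),
    dist (φ (h u) p) (φ (u - posTime t i) (x (i : ℤ)))

/-- The corresponding integral over the `i`-th interval `[-s_{-i}, -s_{-i+1}]` to the left of `0`,
for `i ≥ 1`; there the pseudo-orbit is `u ↦ φ(u + s_{-i}, x_{-i})`. (Only used for `i ≥ 1`.) -/
def negGap (φ : Flow ℝ X) (x : ℤ → X) (t : ℤ → ℝ) (h : ℝ ≃o ℝ) (p : X) (i : ℕ) : ℝ :=
  ∫ u in (-negTime t i)..(-negTime t (i - 1)),
    dist (φ (h u) p) (φ (u + negTime t i) (x (-(i : ℤ))))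

/-- `δ`-average-pseudo orbits. -/
def IsAveragePseudoOrbit (φ : Flow ℝ X) (δ : ℝ) (x : ℤ → X) (t : ℤ → ℝ) : Prop :=
  (∀ i, 1 ≤ t i) ∧ ∃ N : ℕ, 0 < N ∧ ∀ n : ℕ, N ≤ n → ∀ k : ℤ,
    (1 / (n : ℝ)) * ∑ i ∈ Finset.Icc 1 n, jump φ x t ((i : ℤ) + k) < δ

/-- The limit superior is taken in the extended reals, since the averages may be unbounded. -/
def PosShadowedInAverage (φ : Flow ℝ X) (Δ ε : ℝ) (x : ℤ → X) (t : ℤ → ℝ) (p : X) : Prop :=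
  ∃ h ∈ Rep Δ, limsup (fun n : ℕ =>
    (((1 / (n : ℝ)) * ∑ i ∈ Finset.Icc 1 n, posGap φ x t h p i : ℝ) : EReal)) atTop < (ε : EReal)

def NegShadowedInAverage (φ : Flow ℝ X) (Δ ε : ℝ) (x : ℤ → X) (t : ℤ → ℝ) (p : X) : Prop :=
  ∃ h ∈ Rep Δ, limsup (fun n : ℕ =>
    (((1 / (n : ℝ)) * ∑ i ∈ Finset.Icc 1 n, negGap φ x t h p i : ℝ) : EReal)) atTop < (ε : EReal)

/-- The `Δ`-average shadowing property. -/
def HasASP (φ : Flow ℝ X) (Δ : ℝ) : Prop :=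
  ∀ ε : ℝ, 0 < ε → ∃ δ : ℝ, 0 < δ ∧ ∀ (x : ℤ → X) (t : ℤ → ℝ), IsAveragePseudoOrbit φ δ x t →
    (∃ p, PosShadowedInAverage φ Δ ε x t p) ∧ (∃ p, NegShadowedInAverage φ Δ ε x t p)

/-- Limit-pseudo orbits; `cofinite` on `ℤ` means `|i| → ∞`. -/
def IsLimitPseudoOrbit (φ : Flow ℝ X) (x : ℤ → X) (t : ℤ → ℝ) : Prop :=
  (∀ i, 1 < t i) ∧ Tendsto (jump φ x t) cofinite (𝓝 0)

def PosShadowedInLimit (φ : Flow ℝ X) (Δ : ℝ) (x : ℤ → X) (t : ℤ → ℝ) (p : X) : Prop :=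
  ∃ h ∈ Rep Δ, Tendsto (posGap φ x t h p) atTop (𝓝 0)

def NegShadowedInLimit (φ : Flow ℝ X) (Δ : ℝ) (x : ℤ → X) (t : ℤ → ℝ) (p : X) : Prop :=
  ∃ h ∈ Rep Δ, Tendsto (negGap φ x t h p) atTop (𝓝 0)

/-- The `Δ`-limit shadowing property. -/
def HasLSP (φ : Flow ℝ X) (Δ : ℝ) : Prop :=
  ∀ (x : ℤ → X) (t : ℤ → ℝ), IsLimitPseudoOrbit φ x t →
    (∃ p, PosShadowedInLimit φ Δ x t p) ∧ (∃ p, NegShadowedInLimit φ Δ x t p)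

/-- Asymptotic average-pseudo orbits. -/
def IsAsymptoticAveragePseudoOrbit (φ : Flow ℝ X) (x : ℤ → X) (t : ℤ → ℝ) : Prop :=
  (∀ i, 1 ≤ t i) ∧ Tendsto (fun n : ℕ =>
    (1 / (n : ℝ)) * ∑ i ∈ Finset.Icc (-(n : ℤ)) (n : ℤ), jump φ x t i) atTop (𝓝 0)

def PosAsymptoticallyShadowed (φ : Flow ℝ X) (Δ : ℝ) (x : ℤ → X) (t : ℤ → ℝ) (p : X) : Prop :=
  ∃ h ∈ Rep Δ, Tendsto (fun n : ℕ =>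
    (1 / (n : ℝ)) * ∑ i ∈ Finset.Icc 0 n, posGap φ x t h p i) atTop (𝓝 0)

def NegAsymptoticallyShadowed (φ : Flow ℝ X) (Δ : ℝ) (x : ℤ → X) (t : ℤ → ℝ) (p : X) : Prop :=
  ∃ h ∈ Rep Δ, Tendsto (fun n : ℕ =>
    (1 / (n : ℝ)) * ∑ i ∈ Finset.Icc 1 n, negGap φ x t h p i) atTop (𝓝 0)

/-- The `Δ`-asymptotic average shadowing property. -/
def HasAASP (φ : Flow ℝ X) (Δ : ℝ) : Prop :=
  ∀ (x : ℤ → X) (t : ℤ → ℝ), IsAsymptoticAveragePseudoOrbit φ x t →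
    (∃ p, PosAsymptoticallyShadowed φ Δ x t p) ∧ (∃ p, NegAsymptoticallyShadowed φ Δ x t p)

end Shadowing

/-! ### Geometric Lorenz flows -/

namespace Lorenz

/-- Euclidean three-space. -/
abbrev E3 : Type := EuclideanSpace ℝ (Fin 3)

/-- The time-`t` map of the linear system `x' = a x`, `y' = b y`, `z' = c z`. -/
def linearFlow (a b c t : ℝ) (v : E3) : E3 :=
  !₂[Real.exp (a * t) * v 0, Real.exp (b * t) * v 1, Real.exp (c * t) * v 2]

/-- The rotation by `π` around the `z`-axis. -/
def halfTurn (v : E3) : E3 := !₂[-v 0, -v 1, v 2]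

/-- The range `[-1/2, 1/2]` of the coordinates on the cross-section. -/
def I : Set ℝ := Icc (-(1 / 2)) (1 / 2)

/-- The cross-section `{(x, y, 1) : |x| ≤ 1/2, |y| ≤ 1/2}` in the coordinates of `chart`. -/
def sectionOf (chart : OpenPartialHomeomorph E3 E3) : Set E3 :=
  {p | ∃ x ∈ I, ∃ y ∈ I, p = chart.symm !₂[x, y, 1]}

/-- A geometric Lorenz flow: a complete flow on `ℝ³` of a `C¹` vector field, with the singularity
at the origin, linearizing coordinates around it, a cross-section `S`, the return map
`P(x, y) = (f(x), g(x, y))` of `S` minus its singular leaf `{x = 0}`, and a trapping region. -/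
structure GeometricLorenzFlow where
  /-- The vector field and its flow. -/
  Y : E3 → E3
  contDiff_Y : ContDiff ℝ 1 Y
  flow : Flow ℝ E3
  hasDerivAt_flow : ∀ (t : ℝ) (p : E3), HasDerivAt (fun s => flow s p) (Y (flow t p)) t
  /-- The symmetry of the flow. -/
  symm_flow : ∀ (t : ℝ) (p : E3), flow t (halfTurn p) = halfTurn (flow t p)
  /-- The eigenvalues of the singularity at the origin; the `z`-axis belongs to `l₃`. -/
  l₁ : ℝ
  l₂ : ℝ
  l₃ : ℝ
  l₃_neg : 0 < -l₃
  l₃_lt : -l₃ < l₁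
  l₁_lt : l₁ < -l₂
  Y_zero : Y 0 = 0
  eigen₁ : Module.End.HasEigenvalue (fderiv ℝ Y 0 : E3 →ₗ[ℝ] E3) l₁
  eigen₂ : Module.End.HasEigenvalue (fderiv ℝ Y 0 : E3 →ₗ[ℝ] E3) l₂
  eigen₃ : fderiv ℝ Y 0 !₂[0, 0, 1] = l₃ • (!₂[0, 0, 1] : E3)
  /-- Linearizing coordinates, defined on a region that contains (in these coordinates) the cube
  `[-1, 1]³`: as long as a linear orbit stays in the coordinate domain, it is an orbit of the
  flow. -/
  chart : OpenPartialHomeomorph E3 E3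
  zero_mem_source : (0 : E3) ∈ chart.source
  chart_zero : chart 0 = 0
  cube_subset : ∀ v : E3, (∀ i, |v i| ≤ 1) → v ∈ chart.target
  linear : ∀ (v : E3) (t : ℝ), 0 ≤ t →
    (∀ s ∈ Icc 0 t, linearFlow l₁ l₂ l₃ s v ∈ chart.target) →
    flow t (chart.symm v) = chart.symm (linearFlow l₁ l₂ l₃ t v)
  /-- The first return map to the cross-section: every point off the singular leaf returns, and
  leaves `{x = const}` are mapped into leaves. The return time is `ret`. -/
  f : ℝ → ℝ
  g : ℝ → ℝ → ℝ
  ret : ℝ → ℝ → ℝ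
  f_mem : ∀ x ∈ I, x ≠ 0 → f x ∈ I
  g_mem : ∀ x ∈ I, x ≠ 0 → ∀ y ∈ I, g x y ∈ interior I
  ret_pos : ∀ x ∈ I, x ≠ 0 → ∀ y ∈ I, 0 < ret x y
  return_eq : ∀ x ∈ I, x ≠ 0 → ∀ y ∈ I,
    flow (ret x y) (chart.symm !₂[x, y, 1]) = chart.symm !₂[f x, g x y, 1]
  return_first : ∀ x ∈ I, x ≠ 0 → ∀ y ∈ I, ∀ t, 0 < t → t < ret x y →
    flow t (chart.symm !₂[x, y, 1]) ∉ sectionOf chart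
  /-- The symmetry `P(-x, -y) = -P(x, y)`. -/
  f_odd : ∀ x ∈ I, x ≠ 0 → f (-x) = -f x
  g_odd : ∀ x ∈ I, x ≠ 0 → ∀ y ∈ I, g (-x) (-y) = -g x y
  /-- Expansion transversally to the leaves. -/
  f' : ℝ → ℝ
  lam : ℝ
  sqrt_two_lt : Real.sqrt 2 < lam
  hasDeriv_f : ∀ x ∈ I, x ≠ 0 → HasDerivWithinAt f (f' x) I x
  lam_le : ∀ x ∈ I, x ≠ 0 → lam ≤ f' x
  f'_tendsto : Tendsto f' (𝓝[I \ {0}] 0) atTop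
  /-- Contraction along the leaves; `gy` is the partial derivative of `g` in `y`. -/
  gy : ℝ → ℝ → ℝ
  rate : ℝ
  rate_lt : rate < 1
  hasDeriv_g : ∀ x ∈ I, x ≠ 0 → ∀ y ∈ I, HasDerivWithinAt (g x) (gy x y) I y
  gy_pos : ∀ x ∈ I, x ≠ 0 → ∀ y ∈ I, 0 < gy x y
  gy_lt : ∀ x ∈ I, x ≠ 0 → ∀ y ∈ I, gy x y < rate
  gy_tendsto : ∀ y ∈ I, Tendsto (fun x => gy x y) (𝓝[I \ {0}] 0) (𝓝 0)
  /-- The flow takes the exit faces `Σ^±` (inside `{x = ±1}`) to `S`, vertices included: the points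
  `(±1, 0, 0)` of the two unstable branches of the singularity reach `S`, and the time from the
  exit face to `S` extends continuously to them. (The point `(x, y, 1)` of `S` reaches the
  exit face at time `-log |x| / l₁`, and `Real.log x` is `log |x|`.) -/
  exitTime_pos : ∃ T : ℝ, 0 < T ∧ flow T (chart.symm !₂[1, 0, 0]) ∈ sectionOf chart ∧
    Tendsto (fun q : ℝ × ℝ => ret q.1 q.2 + Real.log q.1 / l₁) (𝓝[I ∩ Ioi 0] 0 ×ˢ 𝓟 I) (𝓝 T)
  exitTime_neg : ∃ T : ℝ, 0 < T ∧ flow T (chart.symm !₂[-1, 0, 0]) ∈ sectionOf chart ∧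
    Tendsto (fun q : ℝ × ℝ => ret q.1 q.2 + Real.log q.1 / l₁) (𝓝[I ∩ Iio 0] 0 ×ˢ 𝓟 I) (𝓝 T)
  /-- The trapping region: the flow points inwards on its boundary, it contains `S`, and every
  orbit in it meets `S` in the future or converges to the singularity. -/
  U : Set E3
  isCompact_U : IsCompact U
  trapping : ∀ t : ℝ, 0 < t → flow t '' U ⊆ interior U
  section_subset : sectionOf chart ⊆ U
  section_or_singularity : ∀ p ∈ U,
    (∃ t : ℝ, 0 < t ∧ flow t p ∈ sectionOf chart) ∨ Tendsto (fun t => flow t p) atTop (𝓝 0)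

namespace GeometricLorenzFlow

variable (L : GeometricLorenzFlow)

/-- The geometric Lorenz attractor `Λ`, the intersection of the `φ_t(U)` over `t ≥ 0`. -/
def attractor : Set E3 := ⋂ t ∈ Ici (0 : ℝ), L.flow t '' L.U

/-- The leaf `F_c = {(c, y, 1) : |y| ≤ 1/2}` of the foliation of the cross-section. -/
def leaf (c : ℝ) : Set E3 := {p | ∃ y ∈ I, p = L.chart.symm !₂[c, y, 1]}

theorem isInvariant_attractor : IsInvariant L.flow L.attractor := by
  intro s p hp
  simp only [attractor, mem_iInter, mem_Ici] at hp ⊢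
  intro t ht
  obtain ⟨q, hq, hqp⟩ := hp (|s| + t) (by positivity)
  have hs : 0 ≤ s + |s| := by linarith [neg_abs_le s]
  refine ⟨L.flow (s + |s|) q, ?_, ?_⟩
  · rcases hs.eq_or_lt with h | h
    · rw [← h, L.flow.map_zero_apply]; exact hq
    · exact interior_subset (L.trapping _ h ⟨q, hq, rfl⟩)
  · rw [← hqp, ← L.flow.map_add, ← L.flow.map_add]
    congr 1
    ring

end GeometricLorenzFlow

end Lorenz

end

/-! Let `b` be the limit of `f` at `0` from the left. An orbit that crosses the section left of the
singular leaf returns to a leaf strictly below `b`, and `f` preserves order along a common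
itinerary. So the later itinerary of a true orbit is bounded by that of `b`. A pseudo-orbit is not
bound in this way: near the singularity it may switch between different orbits at negligible cost.

A bad loop exploits this. It starts near `0`, on an orbit coming from a leaf just left of `{x = 0}`,
which then accompanies `b`. If `f^[m] b = 0` for a first `m`, that orbit comes back close to the
singularity, and the loop jumps there to an orbit from a leaf `z > 0`. A follower starting on the
leaf `y < 0` would need `f^[m] (f y) > 0`, while `f y < b` forces it to be negative. If the orbit of
`b` avoids `0`, choose `z` slightly right of `f b` whose itinerary up to its arrival at `0` is
realized by no point left of `f b` (`exists_unrealized_itinerary`). The jump is made after many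
returns, when contraction along the leaves has made the distance small. A follower has `f (f y) < f
b`, a contradiction again. In both cases the loop ends on the singular leaf and converges to `0`, so
loops can be concatenated. They lie in the attractor because all leaves with `|x| < b` meet it
(`exists_sec_mem_attractor`).

By the oddness of `f`, the hypothesis on the outer leaves amounts to `f (1/2) < 1/2`. This keeps
return points off the edges of the section and gives `f b < b`, which leaves room for `z`.

It remains to see that closeness in space reproduces itineraries although time is reparametrized by
`h`, about which only the Lipschitz constant `1 + Δ` is used. This rests on `exists_separation`: in
the middle of an excursion an orbit stays away from all return points. `Shadow.passage` then shows
that a follower leaves the cube on the right side and neither misses nor gains a return.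

Concatenated loops with errors `1/(i+1)` form a limit-pseudo orbit, hence a pseudo-orbit in all
three senses. Positive shadowing of any of the three kinds makes the mean gap small, so there are
three consecutive segments with small gap (`exists_block_lt`), on which closeness is uniform
(`exists_uniform_close`). The first of them ends on the singular leaf and aligns the follower with
the section; the other two are a bad loop. -/

namespace Lorenz

theorem mem_I {x : ℝ} : x ∈ I ↔ -(1 / 2) ≤ x ∧ x ≤ 1 / 2 := Iff.rfl

theorem neg_mem_I {x : ℝ} (hx : x ∈ I) : -x ∈ I := by
  rw [mem_I] at *; constructor <;> linarith [hx.1, hx.2]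

theorem isCompact_I : IsCompact I := isCompact_Icc

theorem abs_le_of_mem_I {x : ℝ} (hx : x ∈ I) : |x| ≤ 1 / 2 := abs_le.2 hx

theorem zero_mem_I : (0 : ℝ) ∈ I := by rw [mem_I]; norm_num

theorem interior_I : interior I = Ioo (-(1 / 2)) (1 / 2) := interior_Icc

theorem tendsto_nhdsWithin_I {x : ℝ} (hx : x ∈ interior I) : 𝓝[I] x = 𝓝 x :=
  nhdsWithin_eq_nhds.2 (mem_interior_iff_mem_nhds.1 hx)

/-! ### The one-dimensional map `f`: expansion, order and itineraries. -/

namespace GeometricLorenzFlow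

variable (L : GeometricLorenzFlow)

theorem one_lt_lam : 1 < L.lam :=
  lt_of_lt_of_le (by rw [Real.lt_sqrt] <;> norm_num) L.sqrt_two_lt.le

/-- Mean value inequality on one branch: the sign condition keeps the discontinuity `0` out of `[x,
y]`. -/
theorem f_sub_le {x y : ℝ} (hx : x ∈ I) (hy : y ∈ I) (h : 0 < x * y) (hxy : x ≤ y) :
    L.lam * (y - x) ≤ L.f y - L.f x := by
  have h0 : ∀ z ∈ Icc x y, z ∈ I ∧ z ≠ 0 := by
    intro z hz
    refine ⟨⟨hx.1.trans hz.1, hz.2.trans hy.2⟩, ?_⟩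
    rintro rfl
    have := mul_nonneg (neg_nonneg.2 hz.1) hz.2
    nlinarith [hz.1, hz.2]
  have hsub : Icc x y ⊆ I := fun z hz => (h0 z hz).1
  have hd : ∀ z ∈ Icc x y, HasDerivWithinAt L.f (L.f' z) (Icc x y) z := fun z hz =>
    (L.hasDeriv_f z (h0 z hz).1 (h0 z hz).2).mono hsub
  refine (convex_Icc x y).mul_sub_le_image_sub_of_le_deriv
    (fun z hz => (hd z hz).continuousWithinAt) ?_ ?_ x (left_mem_Icc.2 hxy) y
    (right_mem_Icc.2 hxy) hxy
  · intro z hz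
    exact ((hd z (interior_subset hz)).mono interior_subset).differentiableWithinAt
  · intro z hz
    have : HasDerivAt L.f (L.f' z) z :=
      (hd z (interior_subset hz)).hasDerivAt (mem_interior_iff_mem_nhds.1 hz)
    rw [this.deriv]
    exact L.lam_le z (h0 z (interior_subset hz)).1 (h0 z (interior_subset hz)).2

theorem f_lt {x y : ℝ} (hx : x ∈ I) (hy : y ∈ I) (h : 0 < x * y) (hxy : x < y) :
    L.f x < L.f y := by
  nlinarith [L.f_sub_le hx hy h hxy.le, L.one_lt_lam]

theorem tendsto_f {x : ℝ} (hx : x ∈ I) (h0 : x ≠ 0) : Tendsto L.f (𝓝[I] x) (𝓝[I] (L.f x)) := by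
  refine tendsto_nhdsWithin_iff.2 ⟨(L.hasDeriv_f x hx h0).continuousWithinAt, ?_⟩
  filter_upwards [self_mem_nhdsWithin, nhdsWithin_le_nhds (isOpen_ne.mem_nhds h0)] with z hz hz0
  exact L.f_mem z hz hz0

/-- The iterates of `f` of order less than `n` do not vanish at `x`. -/
def Avoids (n : ℕ) (x : ℝ) : Prop := ∀ j < n, L.f^[j] x ≠ 0

variable {L}

theorem Avoids.mono {m n : ℕ} {x : ℝ} (h : L.Avoids n x) (hmn : m ≤ n) : L.Avoids m x :=
  fun j hj => h j (hj.trans_le hmn)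

theorem Avoids.tail {n k : ℕ} {x : ℝ} (h : L.Avoids n x) (m : ℕ) (hk : k + m ≤ n) :
    L.Avoids k (L.f^[m] x) := by
  intro j hj
  rw [← Function.iterate_add_apply]
  exact h _ (by omega)

theorem Avoids.iterate_mem {n : ℕ} {x : ℝ} (h : L.Avoids n x) (hx : x ∈ I) : L.f^[n] x ∈ I := by
  induction n with
  | zero => exact hx
  | succ n ih =>
    rw [Function.iterate_succ_apply']
    exact L.f_mem _ (ih (h.mono n.le_succ)) (h n n.lt_succ_self)

theorem Avoids.tendsto_iterate {n : ℕ} {x : ℝ} (h : L.Avoids n x) (hx : x ∈ I) :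
    Tendsto L.f^[n] (𝓝[I] x) (𝓝[I] (L.f^[n] x)) := by
  induction n with
  | zero => exact tendsto_id
  | succ n ih =>
    have h' := h.mono n.le_succ
    rw [Function.iterate_succ', Function.comp_apply]
    exact (L.tendsto_f (h'.iterate_mem hx) (h n n.lt_succ_self)).comp (ih h')

variable (L)

/-- `x` and `y` have the same `f`-itinerary for `n` steps. -/
def SameSide (n : ℕ) (x y : ℝ) : Prop := ∀ j < n, 0 < L.f^[j] x * L.f^[j] y

variable {L}

theorem SameSide.avoids {n : ℕ} {x y : ℝ} (h : L.SameSide n x y) : L.Avoids n x :=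
  fun j hj h0 => by simpa [h0] using h j hj

theorem SameSide.symm {n : ℕ} {x y : ℝ} (h : L.SameSide n x y) : L.SameSide n y x :=
  fun j hj => by rw [mul_comm]; exact h j hj

theorem SameSide.mono {m n : ℕ} {x y : ℝ} (h : L.SameSide n x y) (hmn : m ≤ n) :
    L.SameSide m x y := fun j hj => h j (hj.trans_le hmn)

theorem mul_pos_trans {a b c : ℝ} (h : 0 < a * b) (h' : 0 < b * c) : 0 < a * c := by
  have : 0 < (a * c) * (b * b) := by nlinarith [mul_pos h h']
  exact pos_of_mul_pos_left this (mul_self_nonneg b)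

theorem SameSide.trans {n : ℕ} {x y z : ℝ} (h : L.SameSide n x y) (h' : L.SameSide n y z) :
    L.SameSide n x z := fun j hj => mul_pos_trans (h j hj) (h' j hj)

/-- At each step both points lie in the same increasing branch of `f`. This turns order relations
with `b` or `f b` into restrictions on itineraries. -/
theorem SameSide.iterate_lt {n : ℕ} {x y : ℝ} (h : L.SameSide n x y) (hx : x ∈ I) (hy : y ∈ I)
    (hxy : x < y) : L.f^[n] x < L.f^[n] y := by
  induction n with
  | zero => exact hxy
  | succ n ih =>
    have h' := h.mono n.le_succ
    rw [Function.iterate_succ_apply', Function.iterate_succ_apply']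
    exact L.f_lt (h'.avoids.iterate_mem hx) (h'.symm.avoids.iterate_mem hy) (h n n.lt_succ_self)
      (ih h')

theorem Avoids.eventually_sameSide {n : ℕ} {x : ℝ} (h : L.Avoids n x) (hx : x ∈ I) :
    ∀ᶠ y in 𝓝[I] x, L.SameSide n x y := by
  have : ∀ j ∈ Finset.range n, ∀ᶠ y in 𝓝[I] x, 0 < L.f^[j] x * L.f^[j] y := by
    intro j hj
    have hj := Finset.mem_range.1 hj
    have ht := ((h.mono hj.le).tendsto_iterate hx).mono_right nhdsWithin_le_nhds
    have := (tendsto_const_nhds (x := L.f^[j] x)).mul ht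
    exact this.eventually (lt_mem_nhds (mul_self_pos.2 (h j hj)))
  filter_upwards [(Finset.eventually_all _).2 this] with y hy j hj
  exact hy j (Finset.mem_range.2 hj)

variable (L)

/-- Every interval contains a point whose orbit hits the discontinuity. -/
theorem exists_iterate_eq_zero {α β : ℝ} (hαβ : α < β) (hI : Ioo α β ⊆ I) :
    ∃ z ∈ Ioo α β, ∃ k, L.Avoids k z ∧ L.f^[k] z = 0 := by
  classical
  by_contra! hcon
  have hne : ∀ z ∈ Ioo α β, ∀ k, L.f^[k] z ≠ 0 := by
    intro z hz k hk
    have hex : ∃ k, L.f^[k] z = 0 := ⟨k, hk⟩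
    exact hcon z hz (Nat.find hex) (fun j hj => Nat.find_min hex hj) (Nat.find_spec hex)
  have hav : ∀ z ∈ Ioo α β, ∀ k, L.Avoids k z := fun z hz k j _ => hne z hz j
  -- If no iterate vanishes on the interval, the intermediate value theorem rules out a sign change
  -- of `f^[k]`, so each step expands by `lam`. The images would outgrow `I`, which has length `1`.
  have hexp : ∀ k, ∀ x ∈ Ioo α β, ∀ y ∈ Ioo α β, x < y →
      L.lam ^ k * (y - x) ≤ L.f^[k] y - L.f^[k] x := by
    intro k
    induction k with
    | zero => intro x _ y _ _; simp
    | succ k ih =>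
      intro x hx y hy hxy
      have h1 := ih x hx y hy hxy
      have hpos : 0 < L.lam := by linarith [L.one_lt_lam]
      have hlt : L.f^[k] x < L.f^[k] y := by
        have : 0 < L.lam ^ k * (y - x) := mul_pos (pow_pos hpos k) (sub_pos.2 hxy)
        linarith
      have hsign : 0 < L.f^[k] x * L.f^[k] y := by
        by_contra hle
        push Not at hle
        have hx0 : L.f^[k] x ≤ 0 := by
          by_contra h; push Not at h; nlinarith
        have hy0 : 0 ≤ L.f^[k] y := by
          by_contra h; push Not at h; nlinarith
        have hsub : Icc x y ⊆ Ioo α β := fun z hz => ⟨hx.1.trans_le hz.1, hz.2.trans_lt hy.2⟩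
        have hcont : ContinuousOn L.f^[k] (Icc x y) := fun z hz =>
          (((hav z (hsub hz) k).tendsto_iterate (hI (hsub hz))).mono_right
            nhdsWithin_le_nhds).mono_left (nhdsWithin_mono _ (hsub.trans hI))
        obtain ⟨z, hz, hz0⟩ := intermediate_value_Icc hxy.le hcont ⟨hx0, hy0⟩
        exact hne z (hsub hz) k hz0
      rw [Function.iterate_succ_apply', Function.iterate_succ_apply', pow_succ']
      have := L.f_sub_le ((hav x hx k).iterate_mem (hI hx)) ((hav y hy k).iterate_mem (hI hy))
        hsign hlt.le
      calc L.lam * L.lam ^ k * (y - x) = L.lam * (L.lam ^ k * (y - x)) := by ring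
        _ ≤ L.lam * (L.f^[k] y - L.f^[k] x) := by gcongr
        _ ≤ _ := this
  obtain ⟨x, hx1, hx2⟩ := exists_between hαβ
  obtain ⟨y, hy1, hy2⟩ := exists_between hx2
  have hx : x ∈ Ioo α β := ⟨hx1, hx2⟩
  have hy : y ∈ Ioo α β := ⟨hx1.trans hy1, hy2⟩
  obtain ⟨k, hk⟩ := pow_unbounded_of_one_lt (1 / (y - x)) L.one_lt_lam
  have h1 := hexp k x hx y hy hy1
  have h2 : 1 < L.lam ^ k * (y - x) := by
    rwa [div_lt_iff₀ (sub_pos.2 hy1)] at hk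
  have h3 := (hav x hx k).iterate_mem (hI hx)
  have h4 := (hav y hy k).iterate_mem (hI hy)
  linarith [h3.1, h4.2]

/-- To the right of any `c` there are points, arbitrarily close to `c`, that hit the discontinuity
and whose itinerary until then is not realized to the left of `c`. -/
theorem exists_unrealized_itinerary {c η : ℝ} (hη : 0 < η) (hc : Ioo c (c + η) ⊆ I) :
    ∃ z ∈ Ioo c (c + η), ∃ k, L.Avoids k z ∧ L.f^[k] z = 0 ∧
      ∀ y ∈ I, y < c → ¬ L.SameSide k y z := by
  obtain ⟨z, hz, m, hm, hm0⟩ := L.exists_iterate_eq_zero (show c < c + η by linarith) hc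
  have hev := hm.eventually_sameSide (hc hz)
  rw [nhdsWithin_eq_nhds.2 (mem_of_superset (isOpen_Ioo.mem_nhds hz) hc)] at hev
  obtain ⟨δ, hδ, hball⟩ := Metric.eventually_nhds_iff.1 hev
  set β := min (z + δ) (c + η)
  have hzβ : z < β := lt_min (by linarith) hz.2
  have hsub : Ioo z β ⊆ Ioo c (c + η) := fun w hw =>
    ⟨hz.1.trans hw.1, hw.2.trans_le (min_le_right _ _)⟩
  -- The point `w` lies just right of `z`, so `f^[m] w > 0 = f^[m] z`. A point left of `c` with the
  -- itinerary of `w` lies left of `z` and agrees with `z` for `m` steps, so its `m`-th image is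
  -- negative; but `m < k`.
  obtain ⟨w, hw, k, hk, hk0⟩ := L.exists_iterate_eq_zero hzβ (hsub.trans hc)
  have hzw : L.SameSide m z w := hball (by
    rw [Real.dist_eq, abs_of_pos (sub_pos.2 hw.1)]
    linarith [hw.2.trans_le (min_le_left _ _)])
  have hpos : 0 < L.f^[m] w := by
    rw [← hm0]; exact hzw.iterate_lt (hc hz) (hc (hsub hw)) hw.1
  have hmk : m < k := by
    by_contra! hle
    rcases hle.lt_or_eq with h | rfl
    · exact hzw.symm.avoids k h hk0
    · exact hpos.ne' hk0
  refine ⟨w, hsub hw, k, hk, hk0, fun y hy hyc hyw => ?_⟩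
  have hyz : L.SameSide m y z := (hyw.mono hmk.le).trans hzw.symm
  have h1 := hyz.iterate_lt hy (hc hz) (hyc.trans hz.1)
  have h2 := hyw m hmk
  nlinarith

end GeometricLorenzFlow
end Lorenz

/-! ### Linearizing coordinates and the flow inside the cube. -/

namespace Lorenz

theorem continuous_vec {α : Type*} [TopologicalSpace α] {a b c : α → ℝ} (ha : Continuous a)
    (hb : Continuous b) (hc : Continuous c) : Continuous fun i => (!₂[a i, b i, c i] : E3) := by
  refine (PiLp.continuous_toLp 2 (fun _ : Fin 3 => ℝ)).comp (continuous_pi fun j => ?_)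
  fin_cases j
  exacts [ha, hb, hc]

theorem tendsto_vec {α : Type*} {l : Filter α} {a b c : α → ℝ} {x y z : ℝ}
    (ha : Tendsto a l (𝓝 x)) (hb : Tendsto b l (𝓝 y)) (hc : Tendsto c l (𝓝 z)) :
    Tendsto (fun i => (!₂[a i, b i, c i] : E3)) l (𝓝 !₂[x, y, z]) := by
  have : Continuous fun p : ℝ × ℝ × ℝ => (!₂[p.1, p.2.1, p.2.2] : E3) :=
    continuous_vec continuous_fst (continuous_fst.comp continuous_snd)
      (continuous_snd.comp continuous_snd)
  exact (this.tendsto (x, y, z)).comp (ha.prodMk_nhds (hb.prodMk_nhds hc))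

theorem vec_eta (v : E3) : !₂[v 0, v 1, v 2] = v := by
  ext i; fin_cases i <;> rfl

theorem continuous_coord (i : Fin 3) : Continuous fun v : E3 => v i :=
  (continuous_apply i).comp (PiLp.continuous_ofLp 2 (fun _ : Fin 3 => ℝ))

theorem continuous_linearFlow (a b c : ℝ) :
    Continuous fun p : ℝ × E3 => linearFlow a b c p.1 p.2 := by
  have h := fun i => (continuous_coord i).comp (continuous_snd (X := ℝ) (Y := E3))
  have h' := fun d : ℝ => Real.continuous_exp.comp
    ((continuous_const (y := d)).mul (continuous_fst (X := ℝ) (Y := E3)))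
  exact continuous_vec ((h' a).mul (h 0)) ((h' b).mul (h 1)) ((h' c).mul (h 2))

theorem linearFlow_add (a b c s t : ℝ) (v : E3) :
    linearFlow a b c s (linearFlow a b c t v) = linearFlow a b c (s + t) v := by
  ext i; fin_cases i <;> simp [linearFlow, mul_add, Real.exp_add, mul_assoc]

theorem linearFlow_zero (a b c : ℝ) (v : E3) : linearFlow a b c 0 v = v := by
  ext i; fin_cases i <;> simp [linearFlow]

theorem linearFlow_vec (a b c t x y z : ℝ) : linearFlow a b c t !₂[x, y, z] =
    !₂[Real.exp (a * t) * x, Real.exp (b * t) * y, Real.exp (c * t) * z] := rfl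

/-- The cube `[-1, 1]³`. -/
def cube : Set E3 := {v | ∀ i, |v i| ≤ 1}

theorem isCompact_cube : IsCompact cube := by
  refine Metric.isCompact_of_isClosed_isBounded ?_ ?_
  · have : cube = ⋂ i, {v : E3 | |v i| ≤ 1} := by ext; simp [cube]
    rw [this]
    exact isClosed_iInter fun i => isClosed_le (continuous_coord i).abs continuous_const
  · refine (Metric.isBounded_closedBall (x := (0 : E3)) (r := Real.sqrt 3)).subset fun v hv => ?_
    rw [mem_closedBall_zero_iff, EuclideanSpace.norm_eq]
    refine Real.sqrt_le_sqrt ?_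
    have : ∀ i, ‖v i‖ ^ 2 ≤ 1 := fun i => by
      have := hv i
      rw [Real.norm_eq_abs]
      exact pow_le_one₀ (abs_nonneg _) this
    calc ∑ i, ‖v i‖ ^ 2 ≤ ∑ _i : Fin 3, (1 : ℝ) := Finset.sum_le_sum fun i _ => this i
      _ = 3 := by simp

theorem vec_mem_cube {x y z : ℝ} (hx : |x| ≤ 1) (hy : |y| ≤ 1) (hz : |z| ≤ 1) :
    (!₂[x, y, z] : E3) ∈ cube := by
  intro i; fin_cases i
  exacts [hx, hy, hz]

namespace GeometricLorenzFlow

variable (L : GeometricLorenzFlow)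

theorem l₃_neg' : L.l₃ < 0 := by linarith [L.l₃_neg]

theorem l₁_pos : 0 < L.l₁ := by linarith [L.l₃_neg, L.l₃_lt]

theorem l₂_neg : L.l₂ < 0 := by linarith [L.l₁_pos, L.l₁_lt]

/-- The point with coordinates `(x, y, z)`. -/
noncomputable def pt (x y z : ℝ) : E3 := L.chart.symm !₂[x, y, z]

/-- The point of the cross-section with coordinates `(x, y)`. -/
noncomputable def sec (x y : ℝ) : E3 := L.pt x y 1

theorem sec_mem {x y : ℝ} (hx : x ∈ I) (hy : y ∈ I) : L.sec x y ∈ sectionOf L.chart :=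
  ⟨x, hx, y, hy, rfl⟩

theorem exists_eq_sec {p : E3} (hp : p ∈ sectionOf L.chart) : ∃ x ∈ I, ∃ y ∈ I, p = L.sec x y := hp

theorem cube_subset_target : cube ⊆ L.chart.target := L.cube_subset

/-- The part of the coordinate cube that lies in `Q`. -/
def box (Q : Set E3) : Set E3 := L.chart.symm '' (cube ∩ Q)

theorem isCompact_box {Q : Set E3} (hQ : IsClosed Q) : IsCompact (L.box Q) :=
  (isCompact_cube.inter_right hQ).image_of_continuousOn
    (L.chart.continuousOn_symm.mono (inter_subset_left.trans L.cube_subset_target))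

theorem disjoint_box {Q R : Set E3} (h : ∀ v ∈ cube, v ∈ Q → v ∉ R) :
    Disjoint (L.box Q) (L.box R) := by
  rw [Set.disjoint_left]
  rintro p ⟨v, hv, rfl⟩ ⟨w, hw, hwv⟩
  have := L.chart.symm.injOn (L.cube_subset_target hw.1) (L.cube_subset_target hv.1) hwv
  exact h v hv.1 hv.2 (this ▸ hw.2)

theorem pt_mem_box {Q : Set E3} {x y z : ℝ} (hx : |x| ≤ 1) (hy : |y| ≤ 1) (hz : |z| ≤ 1)
    (hQ : !₂[x, y, z] ∈ Q) : L.pt x y z ∈ L.box Q :=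
  ⟨_, ⟨vec_mem_cube hx hy hz, hQ⟩, rfl⟩

theorem pt_inj {x y z x' y' z' : ℝ} (h : !₂[x, y, z] ∈ L.chart.target)
    (h' : !₂[x', y', z'] ∈ L.chart.target) (he : L.pt x y z = L.pt x' y' z') :
    x = x' ∧ y = y' ∧ z = z' := by
  have := L.chart.symm.injOn h h' he
  exact ⟨congrArg (fun v : E3 => v 0) this, congrArg (fun v : E3 => v 1) this,
    congrArg (fun v : E3 => v 2) this⟩

theorem tendsto_pt {α : Type*} {l : Filter α} {a b c : α → ℝ} {x y z : ℝ}
    (h : !₂[x, y, z] ∈ L.chart.target)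
    (ha : Tendsto a l (𝓝 x)) (hb : Tendsto b l (𝓝 y)) (hc : Tendsto c l (𝓝 z)) :
    Tendsto (fun i => L.pt (a i) (b i) (c i)) l (𝓝 (L.pt x y z)) :=
  (L.chart.symm.continuousAt h).tendsto.comp (tendsto_vec ha hb hc)

theorem sec_vec_mem_cube {x y : ℝ} (hx : x ∈ I) (hy : y ∈ I) : (!₂[x, y, 1] : E3) ∈ cube :=
  vec_mem_cube ((abs_le_of_mem_I hx).trans (by norm_num))
    ((abs_le_of_mem_I hy).trans (by norm_num)) (by simp)

theorem sectionOf_eq_box : sectionOf L.chart = L.box {v | v 0 ∈ I ∧ v 1 ∈ I ∧ v 2 = 1} := by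
  ext p
  constructor
  · rintro ⟨x, hx, y, hy, rfl⟩
    exact ⟨_, ⟨sec_vec_mem_cube hx hy, hx, hy, rfl⟩, rfl⟩
  · rintro ⟨v, ⟨-, hx, hy, hz⟩, rfl⟩
    exact ⟨v 0, hx, v 1, hy, by rw [← hz, vec_eta]⟩

theorem isCompact_section : IsCompact (sectionOf L.chart) := by
  rw [sectionOf_eq_box]
  refine L.isCompact_box ?_
  exact (isClosed_Icc.preimage (continuous_coord 0)).inter
    ((isClosed_Icc.preimage (continuous_coord 1)).inter
      (isClosed_eq (continuous_coord 2) continuous_const))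

theorem continuousOn_sec : ContinuousOn (fun q : ℝ × ℝ => L.sec q.1 q.2) (I ×ˢ I) := by
  intro q hq
  exact L.tendsto_pt (L.cube_subset_target (sec_vec_mem_cube hq.1 hq.2))
    (continuous_fst.tendsto q |>.mono_left nhdsWithin_le_nhds)
    (continuous_snd.tendsto q |>.mono_left nhdsWithin_le_nhds) tendsto_const_nhds

theorem tendsto_sec {α : Type*} {l : Filter α} {a b : α → ℝ} {x y : ℝ}
    (hx : x ∈ I) (hy : y ∈ I) (ha : Tendsto a l (𝓝 x)) (hb : Tendsto b l (𝓝 y)) :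
    Tendsto (fun i => L.sec (a i) (b i)) l (𝓝 (L.sec x y)) :=
  L.tendsto_pt (L.cube_subset_target (sec_vec_mem_cube hx hy)) ha hb tendsto_const_nhds

/-- The coordinates of a point of the cross-section depend continuously on it. -/
theorem tendsto_coords_of_tendsto_sec {α : Type*} {l : Filter α} {a b : α → ℝ} {x y : ℝ}
    (hx : x ∈ I) (hy : y ∈ I) (hab : ∀ᶠ i in l, a i ∈ I ∧ b i ∈ I)
    (h : Tendsto (fun i => L.sec (a i) (b i)) l (𝓝 (L.sec x y))) :
    Tendsto a l (𝓝 x) ∧ Tendsto b l (𝓝 y) := by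
  have hmem : !₂[x, y, 1] ∈ L.chart.target := L.cube_subset_target (sec_vec_mem_cube hx hy)
  have hc : Tendsto (fun i => L.chart (L.sec (a i) (b i))) l (𝓝 !₂[x, y, 1]) := by
    have := (L.chart.continuousAt (L.chart.map_target hmem)).tendsto.comp h
    rwa [L.chart.right_inv hmem] at this
  have he : (fun i => L.chart (L.sec (a i) (b i))) =ᶠ[l] fun i => !₂[a i, b i, 1] := by
    filter_upwards [hab] with i hi
    exact L.chart.right_inv (L.cube_subset_target (sec_vec_mem_cube hi.1 hi.2))
  have hc := hc.congr' he
  exact ⟨((continuous_coord 0).tendsto _).comp hc, ((continuous_coord 1).tendsto _).comp hc⟩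

theorem zero_mem_target : (!₂[0, 0, 0] : E3) ∈ L.chart.target :=
  L.cube_subset_target (vec_mem_cube (by simp) (by simp) (by simp))

theorem pt_zero : L.pt 0 0 0 = 0 := by
  have h : (!₂[0, 0, 0] : E3) = 0 := by ext i; fin_cases i <;> rfl
  rw [pt, h]
  nth_rewrite 1 [← L.chart_zero]
  exact L.chart.left_inv L.zero_mem_source

/-- For negative `t`, the forward statement is applied to the end point of the linear orbit. -/
theorem flow_symm_of_forall {v : E3} {t : ℝ}
    (h : ∀ s, |s| ≤ |t| → linearFlow L.l₁ L.l₂ L.l₃ s v ∈ L.chart.target) :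
    L.flow t (L.chart.symm v) = L.chart.symm (linearFlow L.l₁ L.l₂ L.l₃ t v) := by
  rcases le_total 0 t with ht | ht
  · refine L.linear v t ht fun s hs => h s ?_
    rw [abs_of_nonneg hs.1, abs_of_nonneg ht]; exact hs.2
  · have := L.linear (linearFlow L.l₁ L.l₂ L.l₃ t v) (-t) (by linarith) fun s hs => by
      rw [linearFlow_add]
      refine h _ ?_
      rw [abs_of_nonpos (by linarith [hs.2] : s + t ≤ 0), abs_of_nonpos ht]
      linarith [hs.1]
    rw [linearFlow_add, neg_add_cancel, linearFlow_zero] at this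
    rw [← this, ← L.flow.map_add, add_neg_cancel, L.flow.map_zero_apply]

/-- The orbit of a point of the cube, as long as it stays in the cube. -/
theorem flow_pt {x y z t : ℝ} (ht : 0 ≤ t) (hx : |x| * Real.exp (L.l₁ * t) ≤ 1) (hy : |y| ≤ 1)
    (hz : |z| ≤ 1) : L.flow t (L.pt x y z) =
      L.pt (Real.exp (L.l₁ * t) * x) (Real.exp (L.l₂ * t) * y) (Real.exp (L.l₃ * t) * z) := by
  refine L.linear _ t ht fun s hs => L.cube_subset_target ?_
  rw [linearFlow_vec]
  have key : ∀ l w : ℝ, l < 0 → |w| ≤ 1 → |Real.exp (l * s) * w| ≤ 1 := by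
    intro l w hl hw
    rw [abs_mul, abs_of_pos (Real.exp_pos _)]
    refine mul_le_one₀ (Real.exp_le_one_iff.2 (mul_nonpos_of_nonpos_of_nonneg hl.le hs.1))
      (abs_nonneg _) hw
  refine vec_mem_cube ?_ (key _ _ L.l₂_neg hy) (key _ _ L.l₃_neg' hz)
  rw [abs_mul, abs_of_pos (Real.exp_pos _), mul_comm]
  refine le_trans ?_ hx
  have := L.l₁_pos
  gcongr
  exact hs.2

theorem flow_sec {x y t : ℝ} (hy : y ∈ I) (ht : 0 ≤ t)
    (hx : |x| * Real.exp (L.l₁ * t) ≤ 1) : L.flow t (L.sec x y) =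
      L.pt (Real.exp (L.l₁ * t) * x) (Real.exp (L.l₂ * t) * y) (Real.exp (L.l₃ * t)) := by
  rw [sec, L.flow_pt ht hx ((abs_le_of_mem_I hy).trans (by norm_num)) (by simp), mul_one]

/-- Near an interior point of the cross-section all orbits cross it within a short time. -/
theorem eventually_crosses {x y σ : ℝ} (hx : x ∈ interior I) (hy : y ∈ interior I) (hσ : 0 < σ) :
    ∀ᶠ r in 𝓝 (L.sec x y), ∃ θ, |θ| < σ ∧ L.flow θ r ∈ sectionOf L.chart := by
  have hmem : !₂[x, y, 1] ∈ L.chart.target :=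
    L.cube_subset_target (sec_vec_mem_cube (interior_subset hx) (interior_subset hy))
  have hc : Tendsto L.chart (𝓝 (L.sec x y)) (𝓝 !₂[x, y, 1]) := by
    have := (L.chart.continuousAt (L.chart.map_target hmem)).tendsto
    rwa [L.chart.right_inv hmem] at this
  have hsource : ∀ᶠ r in 𝓝 (L.sec x y), r ∈ L.chart.source :=
    L.chart.open_source.mem_nhds (L.chart.map_target hmem)
  have hlin := (continuous_linearFlow L.l₁ L.l₂ L.l₃).tendsto ((0 : ℝ), (!₂[x, y, 1] : E3))
  simp only [linearFlow_zero] at hlin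
  have htarget := hlin.eventually (L.chart.open_target.mem_nhds hmem)
  rw [nhds_prod_eq, eventually_prod_iff] at htarget
  obtain ⟨pa, ha, pb, hb, hab⟩ := htarget
  obtain ⟨κ, hκ, hpa⟩ := Metric.eventually_nhds_iff.1 ha
  -- The time solving `exp (l₃ T) * v 2 = 1`, at which the linear flow reaches the height of the
  -- section. It tends to `0` at the section, so the other two coordinates still lie in `I`.
  set T : E3 → ℝ := fun v => -Real.log (v 2) / L.l₃ with hTdef
  have hT : Tendsto T (𝓝 !₂[x, y, 1]) (𝓝 0) := by
    have h1 : Tendsto (fun v : E3 => Real.log (v 2)) (𝓝 !₂[x, y, 1]) (𝓝 (Real.log 1)) :=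
      (Real.continuousAt_log one_ne_zero).tendsto.comp ((continuous_coord 2).tendsto !₂[x, y, 1])
    have h2 := h1.neg.div_const L.l₃
    simpa using h2
  have hland : Tendsto (fun v => linearFlow L.l₁ L.l₂ L.l₃ (T v) v) (𝓝 !₂[x, y, 1])
      (𝓝 !₂[x, y, 1]) := by
    have := hlin.comp (hT.prodMk_nhds (tendsto_id (x := 𝓝 (!₂[x, y, 1] : E3))))
    exact this
  have hI : ∀ i : Fin 3, (!₂[x, y, 1] : E3) i ∈ interior I →
      ∀ᶠ v in 𝓝 (!₂[x, y, 1] : E3), linearFlow L.l₁ L.l₂ L.l₃ (T v) v i ∈ I := fun i hi =>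
    (((continuous_coord i).tendsto _).comp hland).eventually
      (mem_interior_iff_mem_nhds.1 hi)
  have hsmall : ∀ᶠ v in 𝓝 (!₂[x, y, 1] : E3), |T v| < min κ σ := by
    have := hT.abs
    rw [abs_zero] at this
    exact this.eventually (gt_mem_nhds (lt_min hκ hσ))
  have hpos : ∀ᶠ v in 𝓝 (!₂[x, y, 1] : E3), 0 < v 2 :=
    ((continuous_coord 2).tendsto !₂[x, y, 1]).eventually (lt_mem_nhds one_pos)
  filter_upwards [hsource, hc.eventually hb, hc.eventually (hI 0 hx), hc.eventually (hI 1 hy),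
    hc.eventually hsmall, hc.eventually hpos] with r hr hrb hr0 hr1 hrT hr2
  refine ⟨T (L.chart r), hrT.trans_le (min_le_right _ _), ?_⟩
  have := L.flow_symm_of_forall (v := L.chart r) (t := T (L.chart r)) fun s hs =>
    hab (hpa (by
      rw [Real.dist_eq, sub_zero]
      exact hs.trans_lt (hrT.trans_le (min_le_left _ _)))) hrb
  rw [L.chart.left_inv hr] at this
  rw [this]
  have h3 : linearFlow L.l₁ L.l₂ L.l₃ (T (L.chart r)) (L.chart r) 2 = 1 := by
    change Real.exp (L.l₃ * (-Real.log (L.chart r 2) / L.l₃)) * L.chart r 2 = 1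
    rw [mul_div_cancel₀ _ L.l₃_neg'.ne, Real.exp_neg, Real.exp_log hr2, inv_mul_cancel₀ hr2.ne']
  refine ⟨_, hr0, _, hr1, ?_⟩
  nth_rewrite 1 [← vec_eta (linearFlow L.l₁ L.l₂ L.l₃ (T (L.chart r)) (L.chart r))]
  rw [h3]

end GeometricLorenzFlow
end Lorenz

/-! ### The return map: continuity, limits at the singular leaf, separation. -/

theorem Ultrafilter.exists_tendsto_of_isCompact {α β : Type*} [TopologicalSpace β]
    (𝒰 : Ultrafilter α) {K : Set β} (hK : IsCompact K) {f : α → β} (h : ∀ᶠ a in 𝒰, f a ∈ K) :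
    ∃ b ∈ K, Tendsto f 𝒰 (𝓝 b) :=
  hK.ultrafilter_le_nhds (𝒰.map f) (le_principal_iff.2 h)

theorem exists_ultrafilter_of_mem_closure_image {α β : Type*} [TopologicalSpace β] {F : α → β}
    {A : Set α} {r : β} (h : r ∈ closure (F '' A)) :
    ∃ 𝒰 : Ultrafilter α, A ∈ 𝒰 ∧ Tendsto F 𝒰 (𝓝 r) := by
  obtain ⟨𝒱, hA, hr⟩ := mem_closure_iff_ultrafilter.1 h
  have : NeBot (comap F 𝒱 ⊓ 𝓟 A) := comap_inf_principal_neBot_of_image_mem 𝒱.neBot hA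
  have hle := Ultrafilter.of_le (comap F (𝒱 : Filter β) ⊓ 𝓟 A)
  exact ⟨Ultrafilter.of (comap F (𝒱 : Filter β) ⊓ 𝓟 A), le_principal_iff.1 (hle.trans inf_le_right),
    (tendsto_iff_comap.2 (hle.trans inf_le_left)).mono_right hr⟩

namespace Lorenz

namespace GeometricLorenzFlow

variable (L : GeometricLorenzFlow)

theorem tendsto_flow {α : Type*} {l : Filter α} {a : α → ℝ} {p : α → E3} {t : ℝ} {q : E3}
    (ha : Tendsto a l (𝓝 t)) (hp : Tendsto p l (𝓝 q)) :
    Tendsto (fun i => L.flow (a i) (p i)) l (𝓝 (L.flow t q)) :=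
  ((L.flow.continuous continuous_fst continuous_snd).tendsto (t, q)).comp (ha.prodMk_nhds hp)

/-- The time at which the point `(x, y, 1)` reaches the exit face. -/
noncomputable def exitT (x : ℝ) : ℝ := -Real.log x / L.l₁

theorem abs_mul_exp_exitT {x : ℝ} (hx : x ≠ 0) : |x| * Real.exp (L.l₁ * L.exitT x) = 1 := by
  rw [exitT, mul_div_cancel₀ _ L.l₁_pos.ne', ← Real.log_abs, Real.exp_neg,
    Real.exp_log (abs_pos.2 hx), mul_inv_cancel₀ (abs_pos.2 hx).ne']

theorem le_exitT_iff {x t : ℝ} (hx : x ≠ 0) : t ≤ L.exitT x ↔ |x| * Real.exp (L.l₁ * t) ≤ 1 := by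
  rw [← L.abs_mul_exp_exitT hx, mul_le_mul_iff_right₀ (abs_pos.2 hx), Real.exp_le_exp,
    mul_le_mul_iff_right₀ L.l₁_pos]

/-- A lower bound for the time between two visits to the cross-section. -/
noncomputable def gap : ℝ := Real.log 2 / L.l₁

theorem gap_pos : 0 < L.gap := div_pos (Real.log_pos one_lt_two) L.l₁_pos

theorem exp_gap : Real.exp (L.l₁ * L.gap) = 2 := by
  rw [gap, mul_div_cancel₀ _ L.l₁_pos.ne', Real.exp_log two_pos]

/-- The first coordinate grows at rate `l₁`, so `gap` is the time it needs to double from `1/2` to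
`1`. -/
theorem add_gap_le_exitT {x t : ℝ} (hx : x ≠ 0) (h : |x| * Real.exp (L.l₁ * t) ≤ 1 / 2) :
    t + L.gap ≤ L.exitT x := by
  rw [L.le_exitT_iff hx, mul_add, Real.exp_add, L.exp_gap]
  linarith

theorem gap_le_exitT {x : ℝ} (hx : x ∈ I) (h0 : x ≠ 0) : L.gap ≤ L.exitT x := by
  have := L.add_gap_le_exitT (t := 0) h0 (by simpa using abs_le_of_mem_I hx)
  simpa using this

theorem exp_lt_one {t : ℝ} (ht : 0 < t) : Real.exp (L.l₃ * t) < 1 :=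
  Real.exp_lt_one_iff.2 (mul_neg_of_neg_of_pos L.l₃_neg' ht)

theorem flow_sec_mem_box {x y t : ℝ} {Q : Set E3} (hy : y ∈ I) (ht : 0 ≤ t)
    (hx : |x| * Real.exp (L.l₁ * t) ≤ 1)
    (hQ : !₂[Real.exp (L.l₁ * t) * x, Real.exp (L.l₂ * t) * y, Real.exp (L.l₃ * t)] ∈ Q) :
    L.flow t (L.sec x y) ∈ L.box Q := by
  rw [L.flow_sec hy ht hx]
  refine L.pt_mem_box ?_ ?_ ?_ hQ
  · rwa [abs_mul, abs_of_pos (Real.exp_pos _), mul_comm]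
  · rw [abs_mul, abs_of_pos (Real.exp_pos _)]
    exact mul_le_one₀ (Real.exp_le_one_iff.2 (mul_nonpos_of_nonpos_of_nonneg L.l₂_neg.le ht))
      (abs_nonneg _) ((abs_le_of_mem_I hy).trans (by norm_num))
  · rw [abs_of_pos (Real.exp_pos _)]
    exact Real.exp_le_one_iff.2 (mul_nonpos_of_nonpos_of_nonneg L.l₃_neg'.le ht)

theorem section_disjoint_box {Q : Set E3} (hQ : ∀ v ∈ Q, v 2 ≠ 1) :
    Disjoint (sectionOf L.chart) (L.box Q) := by
  rw [sectionOf_eq_box]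
  exact L.disjoint_box fun v _ hv hvQ => hQ v hvQ hv.2.2

theorem flow_sec_notMem {x y t : ℝ} (hy : y ∈ I) (ht : 0 < t)
    (hx : |x| * Real.exp (L.l₁ * t) ≤ 1) : L.flow t (L.sec x y) ∉ sectionOf L.chart := fun h =>
  Set.disjoint_left.1 (L.section_disjoint_box (Q := {v | v 2 < 1}) fun _ hv => ne_of_lt hv) h
    (L.flow_sec_mem_box hy ht.le hx (L.exp_lt_one ht))

variable {L}

/-- The return map to the cross-section. -/
def P (L : GeometricLorenzFlow) (q : ℝ × ℝ) : ℝ × ℝ := (L.f q.1, L.g q.1 q.2)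

/-- The domain of the return map. -/
def dom : Set (ℝ × ℝ) := {q | q ∈ I ×ˢ I ∧ q.1 ≠ 0}

variable (L)

theorem flow_ret {q : ℝ × ℝ} (hq : q ∈ dom) :
    L.flow (L.ret q.1 q.2) (L.sec q.1 q.2) = L.sec (L.P q).1 (L.P q).2 :=
  L.return_eq _ hq.1.1 hq.2 _ hq.1.2

theorem P_mem {q : ℝ × ℝ} (hq : q ∈ dom) : L.P q ∈ I ×ˢ I :=
  ⟨L.f_mem _ hq.1.1 hq.2, interior_subset (L.g_mem _ hq.1.1 hq.2 _ hq.1.2)⟩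

theorem P_sec_mem {q : ℝ × ℝ} (hq : q ∈ dom) : L.sec (L.P q).1 (L.P q).2 ∈ sectionOf L.chart :=
  L.sec_mem (L.P_mem hq).1 (L.P_mem hq).2

theorem ret_le {q : ℝ × ℝ} (hq : q ∈ dom) {t : ℝ} (ht : 0 < t)
    (h : L.flow t (L.sec q.1 q.2) ∈ sectionOf L.chart) : L.ret q.1 q.2 ≤ t := by
  by_contra! hlt
  exact L.return_first _ hq.1.1 hq.2 _ hq.1.2 t ht hlt h

/-- Inside the cube the third coordinate has dropped below `1`, so no return is possible before the
exit. -/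
theorem exitT_lt_ret {q : ℝ × ℝ} (hq : q ∈ dom) : L.exitT q.1 < L.ret q.1 q.2 := by
  by_contra! hle
  refine L.flow_sec_notMem hq.1.2 (L.ret_pos _ hq.1.1 hq.2 _ hq.1.2)
    ((L.le_exitT_iff hq.2).1 hle) ?_
  rw [L.flow_ret hq]
  exact L.P_sec_mem hq

theorem gap_lt_ret {q : ℝ × ℝ} (hq : q ∈ dom) : L.gap < L.ret q.1 q.2 :=
  (L.gap_le_exitT hq.1.1 hq.2).trans_lt (L.exitT_lt_ret hq)

theorem f_lt_self (hL : L.f (1 / 2) < 1 / 2) {x : ℝ} (hx : x ∈ I) (h0 : 0 < x) : L.f x < x := by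
  have hh : (1 / 2 : ℝ) ∈ I := by rw [mem_I]; norm_num
  have := L.f_sub_le hx hh (by positivity) hx.2
  nlinarith [L.one_lt_lam, hx.2]

/-- For `x > 0`, `f x < x ≤ 1/2` bounds the image from above, and `f x > f (x / 2) ≥ -1/2` from
below; oddness gives the rest. Return points are thus interior in the section, where nearby orbits
must cross. -/
theorem f_mem_interior (hL : L.f (1 / 2) < 1 / 2) {x : ℝ} (hx : x ∈ I) (h0 : x ≠ 0) :
    L.f x ∈ interior I := by
  have key : ∀ x ∈ I, 0 < x → L.f x ∈ interior I := by
    intro x hx h0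
    rw [interior_I]
    refine ⟨?_, (L.f_lt_self hL hx h0).trans_le hx.2⟩
    have hh : x / 2 ∈ I := ⟨by linarith, by linarith [hx.2]⟩
    exact (L.f_mem _ hh (by positivity)).1.trans_lt (L.f_lt hh hx (by positivity) (by linarith))
  rcases lt_or_gt_of_ne h0 with h | h
  · have := key (-x) (neg_mem_I hx) (by linarith)
    rw [L.f_odd x hx h0, interior_I] at this
    rw [interior_I]
    exact ⟨by linarith [this.2], by linarith [this.1]⟩
  · exact key x hx h

theorem eventually_mem_dom {q : ℝ × ℝ} (hq : q ∈ dom) : ∀ᶠ p in 𝓝[I ×ˢ I] q, p ∈ dom := by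
  have : {p : ℝ × ℝ | p.1 ≠ 0} ∈ 𝓝 q := (isOpen_ne.preimage continuous_fst).mem_nhds hq.2
  filter_upwards [self_mem_nhdsWithin, nhdsWithin_le_nhds this] with p h1 h2
  exact ⟨h1, h2⟩

theorem tendsto_sec_nhdsWithin {q : ℝ × ℝ} (hq : q ∈ I ×ˢ I) :
    Tendsto (fun p : ℝ × ℝ => L.sec p.1 p.2) (𝓝[I ×ˢ I] q) (𝓝 (L.sec q.1 q.2)) :=
  L.continuousOn_sec q hq

theorem eventually_ret_lt (hL : L.f (1 / 2) < 1 / 2) {q : ℝ × ℝ} (hq : q ∈ dom) {σ : ℝ}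
    (hσ : 0 < σ) : ∀ᶠ p in 𝓝[I ×ˢ I] q, L.ret p.1 p.2 < L.ret q.1 q.2 + σ := by
  have hpos := L.ret_pos _ hq.1.1 hq.2 _ hq.1.2
  have hlim := L.tendsto_flow (tendsto_const_nhds (x := L.ret q.1 q.2))
    (L.tendsto_sec_nhdsWithin hq.1)
  rw [L.flow_ret hq] at hlim
  have hev := hlim.eventually (L.eventually_crosses (L.f_mem_interior hL hq.1.1 hq.2)
    (L.g_mem _ hq.1.1 hq.2 _ hq.1.2) (lt_min hσ hpos))
  filter_upwards [hev, eventually_mem_dom hq] with p ⟨θ, hθ, hp⟩ hpd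
  rw [← L.flow.map_add] at hp
  have h1 := hθ.trans_le (min_le_left _ _)
  have h2 := hθ.trans_le (min_le_right _ _)
  have := L.ret_le hpd (by linarith [neg_abs_le θ]) hp
  linarith [le_abs_self θ]

/-- Crossing near the interior return point bounds nearby return times from above. Conversely, a
limit of return times is at least `gap`, hence positive, and lands in the closed section, so it is
no smaller than the first return time. -/
theorem tendsto_ret (hL : L.f (1 / 2) < 1 / 2) {q : ℝ × ℝ} (hq : q ∈ dom) :
    Tendsto (fun p : ℝ × ℝ => L.ret p.1 p.2) (𝓝[I ×ˢ I] q) (𝓝 (L.ret q.1 q.2)) := by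
  rw [tendsto_iff_ultrafilter]
  intro 𝒰 h𝒰
  have hdom := h𝒰 (eventually_mem_dom hq)
  obtain ⟨t, ht, hlim⟩ := 𝒰.exists_tendsto_of_isCompact
    (isCompact_Icc (a := L.gap) (b := L.ret q.1 q.2 + 1))
    (f := fun p => L.ret p.1 p.2) (by
      filter_upwards [hdom, h𝒰 (L.eventually_ret_lt hL hq one_pos)] with p h1 h2
      exact ⟨(L.gap_lt_ret h1).le, h2.le⟩)
  have hle : t ≤ L.ret q.1 q.2 := by
    refine le_of_forall_pos_le_add fun σ hσ => le_of_tendsto hlim ?_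
    filter_upwards [h𝒰 (L.eventually_ret_lt hL hq hσ)] with p hp using hp.le
  have hS : L.flow t (L.sec q.1 q.2) ∈ sectionOf L.chart := by
    refine L.isCompact_section.isClosed.mem_of_tendsto
      (L.tendsto_flow hlim ((L.tendsto_sec_nhdsWithin hq.1).mono_left h𝒰)) ?_
    filter_upwards [hdom] with p hp
    rw [L.flow_ret hp]
    exact L.P_sec_mem hp
  have := L.ret_le hq (L.gap_pos.trans_le ht.1) hS
  rwa [le_antisymm hle this] at hlim

theorem tendsto_P (hL : L.f (1 / 2) < 1 / 2) {q : ℝ × ℝ} (hq : q ∈ dom) :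
    Tendsto L.P (𝓝[I ×ˢ I] q) (𝓝[I ×ˢ I] (L.P q)) := by
  have hmem : ∀ᶠ p in 𝓝[I ×ˢ I] q, L.P p ∈ I ×ˢ I := by
    filter_upwards [eventually_mem_dom hq] with p hp using L.P_mem hp
  have hlim := L.tendsto_flow (L.tendsto_ret hL hq) (L.tendsto_sec_nhdsWithin hq.1)
  rw [L.flow_ret hq] at hlim
  have hlim' : Tendsto (fun p => L.sec (L.P p).1 (L.P p).2) (𝓝[I ×ˢ I] q)
      (𝓝 (L.sec (L.P q).1 (L.P q).2)) := by
    refine hlim.congr' ?_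
    filter_upwards [eventually_mem_dom hq] with p hp using L.flow_ret hp
  have := L.tendsto_coords_of_tendsto_sec (L.P_mem hq).1 (L.P_mem hq).2 hmem hlim'
  exact tendsto_nhdsWithin_iff.2 ⟨this.1.prodMk_nhds this.2, hmem⟩

/-- The points `(±1, 0, 0)` on the unstable branches of the singularity. -/
noncomputable def vtx (s : ℝ) : E3 := L.pt s 0 0

/-- Points of the cross-section approaching the singular leaf from the side `s = ±1`. -/
def edge (s : ℝ) : Filter (ℝ × ℝ) := 𝓝[I ∩ {x | 0 < s * x}] 0 ×ˢ 𝓟 I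

theorem eventually_edge (s : ℝ) : ∀ᶠ q in edge s, q ∈ dom ∧ 0 < s * q.1 := by
  refine eventually_prod_iff.2 ⟨_, self_mem_nhdsWithin, _, mem_principal_self _, ?_⟩
  intro x hx y hy
  refine ⟨⟨⟨hx.1, hy⟩, ?_⟩, hx.2⟩
  rintro rfl
  simpa using hx.2

theorem tendsto_fst_edge (s : ℝ) : Tendsto Prod.fst (edge s) (𝓝 0) :=
  tendsto_fst.mono_right nhdsWithin_le_nhds

theorem exists_transit {s : ℝ} (hs : s = 1 ∨ s = -1) : ∃ T : ℝ, 0 < T ∧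
    L.flow T (L.vtx s) ∈ sectionOf L.chart ∧
    Tendsto (fun q : ℝ × ℝ => L.ret q.1 q.2 - L.exitT q.1) (edge s) (𝓝 T) := by
  have h : ∀ x t : ℝ, t - L.exitT x = t + Real.log x / L.l₁ := fun x t => by rw [exitT]; ring
  simp only [h, edge]
  rcases hs with rfl | rfl
  · obtain ⟨T, h1, h2, h3⟩ := L.exitTime_pos
    simp only [one_mul]
    exact ⟨T, h1, h2, h3⟩
  · obtain ⟨T, h1, h2, h3⟩ := L.exitTime_neg
    simp only [neg_one_mul, neg_pos]
    exact ⟨T, h1, h2, h3⟩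

theorem tendsto_exitT (s : ℝ) : Tendsto (fun q : ℝ × ℝ => L.exitT q.1) (edge s) atTop := by
  have h0 : Tendsto Prod.fst (edge s) (𝓝[≠] 0) := by
    refine tendsto_nhdsWithin_iff.2 ⟨tendsto_fst_edge s, ?_⟩
    filter_upwards [eventually_edge s] with q hq using hq.1.2
  exact (tendsto_neg_atBot_atTop.comp (Real.tendsto_log_nhdsNE_zero.comp h0)).atTop_div_const
    L.l₁_pos

/-- Near the singular leaf the exit time tends to infinity and the two contracted coordinates tend
to `0`, uniformly along the leaf. -/
theorem tendsto_flow_exitT {s : ℝ} (hs : s = 1 ∨ s = -1) :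
    Tendsto (fun q : ℝ × ℝ => L.flow (L.exitT q.1) (L.sec q.1 q.2)) (edge s) (𝓝 (L.vtx s)) := by
  have hexp : ∀ l < 0, Tendsto (fun q : ℝ × ℝ => Real.exp (l * L.exitT q.1)) (edge s) (𝓝 0) :=
    fun l hl => Real.tendsto_exp_atBot.comp ((L.tendsto_exitT s).const_mul_atTop_of_neg hl)
  have hy : Tendsto (fun q : ℝ × ℝ => Real.exp (L.l₂ * L.exitT q.1) * q.2) (edge s) (𝓝 0) := by
    refine squeeze_zero_norm' ?_ (hexp _ L.l₂_neg)
    filter_upwards [eventually_edge s] with q hq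
    rw [Real.norm_eq_abs, abs_mul, abs_of_pos (Real.exp_pos _)]
    exact mul_le_of_le_one_right (Real.exp_pos _).le
      ((abs_le_of_mem_I hq.1.1.2).trans (by norm_num))
  have hmem : (!₂[s, 0, 0] : E3) ∈ L.chart.target :=
    L.cube_subset_target (vec_mem_cube (by rcases hs with rfl | rfl <;> simp) (by simp) (by simp))
  refine (L.tendsto_pt hmem (tendsto_const_nhds (x := s)) hy (hexp _ L.l₃_neg')).congr' ?_
  filter_upwards [eventually_edge s] with q hq
  have h1 := L.abs_mul_exp_exitT hq.1.2
  rw [L.flow_sec hq.1.1.2 ((L.gap_pos.le).trans (L.gap_le_exitT hq.1.1.1 hq.1.2)) h1.le]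
  congr 1
  rcases hs with rfl | rfl
  · rw [← h1, abs_of_pos (by linarith [hq.2]), mul_comm]
  · have := abs_of_neg (show q.1 < 0 by linarith [hq.2])
    rw [this] at h1
    linarith

theorem tendsto_sec_P_edge {s T : ℝ} (hs : s = 1 ∨ s = -1)
    (hT : Tendsto (fun q : ℝ × ℝ => L.ret q.1 q.2 - L.exitT q.1) (edge s) (𝓝 T)) :
    Tendsto (fun q => L.sec (L.P q).1 (L.P q).2) (edge s) (𝓝 (L.flow T (L.vtx s))) := by
  refine (L.tendsto_flow hT (L.tendsto_flow_exitT hs)).congr' ?_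
  filter_upwards [eventually_edge s] with q hq
  rw [← L.flow.map_add, sub_add_cancel, L.flow_ret hq.1]

/-- Going back from a vertex one slides along the `x`-axis towards `0` with strictly decreasing
`|x|`, so no vertex is met again. Hence the unstable branches neither close up nor join. -/
theorem flow_vtx_eq {s s' c : ℝ} (hs : s = 1 ∨ s = -1) (hs' : s' = 1 ∨ s' = -1)
    (h : L.flow c (L.vtx s) = L.vtx s') : c = 0 ∧ s = s' := by
  have key : ∀ s s' c : ℝ, (s = 1 ∨ s = -1) → (s' = 1 ∨ s' = -1) → 0 ≤ c →
      L.flow c (L.vtx s) = L.vtx s' → c = 0 ∧ s = s' := by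
    intro s s' c hs hs' hc h
    have habs : ∀ s : ℝ, (s = 1 ∨ s = -1) → |s| = 1 := by
      rintro s (rfl | rfl) <;> simp
    have hle : Real.exp (-(L.l₁ * c)) ≤ 1 :=
      Real.exp_le_one_iff.2 (neg_nonpos.2 (mul_nonneg L.l₁_pos.le hc))
    have hback : L.flow c (L.pt (Real.exp (-(L.l₁ * c)) * s') 0 0) = L.vtx s' := by
      rw [L.flow_pt hc ?_ (by simp) (by simp), ← mul_assoc, ← Real.exp_add]
      · simp [vtx]
      · rw [abs_mul, habs s' hs', mul_one, abs_of_pos (Real.exp_pos _), ← Real.exp_add]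
        simp
    have heq : L.vtx s = L.pt (Real.exp (-(L.l₁ * c)) * s') 0 0 := by
      have := congrArg (L.flow (-c)) (h.trans hback.symm)
      simpa [← L.flow.map_add, L.flow.map_zero_apply] using this
    have hcoord := (L.pt_inj
      (L.cube_subset_target (vec_mem_cube (habs s hs).le (by simp) (by simp)))
      (L.cube_subset_target (vec_mem_cube (by
        rw [abs_mul, habs s' hs', mul_one, abs_of_pos (Real.exp_pos _)]; exact hle)
        (by simp) (by simp))) heq).1
    have h1 := congrArg abs hcoord
    rw [abs_mul, habs s hs, habs s' hs', mul_one, abs_of_pos (Real.exp_pos _)] at h1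
    have h2 : L.l₁ * c = 0 := by
      have := Real.exp_eq_one_iff _ |>.1 h1.symm
      linarith
    refine ⟨(mul_eq_zero.1 h2).resolve_left L.l₁_pos.ne', ?_⟩
    rw [hcoord, ← h1, one_mul]
  rcases le_total 0 c with hc | hc
  · exact key s s' c hs hs' hc h
  · have := key s' s (-c) hs' hs (by linarith) (by
      rw [← h, ← L.flow.map_add, neg_add_cancel, L.flow.map_zero_apply])
    exact ⟨by linarith [this.1], this.2.symm⟩

/-- A limit of points of the domain lies in the domain or is approached from one side of the
singular leaf. -/
theorem exists_limit (𝒰 : Ultrafilter (ℝ × ℝ)) (h : dom ∈ 𝒰) :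
    (∃ q ∈ dom, (𝒰 : Filter (ℝ × ℝ)) ≤ 𝓝[I ×ˢ I] q) ∨
      ∃ s : ℝ, (s = 1 ∨ s = -1) ∧ (𝒰 : Filter (ℝ × ℝ)) ≤ edge s := by
  have hII : ∀ᶠ q in (𝒰 : Filter (ℝ × ℝ)), q ∈ I ×ˢ I := by
    filter_upwards [h] with q hq using hq.1
  obtain ⟨q, hq, hlim⟩ := (isCompact_I.prod isCompact_I).ultrafilter_le_nhds 𝒰
    (le_principal_iff.2 hII)
  by_cases h0 : q.1 = 0
  · right
    have hfst : Tendsto Prod.fst (𝒰 : Filter (ℝ × ℝ)) (𝓝 0) := by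
      rw [← h0]; exact (continuous_fst.tendsto q).mono_left hlim
    have hsnd : Tendsto Prod.snd (𝒰 : Filter (ℝ × ℝ)) (𝓟 I) := by
      refine tendsto_principal.2 ?_
      filter_upwards [hII] with q hq using hq.2
    have hside : ∀ s : ℝ, (∀ᶠ q in (𝒰 : Filter (ℝ × ℝ)), 0 < s * q.1) →
        (𝒰 : Filter (ℝ × ℝ)) ≤ edge s := by
      intro s hs
      have : Tendsto Prod.fst (𝒰 : Filter (ℝ × ℝ)) (𝓝[I ∩ {x | 0 < s * x}] 0) := by
        refine tendsto_nhdsWithin_iff.2 ⟨hfst, ?_⟩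
        filter_upwards [hs, hII] with q h1 h2 using ⟨h2.1, h1⟩
      exact this.prodMk hsnd
    rcases 𝒰.eventually_or.1 (show ∀ᶠ q : ℝ × ℝ in (𝒰 : Filter (ℝ × ℝ)), 0 < q.1 ∨ q.1 < 0 by
      filter_upwards [h] with q hq using (lt_or_gt_of_ne hq.2).symm) with hpos | hneg
    · refine ⟨1, Or.inl rfl, hside 1 ?_⟩
      simpa using hpos
    · refine ⟨-1, Or.inr rfl, hside (-1) ?_⟩
      simpa using hneg
  · exact Or.inl ⟨q, ⟨hq, h0⟩, le_inf hlim (le_principal_iff.2 hII)⟩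

/-- Away from their ends, the pieces of orbits between two visits to the cross-section stay away
from all points of return. -/
theorem exists_separation (hL : L.f (1 / 2) < 1 / 2) {σ : ℝ} (hσ : 0 < σ) :
    ∃ η > 0, ∀ q ∈ dom, ∀ q' ∈ dom, ∀ t, σ ≤ t → t ≤ L.ret q.1 q.2 - σ →
      η ≤ dist (L.flow t (L.sec q.1 q.2)) (L.sec (L.P q').1 (L.P q').2) := by
  -- Separation is sought from return points only: an orbit could pass close to the edge of the
  -- section without crossing it.
  set R : Set E3 := (fun q => L.sec (L.P q).1 (L.P q).2) '' dom
  set A : Set ((ℝ × ℝ) × ℝ) := {a | a.1 ∈ dom ∧ σ ≤ a.2 ∧ a.2 ≤ L.ret a.1.1 a.1.2 - σ} with hA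
  set B : Set E3 := (fun a : (ℝ × ℝ) × ℝ => L.flow a.2 (L.sec a.1.1 a.1.2)) '' A
  choose! T hTpos hTsec hT using fun s => L.exists_transit (s := s)
  have hRsub : R ⊆ sectionOf L.chart := by
    rintro _ ⟨q, hq, rfl⟩; exact L.P_sec_mem hq
  have hRcpt : IsCompact (closure R) :=
    L.isCompact_section.of_isClosed_subset isClosed_closure
      (closure_minimal hRsub L.isCompact_section.isClosed)
  have hdisj : Disjoint (closure R) (closure B) := by
    rw [Set.disjoint_left]
    intro r hrR hrB
    obtain ⟨𝒱, h𝒱, hVr⟩ := exists_ultrafilter_of_mem_closure_image hrR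
    obtain ⟨𝒰, h𝒰, hUr⟩ := exists_ultrafilter_of_mem_closure_image hrB
    rcases exists_limit 𝒱 h𝒱 with ⟨q, hq, hle⟩ | ⟨s, hs, hle⟩
    -- An interior return point: orbits near it cross within time `σ`, too early for a first return.
    · have hr : r = L.sec (L.P q).1 (L.P q).2 := by
        refine tendsto_nhds_unique hVr ?_
        exact ((L.tendsto_sec_nhdsWithin (L.P_mem hq)).comp (L.tendsto_P hL hq)).mono_left hle
      subst hr
      have hev := hUr.eventually (L.eventually_crosses (L.f_mem_interior hL hq.1.1 hq.2)
        (L.g_mem _ hq.1.1 hq.2 _ hq.1.2) hσ)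
      obtain ⟨a, ⟨θ, hθ, hS⟩, ha⟩ := (hev.and h𝒰).exists
      rw [← L.flow.map_add] at hS
      have := L.ret_le ha.1 (by linarith [ha.2.1, neg_abs_le θ]) hS
      linarith [ha.2.2, le_abs_self θ]
    -- The limit is the point where an unstable branch hits the section, possibly on its edge, so
    -- crossing cannot be used. The excursions themselves are passed to the limit instead.
    · have hr : r = L.flow (T s) (L.vtx s) :=
        tendsto_nhds_unique hVr ((L.tendsto_sec_P_edge hs (hT s hs)).mono_left hle)
      have hrS : r ∈ sectionOf L.chart := hr ▸ hTsec s hs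
      have hfst : Tendsto Prod.fst (𝒰 : Filter ((ℝ × ℝ) × ℝ)) (𝒰.map Prod.fst) := le_rfl
      rcases exists_limit (𝒰.map Prod.fst) (Ultrafilter.mem_map.2 (by
        filter_upwards [h𝒰] with a ha using ha.1)) with ⟨q, hq, hle'⟩ | ⟨s', hs', hle'⟩
      · replace hfst := hfst.mono_right hle'
        obtain ⟨t, ht, hlim⟩ := 𝒰.exists_tendsto_of_isCompact
          (isCompact_Icc (a := σ) (b := L.ret q.1 q.2 + 1)) (f := Prod.snd) (by
            filter_upwards [h𝒰, hfst.eventually (L.eventually_ret_lt hL hq one_pos)] with a h1 h2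
            exact ⟨h1.2.1, by linarith [h1.2.2]⟩)
        have hle : t ≤ L.ret q.1 q.2 - σ := by
          refine le_of_tendsto_of_tendsto hlim
            (((L.tendsto_ret hL hq).comp hfst).sub_const σ) ?_
          filter_upwards [h𝒰] with a ha using ha.2.2
        have hr' := tendsto_nhds_unique hUr
          (L.tendsto_flow hlim ((L.tendsto_sec_nhdsWithin hq.1).comp hfst))
        have := L.ret_le hq (hσ.trans_le ht.1) (hr' ▸ hrS)
        linarith
      · replace hfst := hfst.mono_right hle'
        rcases 𝒰.eventually_or.1 (Eventually.of_forall fun a : (ℝ × ℝ) × ℝ =>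
            le_total a.2 (L.exitT a.1.1)) with hcase | hcase
        · have hcl : IsClosed {v : E3 | v 2 ≤ Real.exp (L.l₃ * σ)} :=
            isClosed_le (continuous_coord 2) continuous_const
          have hmem : r ∈ L.box {v | v 2 ≤ Real.exp (L.l₃ * σ)} := by
            refine (L.isCompact_box hcl).isClosed.mem_of_tendsto hUr ?_
            filter_upwards [h𝒰, hcase] with a ha h
            refine L.flow_sec_mem_box ha.1.1.2 (hσ.le.trans ha.2.1)
              ((L.le_exitT_iff ha.1.2).1 h) ?_
            exact Real.exp_le_exp.2 (mul_le_mul_of_nonpos_left ha.2.1 L.l₃_neg'.le)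
          refine Set.disjoint_left.1 (L.section_disjoint_box fun v hv => ?_) hrS hmem
          exact (lt_of_le_of_lt (show v 2 ≤ _ from hv) (L.exp_lt_one hσ)).ne
        -- After the exit the excursions converge to a piece of an unstable branch, so `r` is
        -- reached on branch `s` at time `T s` and on branch `s'` at some `t ≤ T s' - σ`. By
        -- `flow_vtx_eq` both branches and both times agree.
        · have hTr := (hT s' hs').comp hfst
          obtain ⟨t, ht, hlim⟩ := 𝒰.exists_tendsto_of_isCompact
            (isCompact_Icc (a := 0) (b := T s' + 1)) (f := fun a => a.2 - L.exitT a.1.1) (by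
              filter_upwards [h𝒰, hcase, hTr.eventually (gt_mem_nhds (lt_add_one (T s')))]
                with a h1 h2 h3
              simp only [Function.comp_apply] at h3
              exact ⟨by linarith, by linarith [h1.2.2]⟩)
          have hle : t ≤ T s' - σ := by
            refine le_of_tendsto_of_tendsto hlim (hTr.sub_const σ) ?_
            filter_upwards [h𝒰] with a ha
            simp only [Function.comp_apply]
            linarith [ha.2.2]
          have hr' : r = L.flow t (L.vtx s') := by
            refine tendsto_nhds_unique hUr
              ((L.tendsto_flow hlim ((L.tendsto_flow_exitT hs').comp hfst)).congr fun a => ?_)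
            simp only [Function.comp_apply]
            rw [← L.flow.map_add, sub_add_cancel]
          have := L.flow_vtx_eq (c := T s - t) hs hs' (by
            rw [sub_eq_neg_add, L.flow.map_add, ← hr, hr', ← L.flow.map_add, neg_add_cancel,
              L.flow.map_zero_apply])
          obtain ⟨h0, rfl⟩ := this
          linarith
  obtain ⟨η, hη, hd⟩ := hdisj.exists_thickenings hRcpt isClosed_closure
  refine ⟨η, hη, fun q hq q' hq' t h1 h2 => ?_⟩
  by_contra! hlt
  have hR : L.sec (L.P q').1 (L.P q').2 ∈ closure R := subset_closure ⟨q', hq', rfl⟩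
  have hB : L.flow t (L.sec q.1 q.2) ∈ closure B := subset_closure ⟨(q, t), ⟨hq, h1, h2⟩, rfl⟩
  exact Set.disjoint_left.1 hd (Metric.mem_thickening_iff.2 ⟨_, hR, hlt⟩)
    (Metric.self_subset_thickening hη _ hB)

end GeometricLorenzFlow
end Lorenz

/-! ### Iterated returns and points of the attractor. -/

namespace Lorenz

namespace GeometricLorenzFlow

variable (L : GeometricLorenzFlow)

theorem fst_iterate_P (n : ℕ) (q : ℝ × ℝ) : (L.P^[n] q).1 = L.f^[n] q.1 := by
  induction n with
  | zero => rfl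
  | succ n ih => rw [Function.iterate_succ_apply', Function.iterate_succ_apply', P, ih]

variable {L}

theorem Avoids.iterate_P_mem {n : ℕ} {q : ℝ × ℝ} (h : L.Avoids n q.1) (hq : q ∈ I ×ˢ I) :
    L.P^[n] q ∈ I ×ˢ I := by
  induction n with
  | zero => exact hq
  | succ n ih =>
    rw [Function.iterate_succ_apply']
    exact L.P_mem ⟨ih (h.mono n.le_succ), by rw [fst_iterate_P]; exact h n n.lt_succ_self⟩

theorem Avoids.iterate_P_mem_dom {n j : ℕ} {q : ℝ × ℝ} (h : L.Avoids n q.1) (hq : q ∈ I ×ˢ I)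
    (hj : j < n) : L.P^[j] q ∈ dom :=
  ⟨(h.mono hj.le).iterate_P_mem hq, by rw [fst_iterate_P]; exact h j hj⟩

theorem Avoids.tendsto_iterate_P (hL : L.f (1 / 2) < 1 / 2) {n : ℕ} {q : ℝ × ℝ}
    (h : L.Avoids n q.1) (hq : q ∈ I ×ˢ I) :
    Tendsto L.P^[n] (𝓝[I ×ˢ I] q) (𝓝[I ×ˢ I] (L.P^[n] q)) := by
  induction n with
  | zero => exact tendsto_id
  | succ n ih =>
    rw [Function.iterate_succ', Function.comp_apply]
    exact (L.tendsto_P hL (h.iterate_P_mem_dom hq n.lt_succ_self)).comp (ih (h.mono n.le_succ))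

variable (L)

theorem rate_pos : 0 < L.rate := by
  have h : (1 / 2 : ℝ) ∈ I := by rw [mem_I]; norm_num
  exact (L.gy_pos _ h (by norm_num) _ h).trans (L.gy_lt _ h (by norm_num) _ h)

theorem abs_g_sub_le {x y y' : ℝ} (hx : x ∈ I) (h0 : x ≠ 0) (hy : y ∈ I) (hy' : y' ∈ I) :
    |L.g x y - L.g x y'| ≤ L.rate * |y - y'| := by
  refine (convex_Icc _ _).norm_image_sub_le_of_norm_hasDerivWithin_le
    (fun z hz => L.hasDeriv_g x hx h0 z hz) (fun z hz => ?_) hy' hy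
  rw [Real.norm_eq_abs, abs_of_pos (L.gy_pos x hx h0 z hz)]
  exact (L.gy_lt x hx h0 z hz).le

variable {L}

/-- Contraction along the leaves. -/
theorem Avoids.dist_iterate_P_le {n : ℕ} {x y y' : ℝ} (h : L.Avoids n x) (hx : x ∈ I) (hy : y ∈ I)
    (hy' : y' ∈ I) : dist (L.P^[n] (x, y)) (L.P^[n] (x, y')) ≤ L.rate ^ n := by
  have key : |(L.P^[n] (x, y)).2 - (L.P^[n] (x, y')).2| ≤ L.rate ^ n := by
    induction n with
    | zero =>
      rw [pow_zero]
      change |y - y'| ≤ 1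
      exact abs_le.2 ⟨by linarith [hy.1, hy'.2], by linarith [hy.2, hy'.1]⟩
    | succ n ih =>
      have h' := h.mono n.le_succ
      have e1 := fst_iterate_P L n (x, y)
      have e2 := fst_iterate_P L n (x, y')
      rw [Function.iterate_succ_apply', Function.iterate_succ_apply']
      simp only [P, e1, e2]
      refine (L.abs_g_sub_le (h'.iterate_mem hx) (h n n.lt_succ_self)
        (h'.iterate_P_mem (q := (x, y)) ⟨hx, hy⟩).2
        (h'.iterate_P_mem (q := (x, y')) ⟨hx, hy'⟩).2).trans ?_
      rw [pow_succ']
      exact mul_le_mul_of_nonneg_left (ih h') L.rate_pos.le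
  rw [Prod.dist_eq, fst_iterate_P, fst_iterate_P, dist_self, Real.dist_eq]
  exact max_le (pow_nonneg L.rate_pos.le n) key

variable (L)

/-- The time of the `n`-th return. -/
noncomputable def retSum (n : ℕ) (q : ℝ × ℝ) : ℝ :=
  ∑ j ∈ Finset.range n, L.ret (L.P^[j] q).1 (L.P^[j] q).2

theorem retSum_succ' (n : ℕ) (q : ℝ × ℝ) :
    L.retSum (n + 1) q = L.retSum n (L.P q) + L.ret q.1 q.2 := by
  rw [retSum, Finset.sum_range_succ']
  rfl

variable {L}

theorem Avoids.flow_retSum {n : ℕ} {q : ℝ × ℝ} (h : L.Avoids n q.1) (hq : q ∈ I ×ˢ I) :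
    L.flow (L.retSum n q) (L.sec q.1 q.2) = L.sec (L.P^[n] q).1 (L.P^[n] q).2 := by
  induction n with
  | zero => simp [retSum, L.flow.map_zero_apply]
  | succ n ih =>
    have hd := h.iterate_P_mem_dom hq n.lt_succ_self
    rw [retSum, Finset.sum_range_succ, ← retSum, add_comm, L.flow.map_add, ih (h.mono n.le_succ),
      L.flow_ret hd, Function.iterate_succ_apply']

theorem Avoids.mul_gap_le_retSum {n : ℕ} {q : ℝ × ℝ} (h : L.Avoids n q.1) (hq : q ∈ I ×ˢ I) :
    n * L.gap ≤ L.retSum n q := by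
  have := Finset.card_nsmul_le_sum (Finset.range n)
    (fun j => L.ret (L.P^[j] q).1 (L.P^[j] q).2) L.gap fun j hj =>
      (L.gap_lt_ret (h.iterate_P_mem_dom hq (Finset.mem_range.1 hj))).le
  simpa [retSum] using this

variable (L)

theorem flow_mem_U {p : E3} (hp : p ∈ L.U) {t : ℝ} (ht : 0 ≤ t) : L.flow t p ∈ L.U := by
  rcases ht.eq_or_lt with rfl | h
  · rwa [L.flow.map_zero_apply]
  · exact interior_subset (L.trapping t h ⟨p, hp, rfl⟩)

theorem sec_mem_U {x y : ℝ} (hx : x ∈ I) (hy : y ∈ I) : L.sec x y ∈ L.U :=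
  L.section_subset (L.sec_mem hx hy)

theorem mem_attractor {p : E3} (h : ∀ t, 0 ≤ t → L.flow (-t) p ∈ L.U) : p ∈ L.attractor := by
  simp only [attractor, mem_iInter, mem_Ici]
  intro t ht
  exact ⟨_, h t ht, by rw [← L.flow.map_add, add_neg_cancel, L.flow.map_zero_apply]⟩

theorem attractor_subset_interior : L.attractor ⊆ interior L.U := fun _ hp =>
  L.trapping 1 one_pos (mem_iInter₂.1 hp 1 (mem_Ici.2 zero_le_one))

theorem isCompact_attractor : IsCompact L.attractor := by
  have hc : ∀ t, IsCompact (L.flow t '' L.U) := fun t =>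
    L.isCompact_U.image (L.flow.continuous continuous_const continuous_id)
  refine L.isCompact_U.of_isClosed_subset ?_ (L.attractor_subset_interior.trans interior_subset)
  exact isClosed_iInter fun t => isClosed_iInter fun _ => (hc t).isClosed

/-- The right end `b` of the range of `f` on the left branch, and the height of the corresponding
point of the unstable branch of the singularity. -/
theorem exists_branch_end : ∃ b β : ℝ, b ∈ I ∧ β ∈ I ∧
    Tendsto L.P (edge (-1)) (𝓝[I ×ˢ I] (b, β)) := by
  obtain ⟨T, -, hS, hT⟩ := L.exists_transit (Or.inr rfl)
  obtain ⟨b, hb, β, hβ, he⟩ := L.exists_eq_sec hS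
  have hlim := L.tendsto_sec_P_edge (Or.inr rfl) hT
  rw [he] at hlim
  have hmem : ∀ᶠ q in edge (-1), L.P q ∈ I ×ˢ I := by
    filter_upwards [eventually_edge (-1)] with q hq using L.P_mem hq.1
  have := L.tendsto_coords_of_tendsto_sec hb hβ hmem hlim
  exact ⟨b, β, hb, hβ, tendsto_nhdsWithin_iff.2 ⟨this.1.prodMk_nhds this.2, hmem⟩⟩

theorem tendsto_f_left {b β : ℝ} (h : Tendsto L.P (edge (-1)) (𝓝[I ×ˢ I] (b, β))) :
    Tendsto L.f (𝓝[<] 0) (𝓝 b) := by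
  have hin : Tendsto (fun x : ℝ => (x, (0 : ℝ))) (𝓝[<] 0) (edge (-1)) := by
    refine Tendsto.prodMk ?_ (tendsto_principal.2 (Eventually.of_forall fun _ => zero_mem_I))
    refine tendsto_nhdsWithin_iff.2 ⟨tendsto_id.mono_left nhdsWithin_le_nhds, ?_⟩
    have : I ∈ 𝓝 (0 : ℝ) := Icc_mem_nhds (by norm_num) (by norm_num)
    filter_upwards [self_mem_nhdsWithin, nhdsWithin_le_nhds this] with x h1 h2
    exact ⟨h2, by simpa using h1⟩
  have := (h.mono_right nhdsWithin_le_nhds).comp hin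
  exact (continuous_fst.tendsto _).comp this

/-- Monotonicity on the left branch; the intermediate leaf `x / 2` makes the inequality strict. -/
theorem f_lt_branch_end {b : ℝ} (h : Tendsto L.f (𝓝[<] 0) (𝓝 b)) {x : ℝ} (hx : x ∈ I)
    (h0 : x < 0) : L.f x < b := by
  have hm : x / 2 ∈ I := ⟨by linarith [hx.1], by linarith⟩
  have hle : L.f (x / 2) ≤ b := by
    refine ge_of_tendsto h ?_
    filter_upwards [Ioo_mem_nhdsLT (show x / 2 < 0 by linarith)] with t ht
    exact (L.f_lt hm ⟨by linarith [hx.1, ht.1], by linarith [ht.2]⟩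
      (mul_pos_of_neg_of_neg (by linarith) ht.2) ht.1).le
  exact (L.f_lt hx hm (mul_pos_of_neg_of_neg h0 (by linarith)) (by linarith)).trans_le hle

theorem branch_end_pos (hL : L.f (1 / 2) < 1 / 2) {b : ℝ} (h : Tendsto L.f (𝓝[<] 0) (𝓝 b)) :
    0 < b := by
  have hm : (-(1 / 2) : ℝ) ∈ I := by rw [mem_I]; norm_num
  have h1 := L.f_mem_interior hL hm (by norm_num)
  rw [interior_I] at h1
  have hlin : Tendsto (fun t : ℝ => L.f (-(1 / 2)) + L.lam * (t - -(1 / 2))) (𝓝[<] 0)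
      (𝓝 (L.f (-(1 / 2)) + L.lam * (0 - -(1 / 2)))) :=
    (Continuous.tendsto (by fun_prop) 0).mono_left nhdsWithin_le_nhds
  have hle := le_of_tendsto_of_tendsto hlin h (by
    filter_upwards [Ioo_mem_nhdsLT (show (-(1 / 2) : ℝ) < 0 by norm_num)] with t ht
    have := L.f_sub_le hm ⟨ht.1.le, by linarith [ht.2]⟩
      (mul_pos_of_neg_of_neg (by norm_num) ht.2) ht.1.le
    linarith)
  linarith [L.one_lt_lam, h1.1]

theorem tendsto_f_right {b : ℝ} (h : Tendsto L.f (𝓝[<] 0) (𝓝 b)) :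
    Tendsto L.f (𝓝[>] 0) (𝓝 (-b)) := by
  have hneg : Tendsto (fun x : ℝ => -x) (𝓝[>] 0) (𝓝[<] 0) := by
    have := tendsto_neg_nhdsGT (a := (0 : ℝ))
    rwa [neg_zero] at this
  refine (h.comp hneg).neg.congr' ?_
  filter_upwards [Ioo_mem_nhdsGT (show (0 : ℝ) < 1 / 2 by norm_num)] with x hx
  have hxI : x ∈ I := ⟨by linarith [hx.1], hx.2.le⟩
  simp [L.f_odd x hxI hx.1.ne']

/-- The right branch starts at `-b` and gains at least `lam * b > b` on `(0, b]`. -/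
theorem f_branch_end_pos {b : ℝ} (hb : b ∈ I) (h0 : 0 < b) (h : Tendsto L.f (𝓝[<] 0) (𝓝 b)) :
    0 < L.f b := by
  have hlin : Tendsto (fun t : ℝ => L.f b - L.lam * (b - t)) (𝓝[>] 0)
      (𝓝 (L.f b - L.lam * (b - 0))) :=
    (Continuous.tendsto (by fun_prop) 0).mono_left nhdsWithin_le_nhds
  have hle := le_of_tendsto_of_tendsto (L.tendsto_f_right h) hlin (by
    filter_upwards [Ioo_mem_nhdsGT h0] with t ht
    have := L.f_sub_le ⟨by linarith [ht.1], ht.2.le.trans hb.2⟩ hb (mul_pos ht.1 h0) ht.2.le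
    linarith)
  nlinarith [L.one_lt_lam]

/-- The branch on `(0, b)` covers `(-b, f b)` and, by symmetry, the one on `(-b, 0)` covers `(-f b,
b)`. They overlap because `f b > 0`. -/
theorem exists_preimage {b : ℝ} (hb : b ∈ I) (h0 : 0 < b) (h : Tendsto L.f (𝓝[<] 0) (𝓝 b)) {x : ℝ}
    (hx : x ∈ Ioo (-b) b) : ∃ w ∈ Ioo (-b) b, w ≠ 0 ∧ L.f w = x := by
  have key : ∀ x ∈ Ioo (-b) b, x < L.f b → ∃ w ∈ Ioo 0 b, L.f w = x := by
    intro x hx hxb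
    obtain ⟨t, htx, ht⟩ := (((L.tendsto_f_right h).eventually (gt_mem_nhds hx.1)).and
      (Ioo_mem_nhdsGT h0)).exists
    have hcont : ContinuousOn L.f (Icc t b) := fun z hz =>
      (L.hasDeriv_f z ⟨by linarith [hz.1, ht.1], hz.2.trans hb.2⟩
        (ht.1.trans_le hz.1).ne').continuousWithinAt.mono fun z hz =>
          ⟨by linarith [hz.1, ht.1], hz.2.trans hb.2⟩
    obtain ⟨w, hw, rfl⟩ := intermediate_value_Ioo ht.2.le hcont ⟨htx, hxb⟩
    exact ⟨w, ⟨ht.1.trans hw.1, hw.2⟩, rfl⟩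
  rcases lt_or_ge x (L.f b) with hlt | hge
  · obtain ⟨w, hw, hwx⟩ := key x hx hlt
    exact ⟨w, ⟨by linarith [hw.1], hw.2⟩, hw.1.ne', hwx⟩
  · have hfb := L.f_branch_end_pos hb h0 h
    obtain ⟨w, hw, hwx⟩ := key (-x) ⟨by linarith [hx.2], by linarith [hx.1]⟩ (by linarith)
    have hwI : w ∈ I := ⟨by linarith [hw.1], hw.2.le.trans hb.2⟩
    refine ⟨-w, ⟨by linarith [hw.2], by linarith [hw.1]⟩, neg_ne_zero.2 hw.1.ne', ?_⟩
    rw [L.f_odd w hwI hw.1.ne', hwx, neg_neg]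

/-- Every leaf strictly between `-b` and `b` meets the attractor. -/
theorem exists_sec_mem_attractor {b : ℝ} (hb : b ∈ I) (h0 : 0 < b)
    (h : Tendsto L.f (𝓝[<] 0) (𝓝 b)) {x : ℝ} (hx : x ∈ Ioo (-b) b) :
    ∃ y ∈ I, L.sec x y ∈ L.attractor := by
  choose! pre hpre hpre0 hfpre using fun x hx => L.exists_preimage hb h0 h (x := x) hx
  have hIoo : ∀ z ∈ Ioo (-b) b, z ∈ I := fun z hz =>
    ⟨by linarith [hz.1, hb.2], by linarith [hz.2, hb.2]⟩
  have hmem : ∀ n, pre^[n] x ∈ Ioo (-b) b := by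
    intro n
    induction n with
    | zero => exact hx
    | succ n ih => rw [Function.iterate_succ_apply']; exact hpre _ ih
  have hiter : ∀ j n, L.f^[j] (pre^[n + j] x) = pre^[n] x := by
    intro j n
    induction j with
    | zero => rfl
    | succ j ih =>
      rw [← add_assoc, Function.iterate_succ_apply, Function.iterate_succ_apply' pre,
        hfpre _ (hmem _), ih]
  have hav : ∀ n, L.Avoids n (pre^[n] x) := by
    intro n j hj
    obtain ⟨i, rfl⟩ := Nat.exists_eq_add_of_lt hj
    rw [show j + i + 1 = (i + 1) + j by ring, hiter, Function.iterate_succ_apply']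
    exact hpre0 _ (hmem i)
  -- The `n`-th image of `q n` lies on the leaf over `x` and has a past in `U` of length at least `n
  -- * gap`. A limit of these images therefore has its whole past in `U`.
  set q : ℕ → ℝ × ℝ := fun n => (pre^[n] x, 0)
  have hq : ∀ n, q n ∈ I ×ˢ I := fun n => ⟨hIoo _ (hmem n), zero_mem_I⟩
  have hfst : ∀ n, (L.P^[n] (q n)).1 = x := fun n => by
    rw [fst_iterate_P]
    simpa using hiter n 0
  obtain ⟨y, hy, hlim⟩ := (hyperfilter ℕ).exists_tendsto_of_isCompact isCompact_I
    (f := fun n => (L.P^[n] (q n)).2)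
    (Eventually.of_forall fun n => ((hav n).iterate_P_mem (q := q n) (hq n)).2)
  refine ⟨y, hy, L.mem_attractor fun t ht => ?_⟩
  refine L.isCompact_U.isClosed.mem_of_tendsto
    (L.tendsto_flow (tendsto_const_nhds (x := -t))
      (L.tendsto_sec (hIoo _ hx) hy tendsto_const_nhds hlim)) ?_
  obtain ⟨N, hN⟩ := exists_nat_ge (t / L.gap)
  have hev : ∀ᶠ n in (hyperfilter ℕ : Filter ℕ), N ≤ n :=
    Nat.hyperfilter_le_atTop (eventually_ge_atTop N)
  filter_upwards [hev] with n hn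
  have hflow := (hav n).flow_retSum (q := q n) (hq n)
  rw [hfst] at hflow
  rw [← hflow, ← L.flow.map_add]
  refine L.flow_mem_U (L.sec_mem_U (hq n).1 (hq n).2) ?_
  have h1 := (hav n).mul_gap_le_retSum (q := q n) (hq n)
  have h2 : t ≤ N * L.gap := (div_le_iff₀ L.gap_pos).1 hN
  have h3 : (N : ℝ) * L.gap ≤ n * L.gap :=
    mul_le_mul_of_nonneg_right (Nat.cast_le.2 hn) L.gap_pos.le
  linarith

theorem tendsto_flow_sec_zero {y : ℝ} (hy : y ∈ I) :
    Tendsto (fun t => L.flow t (L.sec 0 y)) atTop (𝓝 0) := by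
  have hexp : ∀ l < 0, Tendsto (fun t : ℝ => Real.exp (l * t)) atTop (𝓝 0) :=
    fun l hl => Real.tendsto_exp_atBot.comp (tendsto_id.const_mul_atTop_of_neg hl)
  have hlim := L.tendsto_pt L.zero_mem_target (l := atTop) (tendsto_const_nhds (x := (0 : ℝ)))
    (by simpa using (hexp _ L.l₂_neg).mul_const y) (hexp _ L.l₃_neg')
  rw [L.pt_zero] at hlim
  refine hlim.congr' ?_
  filter_upwards [eventually_ge_atTop 0] with t ht
  rw [L.flow_sec hy ht (by simp), mul_zero]

theorem zero_mem_U : (0 : E3) ∈ L.U := by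
  refine L.isCompact_U.isClosed.mem_of_tendsto (L.tendsto_flow_sec_zero zero_mem_I) ?_
  filter_upwards [eventually_ge_atTop 0] with t ht
  exact L.flow_mem_U (L.sec_mem_U zero_mem_I zero_mem_I) ht

theorem flow_zero (t : ℝ) : L.flow t 0 = 0 := by
  have key : ∀ t, 0 ≤ t → L.flow t 0 = 0 := by
    intro t ht
    rw [← L.pt_zero, L.flow_pt ht (by simp) (by simp) (by simp)]
    simp
  rcases le_total 0 t with h | h
  · exact key t h
  · conv_lhs => rw [← key (-t) (by linarith)]
    rw [← L.flow.map_add, add_neg_cancel, L.flow.map_zero_apply]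

theorem zero_mem_attractor : (0 : E3) ∈ L.attractor :=
  L.mem_attractor fun t _ => by rw [flow_zero]; exact L.zero_mem_U

/-- Points of the section near the singular leaf come near the singularity. -/
theorem exists_passage_near_zero {ε : ℝ} (hε : 0 < ε) : ∃ α, 2 ≤ α ∧ ∃ δ > 0,
    ∀ x y, |x| < δ → y ∈ I →
    dist (L.flow α (L.sec x y)) 0 < ε ∧ |x| * Real.exp (L.l₁ * α) ≤ 1 / 2 := by
  have hexp : ∀ l < 0, Tendsto (fun t : ℝ => Real.exp (l * t)) atTop (𝓝 0) :=
    fun l hl => Real.tendsto_exp_atBot.comp (tendsto_id.const_mul_atTop_of_neg hl)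
  have hlim := L.tendsto_pt (l := 𝓝 (0 : ℝ × ℝ × ℝ)) (a := fun p => p.1) (b := fun p => p.2.1)
    (c := fun p => p.2.2) L.zero_mem_target (continuous_fst.tendsto _)
    ((continuous_fst.comp continuous_snd).tendsto _)
    ((continuous_snd.comp continuous_snd).tendsto _)
  rw [L.pt_zero] at hlim
  obtain ⟨r, hr, hball⟩ := Metric.eventually_nhds_iff.1 (Metric.tendsto_nhds.1 hlim ε hε)
  obtain ⟨α, h2, h3, hα⟩ := (((hexp _ L.l₂_neg).eventually (gt_mem_nhds hr)).and
    (((hexp _ L.l₃_neg').eventually (gt_mem_nhds hr)).and (eventually_ge_atTop 2))).exists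
  have hpos := Real.exp_pos (L.l₁ * α)
  refine ⟨α, hα, min r (1 / 2) / Real.exp (L.l₁ * α), by positivity, fun x y hx hy => ?_⟩
  rw [lt_div_iff₀ hpos] at hx
  have hhalf := hx.le.trans (min_le_right _ _)
  refine ⟨?_, hhalf⟩
  rw [L.flow_sec hy (by linarith) (hhalf.trans (by norm_num))]
  refine @hball (_, _, _) ?_
  rw [Prod.dist_eq, Prod.dist_eq]
  simp only [Prod.fst_zero, Prod.snd_zero, dist_zero_right, Real.norm_eq_abs, abs_mul,
    abs_of_pos (Real.exp_pos _)]
  refine max_lt ?_ (max_lt ?_ ?_)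
  · rw [mul_comm]; exact hx.trans_le (min_le_left _ _)
  · exact (mul_le_of_le_one_right (Real.exp_pos _).le
      ((abs_le_of_mem_I hy).trans (by norm_num))).trans_lt h2
  · exact (abs_of_pos (Real.exp_pos _)).trans_lt h3

end GeometricLorenzFlow
end Lorenz

/-! ### Scales, and how a shadow reproduces one passage through the cube. -/

namespace Lorenz

namespace GeometricLorenzFlow

variable (L : GeometricLorenzFlow)

/-- The part of the cube on the side `s = ±1`, up to a thin neighbourhood of the singular leaf. -/
def side (s : ℝ) : Set E3 := L.box {v | -(1 / 2) ≤ s * v 0}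

/-- The exit face of the cube on the side `s = ±1`. -/
def face (s : ℝ) : Set E3 := L.box {v | s * v 0 = 1}

/-- The part of the cube below the height which the orbits of the section have at time `σ`. -/
def lower (σ : ℝ) : Set E3 := L.box {v | v 2 ≤ Real.exp (L.l₃ * σ)}

/-- Time and space scales at which the passages through the cube can be recognized, for
reparametrizations with Lipschitz constant `K`. -/
structure IsScale (K σ η : ℝ) : Prop where
  σ_pos : 0 < σ
  σ_le_one : σ ≤ 1
  η_pos : 0 < η
  σ_lt_gap : σ + K * σ < L.gap
  separation : ∀ q ∈ dom, ∀ q' ∈ dom, ∀ t, σ ≤ t → t ≤ L.ret q.1 q.2 - σ →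
    η ≤ dist (L.flow t (L.sec q.1 q.2)) (L.sec (L.P q').1 (L.P q').2)
  face_section : ∀ s : ℝ, s = 1 ∨ s = -1 → ∀ p ∈ sectionOf L.chart, ∀ θ, |θ| ≤ σ →
    ∀ r ∈ L.face s, η ≤ dist (L.flow θ p) r
  face_side : ∀ s : ℝ, s = 1 ∨ s = -1 → ∀ p ∈ L.face (-s), ∀ r ∈ L.side s, η ≤ dist p r
  wrong_side_face : ∀ s : ℝ, s = 1 ∨ s = -1 → ∀ p ∈ L.box {v | s * v 0 ≤ 0}, ∀ r ∈ L.face s,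
    η ≤ dist p r
  lower_section : ∀ p ∈ sectionOf L.chart, ∀ r ∈ L.lower σ, η ≤ dist p r

theorem _root_.Disjoint.exists_forall_le_dist {A B : Set E3} (h : Disjoint A B)
    (hA : IsCompact A) (hB : IsCompact B) : ∃ η > 0, ∀ p ∈ A, ∀ r ∈ B, η ≤ dist p r := by
  obtain ⟨η, hη, hd⟩ := h.exists_thickenings hA hB.isClosed
  refine ⟨η, hη, fun p hp r hr => ?_⟩
  by_contra! hlt
  exact Set.disjoint_left.1 hd (Metric.self_subset_thickening hη _ hp)
    (Metric.mem_thickening_iff.2 ⟨r, hr, hlt⟩)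

/-- Points of a compact set move little in short times. -/
theorem exists_forall_dist_flow_lt {A : Set E3} (hA : IsCompact A) {η : ℝ} (hη : 0 < η) :
    ∃ κ > 0, ∀ p ∈ A, ∀ θ, |θ| ≤ κ → dist (L.flow θ p) p < η := by
  have hcont : Continuous fun a : E3 × ℝ => dist (L.flow a.2 a.1) a.1 :=
    (L.flow.continuous continuous_snd continuous_fst).dist continuous_fst
  have hopen : IsOpen {a : E3 × ℝ | dist (L.flow a.2 a.1) a.1 < η} :=
    isOpen_lt hcont continuous_const
  have hsub : A ×ˢ {(0 : ℝ)} ⊆ {a : E3 × ℝ | dist (L.flow a.2 a.1) a.1 < η} := by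
    rintro ⟨p, θ⟩ ⟨-, hθ⟩
    rw [mem_singleton_iff] at hθ
    change dist (L.flow θ p) p < η
    rwa [show θ = 0 from hθ, L.flow.map_zero_apply, dist_self]
  obtain ⟨u, v, -, hv, hAu, h0v, huv⟩ :=
    generalized_tube_lemma hA (isCompact_singleton (x := (0 : ℝ))) hopen hsub
  obtain ⟨κ, hκ, hball⟩ := Metric.isOpen_iff.1 hv 0 (h0v (mem_singleton _))
  refine ⟨κ / 2, by linarith, fun p hp θ hθ => ?_⟩
  have hθv : θ ∈ v := hball (by rw [Metric.mem_ball, Real.dist_eq, sub_zero]; linarith)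
  have : (p, θ) ∈ u ×ˢ v := ⟨hAu hp, hθv⟩
  simpa only [Set.mem_ofPred] using huv this

theorem isCompact_face (s : ℝ) : IsCompact (L.face s) :=
  L.isCompact_box (isClosed_eq (continuous_const.mul (continuous_coord 0)) continuous_const)

theorem isCompact_side (s : ℝ) : IsCompact (L.side s) :=
  L.isCompact_box (isClosed_le continuous_const (continuous_const.mul (continuous_coord 0)))

theorem isCompact_lower (σ : ℝ) : IsCompact (L.lower σ) :=
  L.isCompact_box (isClosed_le (continuous_coord 2) continuous_const)

/-- The time scale `σ` is fixed first, because the separation and the set `lower σ` depend on it.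
Then `η` is the least of finitely many positive distances, most of them between disjoint compact
parts of the cube. -/
theorem exists_isScale (hL : L.f (1 / 2) < 1 / 2) {K : ℝ} (hK : 0 ≤ K) :
    ∃ σ η, L.IsScale K σ η := by
  have hfs : ∀ s : ℝ, s = 1 ∨ s = -1 → Disjoint (sectionOf L.chart) (L.face s) := by
    intro s hs
    rw [sectionOf_eq_box]
    refine L.disjoint_box fun v _ hv hvF => ?_
    have h0 := hv.1
    have h1 : s * v 0 = 1 := hvF
    rcases hs with rfl | rfl <;> linarith [h0.1, h0.2]
  obtain ⟨a, ha, hfa⟩ := (hfs 1 (Or.inl rfl)).exists_forall_le_dist L.isCompact_section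
    (L.isCompact_face 1)
  obtain ⟨a', ha', hfa'⟩ := (hfs (-1) (Or.inr rfl)).exists_forall_le_dist L.isCompact_section
    (L.isCompact_face (-1))
  have hm : 0 < min a a' := lt_min ha ha'
  obtain ⟨κ, hκ, hmove⟩ := L.exists_forall_dist_flow_lt L.isCompact_section
    (half_pos hm)
  -- Up to time `κ` the section moves by less than half its distance to the exit faces; the last
  -- term gives `(1 + K) * σ ≤ gap / 2`.
  set σ := min (min κ 1) (L.gap / (2 * (1 + K)))
  have hgap := L.gap_pos
  have hσ : 0 < σ := by positivity
  have hσg : σ + K * σ < L.gap := by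
    have : σ ≤ L.gap / (2 * (1 + K)) := min_le_right _ _
    rw [le_div_iff₀ (by positivity)] at this
    nlinarith
  obtain ⟨η₁, h₁, hsep⟩ := L.exists_separation hL hσ
  have hside : ∀ s : ℝ, Disjoint (L.face (-s)) (L.side s) := by
    intro s
    refine L.disjoint_box fun v _ (hv : -s * v 0 = 1) (hv' : -(1 / 2) ≤ s * v 0) => ?_
    linarith
  have hwrong : ∀ s : ℝ, Disjoint (L.box {v | s * v 0 ≤ 0}) (L.face s) := by
    intro s
    refine L.disjoint_box fun v _ (hv : s * v 0 ≤ 0) (hv' : s * v 0 = 1) => ?_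
    linarith
  have hwc : ∀ s : ℝ, IsCompact (L.box {v | s * v 0 ≤ 0}) := fun s =>
    L.isCompact_box (isClosed_le (continuous_const.mul (continuous_coord 0)) continuous_const)
  choose η₂ h₂ hη₂ using fun s => (hside s).exists_forall_le_dist (L.isCompact_face _)
    (L.isCompact_side s)
  choose η₃ h₃ hη₃ using fun s => (hwrong s).exists_forall_le_dist (hwc s) (L.isCompact_face s)
  obtain ⟨η₄, h₄, hlow⟩ := (L.section_disjoint_box (Q := {v | v 2 ≤ Real.exp (L.l₃ * σ)})
    fun v (hv : v 2 ≤ _) => (hv.trans_lt (L.exp_lt_one hσ)).ne).exists_forall_le_dist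
      L.isCompact_section (L.isCompact_lower σ)
  set η := min (min (min a a' / 2) η₁) (min η₄ (min (min (η₂ 1) (η₂ (-1))) (min (η₃ 1) (η₃ (-1)))))
  have hη : 0 < η := by
    have := h₂ 1; have := h₂ (-1); have := h₃ 1; have := h₃ (-1)
    positivity
  have e1 : η ≤ min a a' / 2 := (min_le_left _ _).trans (min_le_left _ _)
  have e2 : η ≤ η₁ := (min_le_left _ _).trans (min_le_right _ _)
  have e3 : η ≤ η₄ := (min_le_right _ _).trans (min_le_left _ _)
  have e4 : η ≤ min (min (η₂ 1) (η₂ (-1))) (min (η₃ 1) (η₃ (-1))) :=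
    (min_le_right _ _).trans (min_le_right _ _)
  simp only [le_min_iff] at e4
  refine ⟨σ, η, hσ, (min_le_left _ _).trans (min_le_right _ _), hη, hσg, ?_, ?_, ?_, ?_, ?_⟩
  · exact fun q hq q' hq' t h h' => e2.trans (hsep q hq q' hq' t h h')
  · intro s hs p hp θ hθ r hr
    have h1 := hmove p hp θ (hθ.trans ((min_le_left _ _).trans (min_le_left _ _)))
    have h2 : min a a' ≤ dist p r := by
      rcases hs with rfl | rfl
      · exact (min_le_left _ _).trans (hfa p hp r hr)
      · exact (min_le_right _ _).trans (hfa' p hp r hr)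
    have := dist_triangle_left p r (L.flow θ p)
    linarith
  · rintro s (rfl | rfl) p hp r hr
    · exact e4.1.1.trans (hη₂ 1 p hp r hr)
    · exact e4.1.2.trans (hη₂ (-1) p hp r hr)
  · rintro s (rfl | rfl) p hp r hr
    · exact e4.2.1.trans (hη₃ 1 p hp r hr)
    · exact e4.2.2.trans (hη₃ (-1) p hp r hr)
  · exact fun p hp r hr => e3.trans (hlow p hp r hr)

/-- From time `τ` on, the orbit of `p` visits the section regularly; `h` reparametrizes it. -/
structure Shadow (K : ℝ) (h : ℝ ≃o ℝ) (p : E3) (τ : ℝ) : Prop where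
  lipschitz : ∀ u u', u ≤ u' → h u' - h u ≤ K * (u' - u)
  start : L.flow τ p ∈ sectionOf L.chart
  regular : ∀ t, τ ≤ t → L.flow t p ∈ sectionOf L.chart →
    ∃ q ∈ dom, L.flow t p = L.sec q.1 q.2

variable {L} {K σ η τ : ℝ} {h : ℝ ≃o ℝ} {p : E3}

/-- Successive returns are at least `gap` apart, so only finitely many of them precede `t`. -/
theorem Shadow.exists_last (hS : L.Shadow K h p τ) {t : ℝ} (ht : τ ≤ t) :
    ∃ t' q, τ ≤ t' ∧ t' ≤ t ∧ q ∈ dom ∧ L.flow t' p = L.sec q.1 q.2 ∧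
      t < t' + L.ret q.1 q.2 := by
  have key : ∀ n : ℕ, ∀ t', τ ≤ t' → t' ≤ t → L.flow t' p ∈ sectionOf L.chart →
      t - t' < n * L.gap → ∃ t' q, τ ≤ t' ∧ t' ≤ t ∧ q ∈ dom ∧ L.flow t' p = L.sec q.1 q.2 ∧
      t < t' + L.ret q.1 q.2 := by
    intro n
    induction n with
    | zero => intro t' _ h2 _ h4; simp at h4; linarith
    | succ n ih =>
      intro t' h1 h2 h3 h4
      obtain ⟨q, hq, he⟩ := hS.regular t' h1 h3
      by_cases hlt : t < t' + L.ret q.1 q.2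
      · exact ⟨t', q, h1, h2, hq, he, hlt⟩
      · push Not at hlt
        have hg := L.gap_lt_ret hq
        have := L.gap_pos
        refine ih (t' + L.ret q.1 q.2) (by linarith) hlt ?_ ?_
        · rw [add_comm, L.flow.map_add, he, L.flow_ret hq]
          exact L.P_sec_mem hq
        · push_cast at h4
          linarith
  obtain ⟨n, hn⟩ := exists_nat_gt ((t - τ) / L.gap)
  exact key n τ le_rfl ht hS.start ((div_lt_iff₀ L.gap_pos).1 hn)

variable (L) in
/-- The shadow crosses the section at a point of the leaf over `y` about the time `u`. -/
def Aligned (σ : ℝ) (h : ℝ ≃o ℝ) (p : E3) (τ u y : ℝ) : Prop :=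
  ∃ t v, |t - h u| < σ ∧ τ ≤ t ∧ (y, v) ∈ dom ∧ L.flow t p = L.sec y v

/-- By the separation, a point close to a return point is not in the middle of an excursion. It is
thus within time `σ` of the last crossing or of the next one. -/
theorem Shadow.exists_aligned (hS : L.Shadow K h p τ) (hsc : L.IsScale K σ η) {u : ℝ}
    (hu : τ ≤ h u) {q : ℝ × ℝ} (hq : q ∈ dom)
    (hclose : dist (L.flow (h u) p) (L.sec (L.P q).1 (L.P q).2) < η) :
    ∃ y, L.Aligned σ h p τ u y := by
  obtain ⟨t, a, h1, h2, ha, he, h3⟩ := hS.exists_last hu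
  have hrep : L.flow (h u) p = L.flow (h u - t) (L.sec a.1 a.2) := by
    rw [← he, ← L.flow.map_add, sub_add_cancel]
  rcases lt_or_ge (h u - t) σ with hlt | hge
  · exact ⟨a.1, t, a.2, by rw [abs_lt]; constructor <;> linarith [hsc.σ_pos], h1, ha, he⟩
  · rcases lt_or_ge (L.ret a.1 a.2 - σ) (h u - t) with hlt' | hge'
    · have he' : L.flow (t + L.ret a.1 a.2) p = L.sec (L.P a).1 (L.P a).2 := by
        rw [add_comm, L.flow.map_add, he, L.flow_ret ha]
      have hτ : τ ≤ t + L.ret a.1 a.2 := by linarith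
      obtain ⟨b, hb, heb⟩ := hS.regular _ hτ (he' ▸ L.P_sec_mem ha)
      exact ⟨b.1, _, b.2, by rw [abs_lt]; constructor <;> linarith [hsc.σ_pos], hτ, hb, heb⟩
    · have := hsc.separation a ha q hq _ hge hge'
      rw [← hrep] at this
      linarith

/-- A passage of the pseudo-orbit through the cube, followed by a return to the section, is
reproduced by its shadow. -/
theorem Shadow.passage (hS : L.Shadow K h p τ) (hsc : L.IsScale K σ η) {s : ℝ}
    (hs : s = 1 ∨ s = -1) {u₀ uₑ u₁ : ℝ} (h₀ : u₀ ≤ uₑ) (h₁ : uₑ ≤ u₁) {q : ℝ × ℝ} (hq : q ∈ dom)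
    (hside : ∀ u ∈ Icc u₀ uₑ, ∃ r ∈ L.side s, dist (L.flow (h u) p) r < η)
    (hlower : ∀ u ∈ Icc (u₀ + σ) uₑ, ∃ r ∈ L.lower σ, dist (L.flow (h u) p) r < η)
    (hface : ∃ r ∈ L.face s, dist (L.flow (h uₑ) p) r < η)
    (hσ : σ ≤ L.ret q.1 q.2 - (u₁ - uₑ))
    (hret : ∀ u ∈ Icc uₑ u₁,
      dist (L.flow (h u) p) (L.flow (L.ret q.1 q.2 - (u₁ - u)) (L.sec q.1 q.2)) < η)
    {y : ℝ} (hy : L.Aligned σ h p τ u₀ y) : 0 < s * y ∧ L.Aligned σ h p τ u₁ (L.f y) := by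
  obtain ⟨t₀, v, ht₀, hτ, hd, he⟩ := hy
  have hσpos := hsc.σ_pos
  have hgap := hsc.σ_lt_gap
  have hKσ : 0 ≤ K * σ := by
    have := hS.lipschitz 0 1 zero_le_one
    have h01 : h 0 ≤ h 1 := h.monotone zero_le_one
    exact mul_nonneg (by linarith) hσpos.le
  rw [abs_lt] at ht₀
  have hrep : ∀ t, L.flow t p = L.flow (t - t₀) (L.sec y v) := fun t => by
    rw [← he, ← L.flow.map_add, sub_add_cancel]
  have hmem : L.sec y v ∈ sectionOf L.chart := L.sec_mem hd.1.1 hd.1.2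
  have hmono := h.monotone h₀
  -- Within time `σ` of its crossing the shadow is still too close to the section to be near the
  -- exit face.
  have hlate : t₀ + σ < h uₑ := by
    by_contra! hle
    obtain ⟨r, hr, hdist⟩ := hface
    have := hsc.face_section s hs _ hmem (h uₑ - t₀)
      (by rw [abs_le]; constructor <;> linarith) r hr
    rw [← hrep] at this
    linarith
  have hexit := L.gap_le_exitT hd.1.1 hd.2
  have hsign : 0 < s * y := by
    -- On the wrong side, the shadow is either still in the wrong half of the cube when it should be
    -- at the face `s`, or it has gone through the face `-s` at a time when the pseudo-orbit is on
    -- the side `s`.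
    by_contra! hle
    have habs : s * y = -|y| := by
      rcases hs with rfl | rfl
      · rw [one_mul] at *; rw [abs_of_nonpos hle, neg_neg]
      · rw [neg_one_mul, abs_of_nonneg]; linarith
    rcases le_total (h uₑ) (t₀ + L.exitT y) with hc | hc
    · obtain ⟨r, hr, hdist⟩ := hface
      have hbox : L.flow (h uₑ - t₀) (L.sec y v) ∈ L.box {v | s * v 0 ≤ 0} := by
        refine L.flow_sec_mem_box hd.1.2 (by linarith) ((L.le_exitT_iff hd.2).1 (by linarith)) ?_
        change s * (Real.exp (L.l₁ * (h uₑ - t₀)) * y) ≤ 0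
        nlinarith [Real.exp_pos (L.l₁ * (h uₑ - t₀))]
      have := hsc.wrong_side_face s hs _ hbox r hr
      rw [← hrep] at this
      linarith
    · obtain ⟨u, hu⟩ := h.surjective (t₀ + L.exitT y)
      have h1 : u₀ ≤ u := by rw [← h.le_iff_le, hu]; linarith
      have h2 : u ≤ uₑ := by rw [← h.le_iff_le, hu]; exact hc
      obtain ⟨r, hr, hdist⟩ := hside u ⟨h1, h2⟩
      have hbox : L.flow (h u - t₀) (L.sec y v) ∈ L.face (-s) := by
        rw [hu, add_sub_cancel_left]
        refine L.flow_sec_mem_box hd.1.2 (by linarith [L.gap_pos])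
          (L.abs_mul_exp_exitT hd.2).le ?_
        change -s * (Real.exp (L.l₁ * L.exitT y) * y) = 1
        rw [← L.abs_mul_exp_exitT hd.2, show |y| = -(s * y) by linarith]
        ring
      have := hsc.face_side s hs _ hbox r hr
      rw [← hrep] at this
      linarith
  refine ⟨hsign, ?_⟩
  have hmono' := h.monotone h₁
  obtain ⟨y₁, t₁, v₁, ht₁, hτ₁, hd₁, he₁⟩ := hS.exists_aligned hsc (u := u₁) (by linarith) hq (by
    have := hret u₁ ⟨h₁, le_rfl⟩
    rwa [sub_self, sub_zero, L.flow_ret hq] at this)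
  rw [abs_lt] at ht₁
  have hle : L.ret y v ≤ t₁ - t₀ := by
    refine L.ret_le (q := (y, v)) hd (by linarith) ?_
    rw [← hrep, he₁]
    exact L.sec_mem hd₁.1.1 hd₁.1.2
  have hret₀ := L.gap_lt_ret hd
  have he₂ : L.flow (t₀ + L.ret y v) p = L.sec (L.P (y, v)).1 (L.P (y, v)).2 := by
    rw [add_comm, L.flow.map_add, he]
    exact L.flow_ret (q := (y, v)) hd
  have hτ₂ : τ ≤ t₀ + L.ret y v := by linarith [L.gap_pos]
  obtain ⟨b, hb, heb⟩ := hS.regular _ hτ₂ (he₂ ▸ L.P_sec_mem hd)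
  rcases hle.eq_or_lt with heq | hlt
  · have hcross : (L.P (y, v)).1 = b.1 ∧ (L.P (y, v)).2 = b.2 ∧ (1 : ℝ) = 1 := by
      have hPm := L.P_mem (q := (y, v)) hd
      exact L.pt_inj (L.cube_subset_target (sec_vec_mem_cube hPm.1 hPm.2))
        (L.cube_subset_target (sec_vec_mem_cube hb.1.1 hb.1.2)) (he₂.symm.trans heb)
    have hb1 : L.f y = b.1 := hcross.1
    refine ⟨t₀ + L.ret y v, b.2, ?_, hτ₂, ?_, ?_⟩
    · rw [abs_lt]; constructor <;> linarith
    · rw [hb1]; exact hb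
    · rw [hb1]; exact heb
  -- An extra return strictly between the two crossings is at least `gap` away from both. Since `σ +
  -- K * σ < gap`, its parameter lies in `[u₀ + σ, u₁ - σ]`, where the pseudo-orbit is either low in
  -- the cube or in mid-excursion, far from return points.
  · exfalso
    have hnext : L.ret b.1 b.2 ≤ t₁ - (t₀ + L.ret y v) := by
      refine L.ret_le hb (by linarith) ?_
      rw [← heb, ← L.flow.map_add, sub_add_cancel, he₁]
      exact L.sec_mem hd₁.1.1 hd₁.1.2
    have hg := L.gap_lt_ret hb
    obtain ⟨u, hu⟩ := h.surjective (t₀ + L.ret y v)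
    have h1 : u₀ + σ ≤ u := by
      by_contra! hlt
      have := h.monotone hlt.le
      have := hS.lipschitz u₀ (u₀ + σ) (by linarith)
      rw [add_sub_cancel_left] at this
      dsimp only at hret₀
      linarith
    have h2 : u ≤ u₁ - σ := by
      by_contra! hlt
      have := h.monotone hlt.le
      have := hS.lipschitz (u₁ - σ) u₁ (by linarith)
      rw [sub_sub_cancel] at this
      linarith
    rw [← hu] at he₂
    rcases le_total u uₑ with hc | hc
    · obtain ⟨r, hr, hdist⟩ := hlower u ⟨h1, hc⟩
      have := hsc.lower_section _ (L.P_sec_mem (q := (y, v)) hd) r hr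
      rw [← he₂] at this
      linarith
    · have hdist := hret u ⟨hc, by linarith⟩
      have := hsc.separation q hq (y, v) hd (L.ret q.1 q.2 - (u₁ - u)) (by linarith) (by linarith)
      rw [← he₂, dist_comm] at this
      linarith

/-- A passage near the singularity with at most one jump: until `u'` the pseudo-orbit comes from the
point `a` of the section near the singular leaf, and from then on from the point `q`. -/
theorem Shadow.passage_of_jump (hS : L.Shadow K h p τ) (hsc : L.IsScale K σ η) {u₀ u' u₁ : ℝ}
    {a q : ℝ × ℝ} (ha : a ∈ I ×ˢ I) (hq : q ∈ dom) (hu : u₀ ≤ u')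
    (haexp : |a.1| * Real.exp (L.l₁ * (u' - u₀)) ≤ 1 / 2)
    (hqexp : |q.1| * Real.exp (L.l₁ * (L.ret q.1 q.2 - (u₁ - u'))) ≤ 1)
    (hq0 : 0 ≤ L.ret q.1 q.2 - (u₁ - u'))
    (hσ : ∀ u, u' ≤ u → u₀ + σ ≤ u → σ ≤ L.ret q.1 q.2 - (u₁ - u))
    (hbefore : ∀ u ∈ Icc u₀ u',
      dist (L.flow (h u) p) (L.flow (u - u₀) (L.sec a.1 a.2)) < η)
    (hafter : ∀ u ∈ Icc u' u₁,
      dist (L.flow (h u) p) (L.flow (L.ret q.1 q.2 - (u₁ - u)) (L.sec q.1 q.2)) < η)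
    {y : ℝ} (hy : L.Aligned σ h p τ u₀ y) : 0 < y * q.1 ∧ L.Aligned σ h p τ u₁ (L.f y) := by
  obtain ⟨s, hs, hsq⟩ : ∃ s : ℝ, (s = 1 ∨ s = -1) ∧ s * q.1 = |q.1| := by
    rcases lt_or_gt_of_ne hq.2 with hlt | hgt
    · exact ⟨-1, Or.inr rfl, by rw [abs_of_neg hlt, neg_one_mul]⟩
    · exact ⟨1, Or.inl rfl, by rw [abs_of_pos hgt, one_mul]⟩
  have hsabs : |s| = 1 := by rcases hs with rfl | rfl <;> simp
  have hexit := L.exitT_lt_ret hq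
  have hgap := L.gap_le_exitT hq.1.1 hq.2
  have hσpos := hsc.σ_pos
  have hKσ : 0 ≤ K * σ := by
    have := hS.lipschitz 0 1 zero_le_one
    have h01 : h 0 ≤ h 1 := h.monotone zero_le_one
    exact mul_nonneg (by linarith) hσpos.le
  have hσg := hsc.σ_lt_gap
  have hle := (L.le_exitT_iff hq.2).2 hqexp
  have hexp_le : ∀ {x A B : ℝ} {c : ℝ}, A ≤ B → |x| * Real.exp (L.l₁ * B) ≤ c →
      |x| * Real.exp (L.l₁ * A) ≤ c := fun {x A B c} hAB hB => le_trans (by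
    have := L.l₁_pos
    gcongr) hB
  -- The parameter at which the orbit of `q` leaves the cube. Before the jump `|x| ≤ 1/2`, so the
  -- piece coming from `a` belongs to both sides and the exit side is decided by `q` alone.
  set uₑ := u₁ - (L.ret q.1 q.2 - L.exitT q.1) with huₑ
  have key : ∀ Q : Set E3, ∀ u ∈ Icc u₀ uₑ,
      (u ≤ u' → !₂[Real.exp (L.l₁ * (u - u₀)) * a.1, Real.exp (L.l₂ * (u - u₀)) * a.2,
        Real.exp (L.l₃ * (u - u₀))] ∈ Q) →
      (u' ≤ u → !₂[Real.exp (L.l₁ * (L.ret q.1 q.2 - (u₁ - u))) * q.1,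
        Real.exp (L.l₂ * (L.ret q.1 q.2 - (u₁ - u))) * q.2,
        Real.exp (L.l₃ * (L.ret q.1 q.2 - (u₁ - u)))] ∈ Q) →
      ∃ r ∈ L.box Q, dist (L.flow (h u) p) r < η := by
    intro Q u hu hQ hQ'
    rcases le_total u u' with hc | hc
    · refine ⟨_, L.flow_sec_mem_box ha.2 (by linarith [hu.1])
        ((hexp_le (by linarith) haexp).trans (by norm_num)) (hQ hc), hbefore u ⟨hu.1, hc⟩⟩
    · refine ⟨_, L.flow_sec_mem_box hq.1.2 (by linarith [hu.1])
        ((L.le_exitT_iff hq.2).1 (by linarith [hu.2])) (hQ' hc), hafter u ⟨hc, by linarith [hu.2]⟩⟩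
  have hu'ₑ : u' ≤ uₑ := by linarith
  have hexplow : ∀ t, σ ≤ t → Real.exp (L.l₃ * t) ≤ Real.exp (L.l₃ * σ) := fun t ht =>
    Real.exp_le_exp.2 (mul_le_mul_of_nonpos_left ht L.l₃_neg'.le)
  have := hS.passage hsc hs (u₀ := u₀) (uₑ := uₑ) (u₁ := u₁) (hu.trans hu'ₑ) (by linarith) hq
    (fun u hu => by
      refine key _ u hu (fun hc => ?_) fun hc => ?_
      · change -(1 / 2) ≤ s * (Real.exp (L.l₁ * (u - u₀)) * a.1)
        have h1 : |s * (Real.exp (L.l₁ * (u - u₀)) * a.1)| ≤ 1 / 2 := by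
          rw [abs_mul, hsabs, one_mul, abs_mul, abs_of_pos (Real.exp_pos _), mul_comm]
          exact hexp_le (by linarith) haexp
        exact (abs_le.1 h1).1
      · change -(1 / 2) ≤ s * (Real.exp (L.l₁ * (L.ret q.1 q.2 - (u₁ - u))) * q.1)
        have : 0 ≤ Real.exp (L.l₁ * (L.ret q.1 q.2 - (u₁ - u))) * (s * q.1) := by
          rw [hsq]; positivity
        linarith)
    (fun u hu => by
      refine key _ u ⟨by linarith [hu.1], hu.2⟩ (fun hc => ?_) fun hc => ?_
      · exact hexplow _ (by linarith [hu.1])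
      · exact hexplow _ (hσ u hc hu.1))
    ⟨_, L.flow_sec_mem_box hq.1.2 (t := L.exitT q.1) (by linarith)
      (L.abs_mul_exp_exitT hq.2).le (by
        change s * (Real.exp (L.l₁ * L.exitT q.1) * q.1) = 1
        rw [← L.abs_mul_exp_exitT hq.2, ← hsq]
        ring), by
      have := hafter uₑ ⟨hu'ₑ, by linarith⟩
      rwa [huₑ, sub_sub_cancel, sub_sub_cancel] at this⟩
    (by linarith) (fun u hu => hafter u ⟨hu'ₑ.trans hu.1, hu.2⟩) hy
  refine ⟨?_, this.2⟩
  have hq' : 0 < q.1 * s := by rw [mul_comm, hsq]; exact abs_pos.2 hq.2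
  have := mul_pos_trans hq' this.1
  rwa [mul_comm]

/-- The shadow has the itinerary of the orbit that it follows. -/
theorem Shadow.follow (hS : L.Shadow K h p τ) (hsc : L.IsScale K σ η) {n : ℕ} {u : ℝ} {q : ℝ × ℝ}
    (hq : q ∈ I ×ˢ I) (hn : L.Avoids n q.1)
    (hclose : ∀ w ∈ Icc u (u + L.retSum n q),
      dist (L.flow (h w) p) (L.flow (w - u) (L.sec q.1 q.2)) < η)
    {y : ℝ} (hy : L.Aligned σ h p τ u y) :
    L.SameSide n y q.1 ∧ L.Aligned σ h p τ (u + L.retSum n q) (L.f^[n] y) := by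
  induction n generalizing u q y with
  | zero => exact ⟨fun j hj => absurd hj (by omega), by simpa [retSum] using hy⟩
  | succ n ih =>
    have hd : q ∈ dom := hn.iterate_P_mem_dom hq n.succ_pos
    have hPav : L.Avoids n (L.P q).1 := hn.tail 1 le_rfl
    have hsum := L.retSum_succ' n q
    have hpos := L.gap_lt_ret hd
    have hgap := L.gap_pos
    have hnn : 0 ≤ L.retSum n (L.P q) :=
      le_trans (by positivity) (hPav.mul_gap_le_retSum (L.P_mem hd))
    -- One return without a jump: the piece before the jump is reduced to a point.
    have hstep := hS.passage_of_jump hsc (u₀ := u) (u' := u) (u₁ := u + L.ret q.1 q.2) hq hd le_rfl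
      (by simpa using abs_le_of_mem_I hq.1)
      (by simpa using (abs_le_of_mem_I hq.1).trans (by norm_num)) (by simp)
      (fun w _ hw => by linarith)
      (fun w hw => hclose w ⟨hw.1, by linarith [hw.2]⟩)
      (fun w hw => by
        have := hclose w ⟨hw.1, by linarith [hw.2]⟩
        rwa [show L.ret q.1 q.2 - (u + L.ret q.1 q.2 - w) = w - u by ring]) hy
    have hrec := ih (u := u + L.ret q.1 q.2) (L.P_mem hd) hPav (fun w hw => by
      have := hclose w ⟨by linarith [hw.1], by linarith [hw.2]⟩
      rwa [← L.flow_ret hd, ← L.flow.map_add,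
        show w - (u + L.ret q.1 q.2) + L.ret q.1 q.2 = w - u by ring]) hstep.2
    refine ⟨fun j hj => ?_, ?_⟩
    · rcases j with _ | j
      · exact hstep.1
      · exact hrec.1 j (by omega)
    · rw [hsum, show u + (L.retSum n (L.P q) + L.ret q.1 q.2) =
        u + L.ret q.1 q.2 + L.retSum n (L.P q) by ring]
      exact hrec.2

end GeometricLorenzFlow
end Lorenz

/-! ### Averages, and the reduction of the three properties to one limit-pseudo orbit. -/

namespace Shadowing

theorem sum_Icc_one_eq (G : ℕ → ℝ) (n : ℕ) :
    ∑ i ∈ Finset.Icc 1 n, G i = ∑ i ∈ Finset.range n, G (i + 1) := by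
  induction n with
  | zero => simp
  | succ n ih => rw [Finset.sum_Icc_succ_top (by omega), Finset.sum_range_succ, ih]

/-- If the averages of a nonnegative sequence are small, then there are blocks of three small
terms. -/
theorem exists_block_lt {G : ℕ → ℝ} (hG : ∀ i, 0 ≤ G i) {ε : ℝ}
    (h : ∀ᶠ n : ℕ in atTop, (1 / (n : ℝ)) * ∑ i ∈ Finset.Icc 1 n, G i < ε) (N : ℕ) :
    ∃ j ≥ N, G (4 * j + 1) < 8 * ε ∧ G (4 * j + 2) < 8 * ε ∧ G (4 * j + 3) < 8 * ε := by
  -- Otherwise each late block of four terms contributes at least `8 * ε`, so the averages would be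
  -- at least about `2 * ε`.
  by_contra! hcon
  have hbad : ∀ j ≥ N, 8 * ε ≤ G (4 * j + 1) + G (4 * j + 2) + G (4 * j + 3) := by
    intro j hj
    by_contra! hlt
    have h1 := hG (4 * j + 1)
    have h2 := hG (4 * j + 2)
    have h3 := hG (4 * j + 3)
    linarith [hcon j hj (by linarith) (by linarith)]
  have hsum : ∀ M : ℕ, 8 * ε * M ≤ ∑ i ∈ Finset.range (4 * (N + M)), G (i + 1) := by
    intro M
    induction M with
    | zero => simpa using Finset.sum_nonneg fun i _ => hG (i + 1)
    | succ M ih =>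
      rw [show 4 * (N + (M + 1)) = 4 * (N + M) + 1 + 1 + 1 + 1 by ring, Finset.sum_range_succ,
        Finset.sum_range_succ, Finset.sum_range_succ, Finset.sum_range_succ]
      have h1 := hbad (N + M) (by omega)
      have h2 := hG (4 * (N + M) + 1 + 1 + 1 + 1)
      push_cast
      linarith
  obtain ⟨n₀, hn₀⟩ := eventually_atTop.1 h
  have hε : 0 < ε := lt_of_le_of_lt
    (mul_nonneg (by positivity) (Finset.sum_nonneg fun i _ => hG i)) (hn₀ n₀ le_rfl)
  have h1 := hn₀ (4 * (N + (N + n₀ + 1))) (by omega)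
  rw [sum_Icc_one_eq, one_div, inv_mul_lt_iff₀ (by positivity)] at h1
  have h2 := hsum (N + n₀ + 1)
  push_cast at h1 h2
  nlinarith [mul_nonneg hε.le (Nat.cast_nonneg (α := ℝ) n₀)]

variable {X : Type*} [MetricSpace X] {φ : Flow ℝ X} {x : ℤ → X} {t : ℤ → ℝ}

theorem posTime_succ (t : ℤ → ℝ) (n : ℕ) : posTime t (n + 1) = posTime t n + t n := by
  rw [posTime, Finset.sum_range_succ, posTime]

theorem posGap_nonneg (ht : ∀ i, 0 ≤ t i) (h : ℝ ≃o ℝ) (p : X) (i : ℕ) :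
    0 ≤ posGap φ x t h p i := by
  refine intervalIntegral.integral_nonneg ?_ fun u _ => dist_nonneg
  rw [posTime_succ]
  linarith [ht i]

/-- Only finitely many jumps are `δ` or larger, and `M` is their sum. The bound does not depend on
the position of `s`, as the uniformity in the shift `k` requires. -/
theorem exists_sum_jump_le (hj : Tendsto (jump φ x t) cofinite (𝓝 0)) {δ : ℝ} (hδ : 0 < δ) :
    ∃ M, ∀ s : Finset ℤ, ∑ i ∈ s, jump φ x t i ≤ s.card * δ + M := by
  have hfin : {i | ¬ jump φ x t i < δ}.Finite := hj.eventually (gt_mem_nhds hδ)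
  refine ⟨∑ i ∈ hfin.toFinset, jump φ x t i, fun s => ?_⟩
  have hnn : ∀ i, 0 ≤ jump φ x t i := fun i => dist_nonneg
  rw [← Finset.sum_filter_add_sum_filter_not s (fun i => jump φ x t i < δ)]
  refine add_le_add ?_ (Finset.sum_le_sum_of_subset_of_nonneg ?_ fun i _ _ => hnn i)
  · calc _ ≤ ∑ i ∈ s.filter (fun i => jump φ x t i < δ), δ :=
        Finset.sum_le_sum fun i hi => (Finset.mem_filter.1 hi).2.le
      _ = (s.filter (fun i => jump φ x t i < δ)).card * δ := by
        rw [Finset.sum_const, nsmul_eq_mul]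
      _ ≤ s.card * δ := by
        gcongr
        exact Finset.filter_subset _ _
  · intro i hi
    simpa using (Finset.mem_filter.1 hi).2

/-- A limit-pseudo orbit is an average-pseudo orbit for every accuracy. -/
theorem isAveragePseudoOrbit_of_tendsto (ht : ∀ i, 1 < t i)
    (hj : Tendsto (jump φ x t) cofinite (𝓝 0)) {δ : ℝ} (hδ : 0 < δ) :
    IsAveragePseudoOrbit φ δ x t := by
  obtain ⟨M, hM⟩ := exists_sum_jump_le hj (half_pos hδ)
  obtain ⟨N, hN⟩ := exists_nat_gt (2 * M / δ)
  refine ⟨fun i => (ht i).le, N + 1, N.succ_pos, fun n hn k => ?_⟩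
  have hn0 : (0 : ℝ) < n := by exact_mod_cast (show 0 < n by omega)
  have hinj : Function.Injective fun i : ℕ => (i : ℤ) + k := fun i j hij => by
    simpa using hij
  have h1 := hM ((Finset.Icc 1 n).map ⟨_, hinj⟩)
  rw [Finset.sum_map, Finset.card_map, Nat.card_Icc, Nat.add_sub_cancel] at h1
  simp only [Function.Embedding.coeFn_mk] at h1
  rw [one_div, inv_mul_lt_iff₀ hn0]
  have h2 : 2 * M < n * δ := by
    rw [← div_lt_iff₀ hδ]
    exact hN.trans (by exact_mod_cast (show N < n by omega))
  linarith

/-- A limit-pseudo orbit is an asymptotic average-pseudo orbit. -/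
theorem isAsymptoticAveragePseudoOrbit_of_tendsto (ht : ∀ i, 1 < t i)
    (hj : Tendsto (jump φ x t) cofinite (𝓝 0)) : IsAsymptoticAveragePseudoOrbit φ x t := by
  refine ⟨fun i => (ht i).le, Metric.tendsto_atTop.2 fun ε hε => ?_⟩
  obtain ⟨M, hM⟩ := exists_sum_jump_le hj (δ := ε / 6) (by linarith)
  obtain ⟨N, hN⟩ := exists_nat_gt (2 * M / ε)
  refine ⟨N + 1, fun n hn => ?_⟩
  have hn1 : (1 : ℝ) ≤ n := by exact_mod_cast (show 1 ≤ n by omega)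
  have hnn : 0 ≤ ∑ i ∈ Finset.Icc (-(n : ℤ)) (n : ℤ), jump φ x t i :=
    Finset.sum_nonneg fun i _ => dist_nonneg
  rw [Real.dist_eq, sub_zero, abs_of_nonneg (by positivity), one_div,
    inv_mul_lt_iff₀ (by linarith)]
  have h1 := hM (Finset.Icc (-(n : ℤ)) (n : ℤ))
  have hcard : ((Finset.Icc (-(n : ℤ)) (n : ℤ)).card : ℝ) = 2 * n + 1 := by
    rw [Int.card_Icc, show (n : ℤ) + 1 - -(n : ℤ) = ((2 * n + 1 : ℕ) : ℤ) by push_cast; ring,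
      Int.toNat_natCast]
    push_cast
    ring
  rw [hcard] at h1
  have h2 : 2 * M < n * ε := by
    rw [← div_lt_iff₀ hε]
    exact hN.trans (by exact_mod_cast (show N < n by omega))
  nlinarith

/-- One limit-pseudo orbit without good shadows in the average refutes all shadowing properties. -/
theorem not_shadowing_of_exists {Δ : ℝ} (ht : ∀ i, 1 < t i)
    (hj : Tendsto (jump φ x t) cofinite (𝓝 0)) {ε : ℝ} (hε : 0 < ε)
    (hno : ∀ p, ∀ h ∈ Rep Δ, ¬ ∀ᶠ n : ℕ in atTop,
      (1 / (n : ℝ)) * ∑ i ∈ Finset.Icc 1 n, posGap φ x t h p i < ε) :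
    ¬ HasASP φ Δ ∧ ¬ HasLSP φ Δ ∧ ¬ HasAASP φ Δ := by
  have ht0 : ∀ i, 0 ≤ t i := fun i => by linarith [ht i]
  refine ⟨fun hA => ?_, fun hA => ?_, fun hA => ?_⟩
  · obtain ⟨δ, hδ, hsh⟩ := hA ε hε
    obtain ⟨⟨p, h, hh, hlim⟩, -⟩ := hsh x t (isAveragePseudoOrbit_of_tendsto ht hj hδ)
    refine hno p h hh ?_
    filter_upwards [eventually_lt_of_limsup_lt hlim] with n hn
    exact EReal.coe_lt_coe_iff.1 hn
  · obtain ⟨⟨p, h, hh, hlim⟩, -⟩ := hA x t ⟨ht, hj⟩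
    refine hno p h hh ?_
    have := (hlim.comp (tendsto_add_atTop_nat 1)).cesaro
    filter_upwards [this.eventually (gt_mem_nhds hε)] with n hn
    rw [sum_Icc_one_eq, one_div]
    exact hn
  · obtain ⟨⟨p, h, hh, hlim⟩, -⟩ := hA x t (isAsymptoticAveragePseudoOrbit_of_tendsto ht hj)
    refine hno p h hh ?_
    filter_upwards [hlim.eventually (gt_mem_nhds hε)] with n hn
    refine lt_of_le_of_lt ?_ hn
    exact mul_le_mul_of_nonneg_left (Finset.sum_le_sum_of_subset_of_nonneg
      (Finset.Icc_subset_Icc_left zero_le_one) fun i _ _ => posGap_nonneg ht0 h p i) (by positivity)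

end Shadowing

/-! ### From closeness in the mean to uniform closeness. -/

namespace Lorenz

namespace GeometricLorenzFlow

variable (L : GeometricLorenzFlow)

/-- Curves that are close to orbits of the attractor in the mean are uniformly close to them. -/
theorem exists_uniform_close {K η : ℝ} (hK : 0 ≤ K) (hη : 0 < η) : ∃ ε > 0, ∀ (h : ℝ ≃o ℝ),
    (∀ u u', u ≤ u' → h u' - h u ≤ K * (u' - u)) →
    ∀ (p x : E3), x ∈ L.attractor → ∀ a b, a + 1 ≤ b →
    (∫ u in a..b, dist (L.flow (h u) p) (L.flow (u - a) x)) < ε →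
    ∀ u ∈ Icc a b, dist (L.flow (h u) p) (L.flow (u - a) x) < η := by
  have hcpt : IsCompact (Metric.cthickening η L.attractor) := L.isCompact_attractor.cthickening
  obtain ⟨κ₁, hκ₁, hmove⟩ := L.exists_forall_dist_flow_lt hcpt (show 0 < η / 4 by linarith)
  set κ := min (κ₁ / (K + 1)) (1 / 2) with hκdef
  have hκ : 0 < κ := by positivity
  have hκK : (K + 1) * κ ≤ κ₁ := by
    rw [mul_comm, ← le_div_iff₀ (by linarith)]
    exact min_le_left _ _
  have hκh : κ ≤ 1 / 2 := min_le_right _ _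
  refine ⟨κ * (η / 2), by positivity, fun h hlip p x hx a b hab hint => ?_⟩
  set d : ℝ → ℝ := fun u => dist (L.flow (h u) p) (L.flow (u - a) x) with hd
  have hcont : Continuous d :=
    (L.flow.continuous h.continuous continuous_const).dist
      (L.flow.continuous (by fun_prop) continuous_const)
  have hclaim : ∀ c, a ≤ c → c + κ ≤ b → ¬ ∀ u ∈ Icc c (c + κ), η / 2 ≤ d u := by
    intro c hac hcb hall
    have h1 : ∫ _u in c..(c + κ), (η / 2) ≤ ∫ u in c..(c + κ), d u :=
      intervalIntegral.integral_mono_on (by linarith) (by simp) (hcont.intervalIntegrable _ _) hall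
    have h2 : ∫ u in c..(c + κ), d u ≤ ∫ u in a..b, d u :=
      intervalIntegral.integral_mono_interval hac (by linarith) hcb
        (Eventually.of_forall fun u => dist_nonneg) (hcont.intervalIntegrable _ _)
    rw [intervalIntegral.integral_const, smul_eq_mul, add_sub_cancel_left] at h1
    linarith
  -- The orbit of `p` may be far from the attractor, where speeds are not controlled. When the
  -- distance is exactly `η`, both points lie in a compact neighbourhood of the attractor, and each
  -- moves by less than `η / 4` meanwhile.
  have hstay : ∀ u₀, d u₀ = η → ∀ u, |u - u₀| ≤ κ → η / 2 ≤ d u := by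
    intro u₀ h0 u hu
    have hxm : L.flow (u₀ - a) x ∈ L.attractor := L.isInvariant_attractor _ hx
    have h1 := hmove _ (Metric.self_subset_cthickening _ hxm) (u - u₀)
      (hu.trans (by nlinarith))
    have h2 := hmove (L.flow (h u₀) p)
      (Metric.mem_cthickening_of_dist_le _ _ _ _ hxm h0.le) (h u - h u₀) (by
        have hle : |h u - h u₀| ≤ K * |u - u₀| := by
          rcases le_total u u₀ with hc | hc
          · have := h.monotone hc
            rw [abs_of_nonpos (by linarith), abs_of_nonpos (by linarith)]
            linarith [hlip u u₀ hc]
          · have := h.monotone hc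
            rw [abs_of_nonneg (by linarith), abs_of_nonneg (by linarith)]
            exact hlip u₀ u hc
        nlinarith [abs_nonneg (u - u₀)])
    rw [← L.flow.map_add, sub_add_sub_cancel] at h1
    rw [← L.flow.map_add, sub_add_cancel] at h2
    have h3 := dist_triangle4 (L.flow (h u₀) p) (L.flow (h u) p) (L.flow (u - a) x)
      (L.flow (u₀ - a) x)
    rw [dist_comm (L.flow (h u₀) p) (L.flow (h u) p)] at h3
    simp only [hd] at h0 ⊢
    linarith
  by_contra! hbad
  obtain ⟨u₁, hu₁, hd₁⟩ := hbad
  by_cases hall : ∀ u ∈ Icc a b, η ≤ d u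
  · refine hclaim a le_rfl (by linarith) fun u hu => ?_
    linarith [hall u ⟨hu.1, by linarith [hu.2]⟩]
  · push Not at hall
    obtain ⟨u₂, hu₂, hd₂⟩ := hall
    have hsub : uIcc u₂ u₁ ⊆ Icc a b := uIcc_subset_Icc hu₂ hu₁
    obtain ⟨u₀, hu₀, h0⟩ := intermediate_value_uIcc (hcont.continuousOn (s := uIcc u₂ u₁))
      (mem_uIcc.2 (Or.inl ⟨hd₂.le, hd₁⟩) : η ∈ uIcc (d u₂) (d u₁))
    have hu₀ := hsub hu₀
    -- As `κ ≤ 1/2` and `b - a ≥ 1`, one of the two one-sided intervals of length `κ` at `u₀` fits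
    -- into `[a, b]`; it alone contributes `κ * (η / 2)` to the integral.
    rcases le_total (u₀ + κ) b with hc | hc
    · refine hclaim u₀ hu₀.1 hc fun u hu => hstay u₀ h0 u ?_
      rw [abs_le]; constructor <;> linarith [hu.1, hu.2]
    · refine hclaim (u₀ - κ) (by linarith) (by linarith [hu₀.2]) fun u hu => hstay u₀ h0 u ?_
      rw [abs_le]; constructor <;> linarith [hu.1, hu.2]

end GeometricLorenzFlow
end Lorenz

/-! ### Construction of bad loops. -/

namespace Lorenz

namespace GeometricLorenzFlow

variable {L : GeometricLorenzFlow} {K σ η τ : ℝ} {h : ℝ ≃o ℝ} {p : E3}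

/-- The shadow of a pseudo-orbit that jumps near the singularity to an orbit coming from the point
`q` of the section has the itinerary of `q`. -/
theorem Shadow.enter_follow (hS : L.Shadow K h p τ) (hsc : L.IsScale K σ η) {u₀ s₀ α : ℝ}
    {a q : ℝ × ℝ} (ha : a ∈ I ×ˢ I) (hq : q ∈ I ×ˢ I) {n : ℕ} (hn : L.Avoids (n + 1) q.1)
    (hu : u₀ ≤ s₀) (haexp : |a.1| * Real.exp (L.l₁ * (s₀ - u₀)) ≤ 1 / 2) (hα : 1 ≤ α)
    (hqexp : |q.1| * Real.exp (L.l₁ * α) ≤ 1 / 2)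
    (hbefore : ∀ u ∈ Icc u₀ s₀,
      dist (L.flow (h u) p) (L.flow (u - u₀) (L.sec a.1 a.2)) < η)
    (hafter : ∀ u ∈ Icc s₀ (s₀ + (L.retSum (n + 1) q - α)),
      dist (L.flow (h u) p) (L.flow (u - s₀) (L.flow α (L.sec q.1 q.2))) < η)
    {y : ℝ} (hy : L.Aligned σ h p τ u₀ y) : L.SameSide (n + 1) y q.1 ∧
      L.Aligned σ h p τ (s₀ + (L.retSum (n + 1) q - α)) (L.f^[n + 1] y) := by
  have hd : q ∈ dom := hn.iterate_P_mem_dom hq n.succ_pos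
  have hPav : L.Avoids n (L.P q).1 := hn.tail 1 le_rfl
  have hsum := L.retSum_succ' n q
  have hgap := L.gap_pos
  have hexit := L.exitT_lt_ret hd
  have hαe := L.add_gap_le_exitT hd.2 hqexp
  have hnn : 0 ≤ L.retSum n (L.P q) :=
    le_trans (by positivity) (hPav.mul_gap_le_retSum (L.P_mem hd))
  have hσ1 := hsc.σ_le_one
  have hstep := hS.passage_of_jump hsc (u₀ := u₀) (u' := s₀) (u₁ := s₀ + (L.ret q.1 q.2 - α)) ha hd
    hu haexp (by
      rw [show L.ret q.1 q.2 - (s₀ + (L.ret q.1 q.2 - α) - s₀) = α by ring]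
      linarith) (by linarith) (fun w _ hw => by linarith) hbefore
    (fun w hw => by
      have := hafter w ⟨hw.1, by linarith [hw.2]⟩
      rwa [← L.flow.map_add,
        show w - s₀ + α = L.ret q.1 q.2 - (s₀ + (L.ret q.1 q.2 - α) - w) by ring] at this) hy
  have hrec := hS.follow hsc (L.P_mem hd) hPav (fun w hw => by
    have := hafter w ⟨by linarith [hw.1], by linarith [hw.2]⟩
    rwa [← L.flow_ret hd, ← L.flow.map_add, show w - (s₀ + (L.ret q.1 q.2 - α)) + L.ret q.1 q.2 =
      w - s₀ + α by ring, L.flow.map_add]) hstep.2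
  refine ⟨fun j hj => ?_, ?_⟩
  · rcases j with _ | j
    · exact hstep.1
    · exact hrec.1 j (by omega)
  · rw [hsum, show s₀ + (L.retSum n (L.P q) + L.ret q.1 q.2 - α) =
      s₀ + (L.ret q.1 q.2 - α) + L.retSum n (L.P q) by ring]
    exact hrec.2

variable (L) in
/-- The orbit of `b` for time `t` ends on the singular leaf, after at least one return, except for a
last piece that approaches the singularity. -/
def EndsAtLeaf (b : E3) (t : ℝ) : Prop :=
  ∃ ρ y, 0 ≤ ρ ∧ ρ ≤ t ∧ y ∈ I ∧ L.flow (t - ρ) b = L.sec 0 y ∧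
    ∃ q ∈ dom, L.sec 0 y = L.sec (L.P q).1 (L.P q).2

variable (L) in
/-- No orbit follows first an orbit on the singular leaf, then the orbit of `a` for time `t`, and
then the orbit of `b` for time `t'`. -/
def Unfollowable (a : E3) (t : ℝ) (b : E3) (t' : ℝ) : Prop :=
  ∀ (K σ η τ : ℝ) (h : ℝ ≃o ℝ) (p : E3), L.Shadow K h p τ → L.IsScale K σ η →
    ∀ u₀ s₀ y y₀ : ℝ, u₀ ≤ s₀ → y ∈ I → L.Aligned σ h p τ u₀ y₀ →
    (∀ u ∈ Icc u₀ s₀, dist (L.flow (h u) p) (L.flow (u - u₀) (L.sec 0 y)) < η) →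
    (∀ u ∈ Icc s₀ (s₀ + t), dist (L.flow (h u) p) (L.flow (u - s₀) a) < η) →
    (∀ u ∈ Icc (s₀ + t) (s₀ + t + t'), dist (L.flow (h u) p) (L.flow (u - (s₀ + t)) b) < η) → False

variable (L) in
/-- Two pieces of orbits of the attractor that form, up to jumps of size `ε`, a loop at the
singularity that is not followed by any orbit. -/
structure BadLoop (ε : ℝ) (a : E3) (t : ℝ) (b : E3) (t' : ℝ) : Prop where
  left_mem : a ∈ L.attractor
  right_mem : b ∈ L.attractor
  one_lt_left : 1 < t
  one_lt_right : 1 < t'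
  dist_start : dist a 0 < ε
  dist_middle : dist (L.flow t a) b < ε
  dist_end : dist (L.flow t' b) 0 < ε
  endsAtLeaf : L.EndsAtLeaf b t'
  unfollowable : L.Unfollowable a t b t'

/-- A point near the singularity on an orbit of the attractor from a leaf close to the singular
leaf, on the left. -/
theorem exists_start {b β : ℝ} (hbI : b ∈ I) (hb : 0 < b)
    (hP : Tendsto L.P (edge (-1)) (𝓝[I ×ˢ I] (b, β))) {Q : ℝ × ℝ → Prop}
    (hQ : ∀ᶠ q in edge (-1), Q q) {δ : ℝ} (hδ : 0 < δ) :
    ∃ q ∈ dom, Q q ∧ q.1 < 0 ∧ |q.1| < δ ∧ L.sec q.1 q.2 ∈ L.attractor := by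
  have hlim := L.tendsto_f_left hP
  rw [edge, eventually_prod_principal_iff] at hQ
  have hmem : I ∈ 𝓝 (0 : ℝ) := Icc_mem_nhds (by norm_num) (by norm_num)
  have hne : NeBot (𝓝[I ∩ {x : ℝ | 0 < -1 * x}] 0) := by
    rw [inter_comm, nhdsWithin_inter_of_mem' (nhdsWithin_le_nhds hmem)]
    have : {x : ℝ | 0 < -1 * x} = Iio 0 := by ext x; simp
    rw [this]
    infer_instance
  have hsmall : ∀ᶠ x : ℝ in 𝓝 0, |x| < min δ b := by
    have := (continuous_abs.tendsto (0 : ℝ))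
    rw [abs_zero] at this
    exact this.eventually (gt_mem_nhds (lt_min hδ hb))
  obtain ⟨x, hxQ, hx, hxs⟩ := (hQ.and ((eventually_mem_nhdsWithin).and
    (nhdsWithin_le_nhds hsmall))).exists
  have hx0 : x < 0 := by
    have : 0 < -1 * x := hx.2
    linarith
  have hxb := hxs.trans_le (min_le_right _ _)
  rw [abs_of_neg hx0] at hxb
  obtain ⟨w, hw, hwΛ⟩ := L.exists_sec_mem_attractor hbI hb hlim (x := x) ⟨by linarith, by linarith⟩
  exact ⟨(x, w), ⟨⟨hx.1, hw⟩, hx0.ne⟩, hxQ w hw, hx0, hxs.trans_le (min_le_left _ _), hwΛ⟩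

theorem flow_mem_attractor {x : E3} (hx : x ∈ L.attractor) (t : ℝ) : L.flow t x ∈ L.attractor :=
  L.isInvariant_attractor t hx

theorem Aligned.mem_I {u y : ℝ} (hy : L.Aligned σ h p τ u y) : y ∈ I := by
  obtain ⟨t, v, -, -, hd, -⟩ := hy
  exact hd.1.1

/-- The case in which the left limit `b` of `f` at `0` is mapped to `0` by an iterate of `f`. -/
theorem exists_badLoop_of_iterate_eq_zero {b β : ℝ} (hbI : b ∈ I)
    (hb : 0 < b) (hP : Tendsto L.P (edge (-1)) (𝓝[I ×ˢ I] (b, β))) {m : ℕ} (hm : L.Avoids m b)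
    (hm0 : L.f^[m] b = 0) {ε : ℝ} (hε : 0 < ε) : ∃ a t b' t', L.BadLoop ε a t b' t' := by
  have hlim := L.tendsto_f_left hP
  obtain ⟨α, hα, δ, hδ, hnear⟩ := L.exists_passage_near_zero (half_pos hε)
  have hgap := L.gap_pos
  have hfP : Tendsto (fun q : ℝ × ℝ => L.f q.1) (edge (-1)) (𝓝[I] b) :=
    tendsto_nhdsWithin_iff.2 ⟨(continuous_fst.tendsto _).comp (hP.mono_right nhdsWithin_le_nhds), by
      filter_upwards [eventually_edge (-1)] with q hq using (L.P_mem hq.1).1⟩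
  have hsmall : ∀ᶠ q : ℝ × ℝ in edge (-1), |L.f^[m] (L.f q.1)| < δ := by
    have := (((hm.tendsto_iterate hbI).comp hfP).mono_right nhdsWithin_le_nhds).abs
    rw [hm0, abs_zero] at this
    exact this.eventually (gt_mem_nhds hδ)
  -- So close to the singular leaf that `f q.1` has the itinerary of `b` for `m` steps and then
  -- comes within `δ` of `0`. The loop switches there to the orbit of a leaf `z > 0` that later ends
  -- at `0`.
  obtain ⟨q, hq, ⟨hqside, hqsmall⟩, hq0, hqδ, hqΛ⟩ := exists_start hbI hb hP
    ((hfP.eventually (hm.eventually_sameSide hbI)).and hsmall) hδ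
  have hqav : L.Avoids (m + 1) q.1 := by
    intro j hj
    rcases j with _ | j
    · exact hq.2
    · exact hqside.symm.avoids j (by omega)
  obtain ⟨hqd, hqexp⟩ := hnear q.1 q.2 hqδ hq.1.2
  have hmb : Ioo 0 (min δ b) ⊆ I := fun z hz =>
    ⟨by linarith [hz.1], (hz.2.le.trans (min_le_right _ _)).trans hbI.2⟩
  obtain ⟨z, hz, k, hzk, hzk0⟩ := L.exists_iterate_eq_zero (lt_min hδ hb) hmb
  obtain ⟨w, hw, hwΛ⟩ := L.exists_sec_mem_attractor hbI hb hlim (x := z)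
    ⟨by linarith [hz.1], hz.2.trans_le (min_le_right _ _)⟩
  have hzd : (z, w) ∈ dom := ⟨⟨hmb hz, hw⟩, hz.1.ne'⟩
  obtain ⟨hzdist, hzexp⟩ := hnear z w (by
    rw [abs_of_pos hz.1]; exact hz.2.trans_le (min_le_left _ _)) hw
  obtain ⟨k, rfl⟩ : ∃ k', k = k' + 1 := Nat.exists_eq_succ_of_ne_zero (by
    rintro rfl; exact hz.1.ne' hzk0)
  have hlong : ∀ {n : ℕ} {q : ℝ × ℝ}, q ∈ I ×ˢ I → L.Avoids (n + 1) q.1 →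
      |q.1| * Real.exp (L.l₁ * α) ≤ 1 / 2 → α < L.retSum (n + 1) q := by
    intro n q hq hn hexp
    have hd : q ∈ dom := hn.iterate_P_mem_dom hq n.succ_pos
    have hPav : L.Avoids n (L.P q).1 := hn.tail 1 le_rfl
    have hnn : 0 ≤ L.retSum n (L.P q) :=
      le_trans (by positivity) (hPav.mul_gap_le_retSum (L.P_mem hd))
    rw [L.retSum_succ']
    linarith [L.exitT_lt_ret hd, L.add_gap_le_exitT hd.2 hexp]
  have hq2 := hqav.iterate_P_mem hq.1
  have hz2 := hzk.iterate_P_mem (q := (z, w)) hzd.1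
  have hq2x : (L.P^[m + 1] q).1 = L.f^[m] (L.f q.1) := L.fst_iterate_P _ _
  have hz2x : (L.P^[k + 1] (z, w)).1 = 0 := (L.fst_iterate_P _ _).trans hzk0
  obtain ⟨hq2d, hq2exp⟩ := hnear (L.P^[m + 1] q).1 (L.P^[m + 1] q).2 (by rwa [hq2x]) hq2.2
  obtain ⟨hz2d, -⟩ := hnear 0 (L.P^[k + 1] (z, w)).2 (by simpa using hδ) hz2.2
  have hflowq : L.flow (L.retSum (m + 1) q) (L.flow α (L.sec q.1 q.2)) =
      L.flow α (L.sec (L.P^[m + 1] q).1 (L.P^[m + 1] q).2) := by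
    rw [← hqav.flow_retSum hq.1, ← L.flow.map_add, ← L.flow.map_add, add_comm]
  have hflowz : L.flow (L.retSum (k + 1) (z, w)) (L.flow α (L.sec z w)) =
      L.flow α (L.sec 0 (L.P^[k + 1] (z, w)).2) := by
    have := hzk.flow_retSum (q := (z, w)) hzd.1
    rw [hz2x] at this
    rw [← this, ← L.flow.map_add, ← L.flow.map_add, add_comm]
  have hlq := hlong hq.1 hqav hqexp
  have hlz := hlong (q := (z, w)) hzd.1 hzk hzexp
  refine ⟨L.flow α (L.sec q.1 q.2), L.retSum (m + 1) q, L.flow α (L.sec z w),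
    L.retSum (k + 1) (z, w), flow_mem_attractor hqΛ _, flow_mem_attractor hwΛ _,
    by linarith, by linarith, by linarith, ?_, ?_, ?_, ?_⟩
  · rw [hflowq]
    have := dist_triangle_right (L.flow α (L.sec (L.P^[m + 1] q).1 (L.P^[m + 1] q).2))
      (L.flow α (L.sec z w)) 0
    linarith
  · rw [hflowz]; linarith
  · refine ⟨α, (L.P^[k + 1] (z, w)).2, by linarith, hlz.le, hz2.2, ?_, L.P^[k] (z, w),
      hzk.iterate_P_mem_dom (q := (z, w)) hzd.1 k.lt_succ_self, ?_⟩
    · rw [← L.flow.map_add, sub_add_cancel, hzk.flow_retSum (q := (z, w)) hzd.1, hz2x]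
    · rw [← Function.iterate_succ_apply' L.P, hz2x]
  · intro K σ η τ h p hS hsc u₀ s₀ y y₀ hu hy hal h1 h2 h3
    obtain ⟨hside, hal'⟩ := hS.enter_follow hsc (a := (0, y)) ⟨zero_mem_I, hy⟩ hq.1 hqav hu
      (by simp) (by linarith) hqexp h1 (fun u hu => h2 u ⟨hu.1, by linarith [hu.2]⟩) hal
    have hqpos := hS.passage_of_jump hsc (u₀ := s₀ + (L.retSum (m + 1) q - α))
      (u' := s₀ + L.retSum (m + 1) q) (u₁ := s₀ + L.retSum (m + 1) q + (L.ret z w - α)) hq2 hzd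
      (by linarith) (by
        rwa [show s₀ + L.retSum (m + 1) q - (s₀ + (L.retSum (m + 1) q - α)) = α by ring])
      (by
        rw [show L.ret (z, w).1 (z, w).2 - (s₀ + L.retSum (m + 1) q + (L.ret z w - α) -
          (s₀ + L.retSum (m + 1) q)) = α by ring]
        linarith) (by dsimp only; linarith) (fun v hv _ => by
          dsimp only; linarith [hsc.σ_le_one])
      (fun v hv => by
        have := h2 v ⟨by linarith [hv.1], hv.2⟩
        rwa [← hqav.flow_retSum hq.1, ← L.flow.map_add,
          show v - (s₀ + (L.retSum (m + 1) q - α)) + L.retSum (m + 1) q = v - s₀ + α by ring,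
          L.flow.map_add])
      (fun v hv => by
        have hle : L.ret z w ≤ L.retSum (k + 1) (z, w) := by
          have hPav : L.Avoids k (L.P (z, w)).1 := hzk.tail 1 le_rfl
          have : 0 ≤ L.retSum k (L.P (z, w)) :=
            le_trans (by positivity) (hPav.mul_gap_le_retSum (L.P_mem hzd))
          rw [L.retSum_succ']
          linarith
        have := h3 v ⟨hv.1, by linarith [hv.2]⟩
        rwa [← L.flow.map_add, show v - (s₀ + L.retSum (m + 1) q) + α = L.ret (z, w).1 (z, w).2 -
          (s₀ + L.retSum (m + 1) q + (L.ret z w - α) - v) by ring] at this) hal'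
    have hy0 := hside 0 m.succ_pos
    have hyneg : y₀ < 0 := by
      by_contra! hge
      exact absurd hy0 (not_lt.2 (mul_nonpos_of_nonneg_of_nonpos hge hq0.le))
    -- The follower shares the itinerary of `b` from strictly below, so its image when `b` reaches
    -- `0` is negative, whereas the second piece requires the sign of `z`.
    have hsame : L.SameSide m (L.f y₀) b := fun j hj =>
      mul_pos_trans (hside (j + 1) (by omega)) (hqside.symm j hj)
    have hlt := hsame.iterate_lt (L.f_mem _ hal.mem_I hyneg.ne) hbI
      (L.f_lt_branch_end hlim hal.mem_I hyneg)
    rw [hm0] at hlt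
    have := hqpos.1
    rw [Function.iterate_succ_apply] at this
    exact absurd this (not_lt.2 (mul_nonpos_of_nonpos_of_nonneg hlt.le hz.1.le))

/-- The case in which the iterates of the left limit `b` of `f` at `0` do not vanish. -/
theorem exists_badLoop_of_avoids (hL : L.f (1 / 2) < 1 / 2) {b β : ℝ} (hbI : b ∈ I) (hβ : β ∈ I)
    (hb : 0 < b) (hP : Tendsto L.P (edge (-1)) (𝓝[I ×ˢ I] (b, β))) (hav : ∀ n, L.Avoids n b)
    {ε : ℝ} (hε : 0 < ε) : ∃ a t b' t', L.BadLoop ε a t b' t' := by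
  have hlim := L.tendsto_f_left hP
  have hgap := L.gap_pos
  obtain ⟨α, hα, δ, hδ, hnear⟩ := L.exists_passage_near_zero hε
  set c := L.f b with hc
  have hcb : c < b := L.f_lt_self hL hbI hb
  have hc0 : 0 < c := L.f_branch_end_pos hbI hb hlim
  have hbd : (b, β) ∈ dom := ⟨⟨hbI, hβ⟩, hb.ne'⟩
  have hcI : c ∈ interior I := L.f_mem_interior hL hbI hb.ne'
  have hcav : ∀ n, L.Avoids n c := fun n => (hav (n + 1)).tail 1 le_rfl
  set γ := L.g b β
  have hγ : γ ∈ I := (L.P_mem hbd).2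
  have hunif := (isCompact_I.prod isCompact_I).uniformContinuousOn_of_continuous L.continuousOn_sec
  obtain ⟨κ, hκ, hκsec⟩ := Metric.uniformContinuousOn_iff.1 hunif (ε / 2) (half_pos hε)
  -- After `M` returns the unknown height `w` of the attractor point over `z` no longer matters,
  -- since leaves have shrunk below `κ / 2`. Also `M * gap > 1`, so the first piece lasts longer
  -- than `1`.
  obtain ⟨M, hMrate, hMgap⟩ := (((tendsto_pow_atTop_nhds_zero_of_lt_one L.rate_pos.le
    L.rate_lt).eventually (gt_mem_nhds (half_pos hκ))).and
    ((tendsto_natCast_atTop_atTop (R := ℝ)).eventually (eventually_gt_atTop (1 / L.gap)))).exists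
  rw [div_lt_iff₀ hgap] at hMgap
  have hfP : Tendsto (fun q : ℝ × ℝ => L.f q.1) (edge (-1)) (𝓝[I] b) :=
    tendsto_nhdsWithin_iff.2 ⟨(continuous_fst.tendsto _).comp (hP.mono_right nhdsWithin_le_nhds), by
      filter_upwards [eventually_edge (-1)] with q hq using (L.P_mem hq.1).1⟩
  have hitP : Tendsto (fun q => L.P^[M + 1] (L.P q)) (edge (-1))
      (𝓝[I ×ˢ I] (L.P^[M + 1] (b, β))) :=
    ((hav (M + 1)).tendsto_iterate_P (q := (b, β)) hL hbd.1).comp hP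
  have hsecP := (L.tendsto_sec_nhdsWithin
    ((hav (M + 1)).iterate_P_mem (q := (b, β)) hbd.1)).comp hitP
  obtain ⟨q, hq, ⟨hqside, hqclose⟩, hq0, hqδ, hqΛ⟩ := exists_start hbI hb hP
    ((hfP.eventually ((hav (M + 1)).eventually_sameSide hbI)).and
      (Metric.tendsto_nhds.1 hsecP (ε / 2) (half_pos hε))) hδ
  simp only [Function.comp_apply] at hqclose
  rw [Function.iterate_succ_apply L.P M (b, β)] at hqclose
  have hqav : L.Avoids (M + 2) q.1 := by
    intro j hj
    rcases j with _ | j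
    · exact hq.2
    · exact hqside.symm.avoids j (by omega)
  obtain ⟨hqd, hqexp⟩ := hnear q.1 q.2 hqδ hq.1.2
  have hside := (hcav (M + 1)).eventually_sameSide (interior_subset hcI)
  have hins : Tendsto (fun z : ℝ => (z, γ)) (𝓝[I] c) (𝓝[I ×ˢ I] (c, γ)) := by
    refine tendsto_nhdsWithin_iff.2 ⟨(Continuous.tendsto (by fun_prop) c).mono_left
      nhdsWithin_le_nhds, ?_⟩
    filter_upwards [self_mem_nhdsWithin] with z hz using ⟨hz, hγ⟩
  have hitc := (((hcav M).tendsto_iterate_P (q := (c, γ)) hL ⟨interior_subset hcI, hγ⟩).comp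
    hins).mono_right nhdsWithin_le_nhds
  have hev := hside.and (Metric.tendsto_nhds.1 hitc (κ / 2) (half_pos hκ))
  rw [tendsto_nhdsWithin_I hcI] at hev
  obtain ⟨r, hr, hball⟩ := Metric.eventually_nhds_iff.1 hev
  set ζ := min r (b - c)
  have hζ : 0 < ζ := lt_min hr (by linarith)
  have hζb : ∀ z ∈ Ioo c (c + ζ), z < b := fun z hz => by
    have : ζ ≤ b - c := min_le_right _ _
    linarith [hz.2]
  have hζI : Ioo c (c + ζ) ⊆ I := fun z hz =>
    ⟨by linarith [hz.1], (hζb z hz).le.trans hbI.2⟩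
  -- Here `z` lies between `c = f b` and `b`, so its leaf meets the attractor, and it is near enough
  -- to `c` to accompany it for `M` returns.
  obtain ⟨z, hz, k, hzk, hzk0, hno⟩ := L.exists_unrealized_itinerary hζ hζI
  obtain ⟨hzside, hzclose⟩ := hball (y := z) (by
    rw [Real.dist_eq, abs_of_pos (by linarith [hz.1])]
    have : ζ ≤ r := min_le_left _ _
    linarith [hz.2])
  simp only [Function.comp_apply] at hzclose
  have hMk : M < k := by
    by_contra! hle
    exact hzside.symm.avoids k (by omega) hzk0
  obtain ⟨w, hw, hwΛ⟩ := L.exists_sec_mem_attractor hbI hb hlim (x := z)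
    ⟨by linarith [hz.1], hζb z hz⟩
  obtain ⟨n, rfl⟩ : ∃ n, k = M + (n + 1) := ⟨k - M - 1, by omega⟩
  have hzM : L.Avoids M z := hzk.mono (by omega)
  have hzI := hζI hz
  set B := L.P^[M] (z, w)
  have hBmem : B ∈ I ×ˢ I := hzM.iterate_P_mem (q := (z, w)) ⟨hzI, hw⟩
  have hB1 : B.1 = L.f^[M] z := L.fst_iterate_P _ _
  have hBav : L.Avoids (n + 1) B.1 := by rw [hB1]; exact hzk.tail M (by omega)
  have hBend := hBav.iterate_P_mem hBmem
  have hBend1 : (L.P^[n + 1] B).1 = 0 := by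
    rw [fst_iterate_P, hB1, ← Function.iterate_add_apply, add_comm]
    exact hzk0
  obtain ⟨hBd, -⟩ := hnear 0 (L.P^[n + 1] B).2 (by simpa using hδ) hBend.2
  have hBflow := hBav.flow_retSum hBmem
  have hBnn : 0 ≤ L.retSum (n + 1) B := le_trans (by positivity) (hBav.mul_gap_le_retSum hBmem)
  have hqflow : L.flow (L.retSum (M + 2) q - α) (L.flow α (L.sec q.1 q.2)) =
      L.sec (L.P^[M + 2] q).1 (L.P^[M + 2] q).2 := by
    rw [← L.flow.map_add, sub_add_cancel, hqav.flow_retSum hq.1]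
  have hqlong : 1 < L.retSum (M + 2) q - α := by
    have hPav : L.Avoids (M + 1) (L.P q).1 := hqav.tail 1 le_rfl
    have h1 := hPav.mul_gap_le_retSum (L.P_mem hq)
    rw [L.retSum_succ']
    push_cast at h1
    linarith [L.exitT_lt_ret hq, L.add_gap_le_exitT hq.2 hqexp]
  refine ⟨L.flow α (L.sec q.1 q.2), L.retSum (M + 2) q - α, L.sec B.1 B.2,
    L.retSum (n + 1) B + α, flow_mem_attractor hqΛ _, ?_, hqlong, by linarith, hqd, ?_, ?_, ?_, ?_⟩
  · have := hzM.flow_retSum (q := (z, w)) ⟨hzI, hw⟩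
    rw [← this]
    exact flow_mem_attractor hwΛ _
  · rw [hqflow]
    have h1 : dist (L.P^[M] (z, w)) (L.P^[M] (z, γ)) < κ / 2 :=
      (hzM.dist_iterate_P_le hzI hw hγ).trans_lt hMrate
    have h2 : dist B (L.P^[M] (c, γ)) < κ := by
      have := dist_triangle (L.P^[M] (z, w)) (L.P^[M] (z, γ)) (L.P^[M] (c, γ))
      linarith
    have h3 := hκsec _ hBmem _
      ((hcav M).iterate_P_mem (q := (c, γ)) ⟨interior_subset hcI, hγ⟩) h2
    have h4 := dist_triangle_right (L.sec (L.P^[M + 2] q).1 (L.P^[M + 2] q).2) (L.sec B.1 B.2)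
      (L.sec (L.P^[M] (c, γ)).1 (L.P^[M] (c, γ)).2)
    have h5 : dist (L.sec (L.P^[M + 2] q).1 (L.P^[M + 2] q).2)
      (L.sec (L.P^[M] (c, γ)).1 (L.P^[M] (c, γ)).2) < ε / 2 := hqclose
    linarith
  · rw [add_comm, L.flow.map_add, hBflow, hBend1]
    exact hBd
  · refine ⟨α, (L.P^[n + 1] B).2, by linarith, by linarith, hBend.2, ?_, L.P^[n] B,
      hBav.iterate_P_mem_dom hBmem n.lt_succ_self, ?_⟩
    · rw [add_sub_cancel_right, hBflow, hBend1]
    · rw [← Function.iterate_succ_apply' L.P, hBend1]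
  · intro K σ η τ h p hS hsc u₀ s₀ y y₀ hu hy hal h1 h2 h3
    obtain ⟨hsideA, hal'⟩ := hS.enter_follow hsc (a := (0, y)) ⟨zero_mem_I, hy⟩ hq.1 hqav hu
      (by simp) (by linarith) hqexp h1 h2 hal
    obtain ⟨hsideB, -⟩ := hS.follow hsc hBmem hBav
      (fun v hv => h3 v ⟨hv.1, by linarith [hv.2]⟩) hal'
    have hneg : y₀ < 0 := by
      by_contra! hge
      exact absurd (hsideA 0 (by omega)) (not_lt.2 (mul_nonpos_of_nonneg_of_nonpos hge hq0.le))
    have hy1I := L.f_mem _ hal.mem_I hneg.ne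
    have hy1b := L.f_lt_branch_end hlim hal.mem_I hneg
    have hy1 : 0 < L.f y₀ * b :=
      mul_pos_trans (hsideA 1 (by omega)) (hqside.symm 0 (by omega))
    have hy1pos : 0 < L.f y₀ := pos_of_mul_pos_left hy1 hb.le
    -- The second image of the follower's leaf lies left of `c` but would have the itinerary of `z`:
    -- for `M` steps through `q`, `b` and `c`, afterwards through the second piece.
    refine hno (L.f (L.f y₀)) (L.f_mem _ hy1I hy1pos.ne') (L.f_lt hy1I hbI hy1 hy1b) fun j hj => ?_
    rcases lt_or_ge j M with hjM | hjM
    · exact mul_pos_trans (mul_pos_trans (hsideA (j + 2) (by omega))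
        (hqside.symm (j + 1) (by omega))) (hzside j (by omega))
    · obtain ⟨i, rfl⟩ := Nat.exists_eq_add_of_le hjM
      have := hsideB i (by omega)
      rw [hB1, ← Function.iterate_add_apply, ← Function.iterate_add_apply] at this
      rw [add_comm M i]
      exact this

theorem exists_badLoop (hL : L.f (1 / 2) < 1 / 2) {ε : ℝ} (hε : 0 < ε) :
    ∃ a t b t', L.BadLoop ε a t b t' := by
  classical
  obtain ⟨b, β, hb, hβ, hP⟩ := L.exists_branch_end
  have hpos := L.branch_end_pos hL (L.tendsto_f_left hP)
  by_cases hex : ∃ m, L.f^[m] b = 0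
  · exact exists_badLoop_of_iterate_eq_zero hb hpos hP (fun j hj => Nat.find_min hex hj)
      (Nat.find_spec hex) hε
  · push Not at hex
    exact exists_badLoop_of_avoids hL hb hβ hpos hP (fun _ j _ => hex j) hε

end GeometricLorenzFlow
end Lorenz

/-! ### Concatenation of the loops and conclusion. -/

theorem Shadowing.Rep.sub_le {Δ : ℝ} {h : ℝ ≃o ℝ} (hh : h ∈ Shadowing.Rep Δ) {u u' : ℝ}
    (hu : u ≤ u') : h u' - h u ≤ (1 + Δ) * (u' - u) := by
  rcases hu.eq_or_lt with rfl | hlt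
  · simp
  · have := (abs_le.1 (hh.2 u' u hlt.ne')).2
    rw [← div_le_iff₀ (sub_pos.2 hlt)]
    linarith

theorem Shadowing.jump_restrict {Y : Type*} [MetricSpace Y] (φ : Flow ℝ Y) {X : Set Y}
    (hX : IsInvariant φ X) (x : ℤ → X) (t : ℤ → ℝ) :
    jump (φ.restrict hX) x t = jump φ (fun i => x i) t := rfl

theorem Shadowing.posGap_restrict {Y : Type*} [MetricSpace Y] (φ : Flow ℝ Y) {X : Set Y}
    (hX : IsInvariant φ X) (x : ℤ → X) (t : ℤ → ℝ) (h : ℝ ≃o ℝ) (p : X) (i : ℕ) :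
    posGap (φ.restrict hX) x t h p i = posGap φ (fun i => x i) t h p i := rfl

/-- The sequence on `ℤ` that alternates between two sequences and is constant on the left. -/
def interleave {α : Type*} (d : α) (a b : ℕ → α) (i : ℤ) : α :=
  if i < 0 then d else if i % 2 = 0 then a (i / 2).toNat else b (i / 2).toNat

section interleave

variable {α : Type*} (d : α) (a b : ℕ → α)

theorem interleave_of_neg {i : ℤ} (hi : i < 0) : interleave d a b i = d := if_pos hi

theorem interleave_even (n : ℕ) : interleave d a b ((2 * n : ℕ) : ℤ) = a n := by
  rw [interleave, if_neg (by omega), if_pos (by omega)]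
  congr 1
  omega

theorem interleave_odd (n : ℕ) : interleave d a b ((2 * n + 1 : ℕ) : ℤ) = b n := by
  rw [interleave, if_neg (by omega), if_neg (by omega)]
  congr 1
  omega

theorem interleave_induction {Q : α → Prop} (hd : Q d) (ha : ∀ n, Q (a n)) (hb : ∀ n, Q (b n))
    (i : ℤ) : Q (interleave d a b i) := by
  unfold interleave
  split_ifs
  exacts [hd, ha _, hb _]

end interleave

namespace Lorenz

namespace GeometricLorenzFlow

variable {L : GeometricLorenzFlow} {K σ η : ℝ} {h : ℝ ≃o ℝ} {p : E3}

theorem IsScale.mono (hsc : L.IsScale K σ η) {η' : ℝ} (h0 : 0 < η') (hle : η' ≤ η) :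
    L.IsScale K σ η' where
  σ_pos := hsc.σ_pos
  σ_le_one := hsc.σ_le_one
  η_pos := h0
  σ_lt_gap := hsc.σ_lt_gap
  separation q hq q' hq' t h h' := hle.trans (hsc.separation q hq q' hq' t h h')
  face_section s hs p hp θ hθ r hr := hle.trans (hsc.face_section s hs p hp θ hθ r hr)
  face_side s hs p hp r hr := hle.trans (hsc.face_side s hs p hp r hr)
  wrong_side_face s hs p hp r hr := hle.trans (hsc.wrong_side_face s hs p hp r hr)
  lower_section p hp r hr := hle.trans (hsc.lower_section p hp r hr)

variable (L) in
-- Excludes convergence to the singularity for an orbit that keeps coming close to the section.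
theorem exists_dist_zero_section : ∃ d > 0, ∀ r ∈ sectionOf L.chart, d ≤ dist r 0 := by
  have hdisj : Disjoint (sectionOf L.chart) (L.box {v | v 2 = 0}) :=
    L.section_disjoint_box fun v (hv : v 2 = 0) => by rw [hv]; exact zero_ne_one
  obtain ⟨d, hd, hdist⟩ := hdisj.exists_forall_le_dist L.isCompact_section
    (L.isCompact_box (isClosed_eq (continuous_coord 2) continuous_const))
  refine ⟨d, hd, fun r hr => hdist r hr 0 ?_⟩
  rw [← L.pt_zero]
  exact L.pt_mem_box (by simp) (by simp) (by simp) rfl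

/-- An orbit that enters the trapping region and comes close to the section again and again visits
the section regularly. -/
theorem exists_shadow (hlip : ∀ u u', u ≤ u' → h u' - h u ≤ K * (u' - u)) {u : ℝ}
    (hU : L.flow (h u) p ∈ L.U) {d : ℝ} (hd : 0 < d)
    (hd0 : ∀ r ∈ sectionOf L.chart, d ≤ dist r 0)
    (hfar : ∀ R, ∃ u ≥ R, ∃ r ∈ sectionOf L.chart, dist (L.flow (h u) p) r < d / 2) :
    ∃ τ, L.Shadow K h p τ := by
  have hno : ¬ Tendsto (fun t => L.flow t p) atTop (𝓝 0) := by
    intro hlim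
    have hlim' := hlim.comp h.tendsto_atTop
    obtain ⟨R, hR⟩ := eventually_atTop.1 (Metric.tendsto_nhds.1 hlim' (d / 2) (half_pos hd))
    obtain ⟨u, hu, r, hr, hclose⟩ := hfar R
    have h1 := hR u hu
    have h2 := hd0 r hr
    have h3 := dist_triangle_left r 0 (L.flow (h u) p)
    simp only [Function.comp_apply] at h1
    linarith
  have hno' : ∀ t₀ : ℝ, ¬ Tendsto (fun t => L.flow t (L.flow t₀ p)) atTop (𝓝 0) := by
    intro t₀ hlim
    refine hno ((hlim.comp (tendsto_atTop_add_const_right atTop (-t₀) tendsto_id)).congr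
      fun t => ?_)
    simp only [Function.comp_apply, id]
    rw [← L.flow.map_add, neg_add_cancel_right]
  obtain ⟨t, -, ht⟩ := (L.section_or_singularity _ hU).resolve_right (hno' _)
  rw [← L.flow.map_add] at ht
  refine ⟨t + h u, hlip, ht, fun t' _ ht' => ?_⟩
  obtain ⟨x, hx, y, hy, he⟩ := L.exists_eq_sec ht'
  refine ⟨(x, y), ⟨⟨hx, hy⟩, ?_⟩, he⟩
  rintro (rfl : x = 0)
  exact hno' t' (he ▸ L.tendsto_flow_sec_zero hy)

/-- No orbit follows the concatenation of bad loops. -/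
theorem false_of_follows_badLoops (hsc : L.IsScale K σ η)
    (hlip : ∀ u u', u ≤ u' → h u' - h u ≤ K * (u' - u))
    (hU : Metric.thickening η L.attractor ⊆ L.U) {d : ℝ} (hd : 0 < d) (hηd : η ≤ d / 2)
    (hd0 : ∀ r ∈ sectionOf L.chart, d ≤ dist r 0) {a b : ℕ → E3} {t t' ε : ℕ → ℝ}
    (hbad : ∀ i, L.BadLoop (ε i) (a i) (t i) (b i) (t' i))
    (hfollow : ∀ R : ℝ, ∃ s ≥ R, ∃ i,
      (∀ u ∈ Icc s (s + t' i), dist (L.flow (h u) p) (L.flow (u - s) (b i)) < η) ∧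
      (∀ u ∈ Icc (s + t' i) (s + t' i + t (i + 1)),
        dist (L.flow (h u) p) (L.flow (u - (s + t' i)) (a (i + 1))) < η) ∧
      (∀ u ∈ Icc (s + t' i + t (i + 1)) (s + t' i + t (i + 1) + t' (i + 1)),
        dist (L.flow (h u) p) (L.flow (u - (s + t' i + t (i + 1))) (b (i + 1))) < η)) :
    False := by
  obtain ⟨τ, hS⟩ : ∃ τ, L.Shadow K h p τ := by
    obtain ⟨s, -, i, hs, -⟩ := hfollow 0
    have hpos := (hbad i).one_lt_right
    refine exists_shadow hlip (u := s) (hU ?_) hd hd0 fun R => ?_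
    · refine Metric.mem_thickening_iff.2 ⟨_, (hbad i).right_mem, ?_⟩
      have := hs s ⟨le_rfl, by linarith⟩
      rwa [sub_self, L.flow.map_zero_apply] at this
    · obtain ⟨s, hsR, i, hs, -⟩ := hfollow R
      obtain ⟨ρ, y, hρ, hρt, hy, hflow, -⟩ := (hbad i).endsAtLeaf
      refine ⟨s + (t' i - ρ), by linarith, L.sec 0 y, L.sec_mem zero_mem_I hy, ?_⟩
      have := hs (s + (t' i - ρ)) ⟨by linarith, by linarith⟩
      rw [add_sub_cancel_left, hflow] at this
      exact this.trans_le hηd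
  obtain ⟨R, hR⟩ := eventually_atTop.1 (h.tendsto_atTop.eventually (eventually_ge_atTop τ))
  obtain ⟨s, hsR, i, h1, h2, h3⟩ := hfollow R
  obtain ⟨ρ, y, hρ, hρt, hy, hflow, q, hq, hyq⟩ := (hbad i).endsAtLeaf
  have hclose := h1 (s + (t' i - ρ)) ⟨by linarith, by linarith⟩
  rw [add_sub_cancel_left, hflow, hyq] at hclose
  -- The end of one loop supplies the initial alignment for the next: its point on the singular leaf
  -- is a return point, so the follower crosses the section at about that time.
  obtain ⟨y₀, hal⟩ := hS.exists_aligned hsc (u := s + (t' i - ρ)) (hR _ (by linarith)) hq hclose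
  refine (hbad (i + 1)).unfollowable K σ η τ h p hS hsc (s + (t' i - ρ)) (s + t' i) y y₀
    (by linarith) hy hal (fun u hu => ?_) h2 h3
  have := h1 u ⟨by linarith [hu.1], hu.2⟩
  rwa [← hflow, ← L.flow.map_add, show u - (s + (t' i - ρ)) + (t' i - ρ) = u - s by ring]

theorem tendsto_jump_interleave {a b : ℕ → E3} {t t' : ℕ → ℝ}
    (hbad : ∀ i : ℕ, L.BadLoop (1 / ((i : ℝ) + 1)) (a i) (t i) (b i) (t' i)) :
    Tendsto (Shadowing.jump L.flow (interleave 0 a b) (interleave 2 t t')) cofinite (𝓝 0) := by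
  rw [Int.cofinite_eq, tendsto_sup]
  constructor
  · refine tendsto_const_nhds.congr' ?_
    filter_upwards [eventually_le_atBot (-2 : ℤ)] with i hi
    rw [Shadowing.jump, interleave_of_neg _ _ _ (by omega), interleave_of_neg _ _ _ (by omega),
      interleave_of_neg _ _ _ (by omega), L.flow_zero, dist_self]
  -- The jump inside loop `m`, of index `2m`, is below `1/(m+1)`. The jump to the next loop, of
  -- index `2m+1`, passes through `0` and is below `2/(m+1) = 4/(2m+2)`.
  · have hle : ∀ n : ℕ, Shadowing.jump L.flow (interleave 0 a b) (interleave 2 t t') (n : ℤ) ≤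
        4 / (((n : ℤ) : ℝ) + 1) := by
      intro n
      rw [Shadowing.jump, Int.cast_natCast]
      obtain ⟨m, rfl | rfl⟩ := n.even_or_odd'
      · rw [show ((2 * m : ℕ) : ℤ) + 1 = ((2 * m + 1 : ℕ) : ℤ) by push_cast; ring,
          interleave_even, interleave_even, interleave_odd]
        refine (hbad m).dist_middle.le.trans ?_
        rw [div_le_div_iff₀ (by positivity) (by positivity)]
        push_cast
        linarith [(Nat.cast_nonneg m : (0 : ℝ) ≤ m)]
      · rw [show ((2 * m + 1 : ℕ) : ℤ) + 1 = ((2 * (m + 1) : ℕ) : ℤ) by push_cast; ring,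
          interleave_even, interleave_odd, interleave_odd]
        have h1 := (hbad m).dist_end
        have h2 := (hbad (m + 1)).dist_start
        have h3 := dist_triangle_right (L.flow (t' m) (b m)) (a (m + 1)) 0
        have h4 : (1 : ℝ) / (((m + 1 : ℕ) : ℝ) + 1) ≤ 1 / ((m : ℝ) + 1) := by
          refine one_div_le_one_div_of_le (by positivity) ?_
          push_cast
          linarith
        have h5 : (4 : ℝ) / (((2 * m + 1 : ℕ) : ℝ) + 1) =
            1 / ((m : ℝ) + 1) + 1 / ((m : ℝ) + 1) := by
          push_cast
          field_simp
          ring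
        linarith
    have hlim : Tendsto (fun i : ℤ => 4 / ((i : ℝ) + 1)) atTop (𝓝 0) :=
      (tendsto_atTop_add_const_right atTop (1 : ℝ) tendsto_intCast_atTop_atTop).const_div_atTop 4
    refine tendsto_of_tendsto_of_tendsto_of_le_of_le' tendsto_const_nhds hlim
      (Eventually.of_forall fun i => dist_nonneg) ?_
    filter_upwards [eventually_ge_atTop 0] with i hi
    lift i to ℕ using hi
    exact hle i

theorem not_shadowing (hL : L.f (1 / 2) < 1 / 2) {X : Set E3} (hX : IsInvariant L.flow X)
    (hLX : L.attractor ⊆ X) {Δ : ℝ} (hΔ : 0 ≤ Δ) :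
    ¬ Shadowing.HasASP (L.flow.restrict hX) Δ ∧
    ¬ Shadowing.HasLSP (L.flow.restrict hX) Δ ∧
    ¬ Shadowing.HasAASP (L.flow.restrict hX) Δ := by
  choose a t b t' hbad using fun i : ℕ =>
    exists_badLoop hL (show 0 < 1 / ((i : ℝ) + 1) by positivity)
  have hmem : ∀ i, interleave 0 a b i ∈ L.attractor := interleave_induction 0 a b
    L.zero_mem_attractor (fun n => (hbad n).left_mem) fun n => (hbad n).right_mem
  have htime : ∀ i, 1 < interleave 2 t t' i := interleave_induction 2 t t' one_lt_two
    (fun n => (hbad n).one_lt_left) fun n => (hbad n).one_lt_right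
  obtain ⟨σ, η₀, hsc₀⟩ := L.exists_isScale hL (show 0 ≤ 1 + Δ by linarith)
  obtain ⟨d, hd, hd0⟩ := L.exists_dist_zero_section
  obtain ⟨r, hr, hrU⟩ := L.isCompact_attractor.exists_thickening_subset_open isOpen_interior
    L.attractor_subset_interior
  -- The bound `r` forces followers into `U`, and `d / 2` keeps them away from `0` near the section.
  set η := min η₀ (min r (d / 2))
  have hη : 0 < η := lt_min hsc₀.η_pos (lt_min hr (half_pos hd))
  have hsc := hsc₀.mono hη (min_le_left _ _)
  have hηr : η ≤ r := (min_le_right _ _).trans (min_le_left _ _)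
  have hηd : η ≤ d / 2 := (min_le_right _ _).trans (min_le_right _ _)
  have hU : Metric.thickening η L.attractor ⊆ L.U :=
    (Metric.thickening_mono hηr _).trans (hrU.trans interior_subset)
  obtain ⟨ε, hε, hclose⟩ := L.exists_uniform_close (show 0 ≤ 1 + Δ by linarith) hη
  set x : ℤ → X := fun i => ⟨interleave 0 a b i, hLX (hmem i)⟩
  have hjump : Tendsto (Shadowing.jump (L.flow.restrict hX) x (interleave 2 t t')) cofinite
      (𝓝 0) := by
    rw [Shadowing.jump_restrict]
    exact tendsto_jump_interleave hbad
  refine Shadowing.not_shadowing_of_exists htime hjump (ε := ε / 8) (by linarith)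
    fun p h hh hev => ?_
  have hlip : ∀ u u', u ≤ u' → h u' - h u ≤ (1 + Δ) * (u' - u) := fun u u' hu =>
    Shadowing.Rep.sub_le hh hu
  set s : ℕ → ℝ := Shadowing.posTime (interleave 2 t t')
  have hs : ∀ n, s (n + 1) = s n + interleave 2 t t' n := Shadowing.posTime_succ _
  have hsn : ∀ n : ℕ, (n : ℝ) ≤ s n := by
    intro n
    induction n with
    | zero => simp [s, Shadowing.posTime]
    | succ n ih =>
      rw [hs]
      push_cast
      linarith [htime n]
  have hseg : ∀ n : ℕ, Shadowing.posGap (L.flow.restrict hX) x (interleave 2 t t') h p n <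
      8 * (ε / 8) → ∀ u ∈ Icc (s n) (s (n + 1)),
      dist (L.flow (h u) p) (L.flow (u - s n) (interleave 0 a b n)) < η := by
    intro n hn
    refine hclose h hlip p _ (hmem n) _ _ ?_ ?_
    · rw [hs]; linarith [htime n]
    · rw [Shadowing.posGap_restrict, Shadowing.posGap] at hn
      linarith
  refine false_of_follows_badLoops hsc hlip hU hd hηd hd0 (p := p) hbad fun R => ?_
  obtain ⟨N, hN⟩ := exists_nat_ge R
  -- The indices `4j+1`, `4j+2`, `4j+3` are the second half of loop `2j` and the two halves of loop
  -- `2j+1`.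
  obtain ⟨j, hj, h1, h2, h3⟩ := Shadowing.exists_block_lt
    (fun i => Shadowing.posGap_nonneg (fun i => by linarith [htime i]) h p i) hev N
  have e1 := hs (2 * (2 * j) + 1)
  have e2 := hs (2 * (2 * j + 1))
  have e3 := hs (2 * (2 * j + 1) + 1)
  rw [interleave_odd] at e1 e3
  rw [interleave_even] at e2
  have c1 := hseg (2 * (2 * j) + 1) (by rw [show 2 * (2 * j) + 1 = 4 * j + 1 by ring]; exact h1)
  have c2 := hseg (2 * (2 * j + 1)) (by rw [show 2 * (2 * j + 1) = 4 * j + 2 by ring]; exact h2)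
  have c3 := hseg (2 * (2 * j + 1) + 1)
    (by rw [show 2 * (2 * j + 1) + 1 = 4 * j + 3 by ring]; exact h3)
  rw [interleave_odd, e1] at c1
  rw [interleave_even, e2, show 2 * (2 * j + 1) = 2 * (2 * j) + 1 + 1 by ring, e1] at c2
  rw [interleave_odd, e3, e2, show 2 * (2 * j + 1) = 2 * (2 * j) + 1 + 1 by ring, e1] at c3
  refine ⟨s (2 * (2 * j) + 1), ?_, 2 * j, c1, c2, c3⟩
  have := hsn (2 * (2 * j) + 1)
  push_cast at this
  have hjN : (N : ℝ) ≤ j := Nat.cast_le.2 hj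
  linarith [(Nat.cast_nonneg j : (0 : ℝ) ≤ j)]

/-- If one of the outer leaves is not invariant, then `f` moves the end of the section inwards. -/
theorem f_half_lt (hL : L.leaf (L.f (1 / 2)) ≠ L.leaf (1 / 2) ∨
    L.leaf (L.f (-(1 / 2))) ≠ L.leaf (-(1 / 2))) : L.f (1 / 2) < 1 / 2 := by
  have hh : (1 / 2 : ℝ) ∈ I := by rw [mem_I]; norm_num
  have hle := (L.f_mem _ hh (by norm_num)).2
  refine lt_of_le_of_ne hle fun he => ?_
  rcases hL with h | h
  · exact h (by rw [he])
  · exact h (by rw [L.f_odd _ hh (by norm_num), he])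

end GeometricLorenzFlow
end Lorenz

theorem theorem1 (L : Lorenz.GeometricLorenzFlow)
    (hL : L.leaf (L.f (1 / 2)) ≠ L.leaf (1 / 2) ∨ L.leaf (L.f (-(1 / 2))) ≠ L.leaf (-(1 / 2)))
    (X : Set Lorenz.E3) (hX : IsInvariant L.flow X) (hLX : L.attractor ⊆ X)
    (Δ : ℝ) (hΔ : 0 ≤ Δ) :
    ¬ Shadowing.HasASP (L.flow.restrict hX) Δ ∧
    ¬ Shadowing.HasLSP (L.flow.restrict hX) Δ ∧
    ¬ Shadowing.HasAASP (L.flow.restrict hX) Δ :=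
  Lorenz.GeometricLorenzFlow.not_shadowing (Lorenz.GeometricLorenzFlow.f_half_lt hL) hX hLX hΔ
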